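/- **Setting.** Let $T>0$, $Q_T=(0,T)\times\mathbb R$, and consider $\partial_t u+\partial_x\big(f(u)\,\nu(\mu*\beta(u))\big)=0$ on $Q_T$ with $u(0,\cdot)=u_0$, where $f$ is Lipschitz on $\mathbb R$ with $f(0)=0$; $\beta,\nu,\mu\in (C^2\cap BV\cap W^{2,\infty})(\mathbb R)$ ($BV$ meaning finite total variation) with $\beta(0)=\nu(0)=0$; and $u_0\ge 0$, $u_0\in (L^1\cap BV)(\mathbb R)$. Let $u\in C([0,T];L^1(\mathbb R))\cap L^\infty(Q_T)$ be an entropy solution: for every $k\in\mathbb R$ and every non-negative $\phi\in C_c^\infty([0,T)\times\mathbb R)$, $$\int_{Q_T}\Big(|u-k|\phi_t+\mathcal U\,G(u,k)\phi_x-\operatorname{sgn}(u-k)f(k)\,\mathcal U_x\phi\Big)\,dt\,dx+\int_{\mathbb R}|u_0(x)-k|\phi(0,x)\,dx\ge 0,$$ where $G(a,b)=\operatorname{sgn}(a-b)(f(a)-f(b))$ and $\mathcal U(t,x)=\nu\big((\mu*\beta(u(t,\cdot)))(x)\big)$. **Scheme.** Let $\Delta x,\Delta t>0$ with $N\Delta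 t=T$ for some $N\in\mathbb N$, and put $\lambda=\Delta t/\Delta x$, $x_i=i\Delta x$ (also for half-integers $i$), $C_i=[x_{i-1/2},x_{i+1/2})$, $t^n=n\Delta t$. Put $u_i^0=\frac1{\Delta x}\int_{C_i}u_0\,dx$ and $$u_i^{n+1}=H\big(\nu(c^n_{i-1/2}),\nu(c^n_{i+1/2}),u^n_{i-1},u^n_i,u^n_{i+1}\big),\qquad H(a,a',b_1,b_2,b_3)=b_2-\lambda\big[\mathcal F(a',b_2,b_3)-\mathcal F(a,b_1,b_2)\big],$$ $$c^n_{i+1/2}=\Delta x\sum_{p\in\mathbb Z}\mu(x_{i+1/2-p})\,\beta(u^n_{p+1/2}),\qquad u^n_{p+1/2}=(1-\theta^n_p)u^n_p+\theta^n_p u^n_{p+1},\quad \theta^n_p\in[0,1]\text{ arbitrary}.$$ The numerical flux $\mathcal F$ (which may depend on the mesh) is assumed to satisfy, for a constant $L$, all $a,a'$ in the range of $\nu$ and all $b,c,b',c'\in\mathbb R$: $\mathcal F(a,b,b)=a f(b)$; $|\mathcal F(a,b,c)-\mathcal F(a,b',c')|\le L(|b-b'|+|c-c'|)$; $|(\mathcal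 F(a,b,c)-af(b))-(\mathcal F(a',b,c)-a'f(b))|\le L|a-a'||c-b|$; and $H(a,a',\cdot,\cdot,\cdot)$ is non-decreasing in each of its last three arguments. Put $u^\Delta(t,x)=u_i^n$ for $(t,x)\in[t^n,t^{n+1})\times C_i$, $n\ge 0$ (so $u^\Delta(T,x)=u_i^N$ for $x\in C_i$). **Relative entropy.** Let $\omega\in C_c^\infty(\mathbb R)$ be non-negative and even with support in $[-1,1]$ and $\int\omega=1$; $\omega_a(x)=\frac1a\omega(\frac xa)$; $\Phi(t,x,s,y)=\omega_\epsilon(x-y)\,\omega_{\epsilon_0}(t-s)$. For $k\in\mathbb R$, and with $\mathcal V(t,x)=\nu\big((\mu*\beta(v(t,\cdot)))(x)\big)$, set $$\Lambda_T(v,\phi,k)=\int_{Q_T}\Big(|v-k|\phi_t+\mathcal V\,G(v,k)\phi_x-\operatorname{sgn}(v-k)f(k)\,\mathcal V_x\phi\Big)dt\,dx-\int_{\mathbb R}|v(T,x)-k|\phi(T,x)\,dx+\int_{\mathbb R}|v(0,x)-k|\phi(0,x)\,dx,$$ $$\Lambda_{\epsilon,\epsilon_0}(v,u)=\int_{Q_T}\Lambda_T\big(v,\Phi(\cdot,\cdot,s,y),u(s,y)\big)\,dy\,ds.$$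 **Lemma.** There is a constant $\mathcal C$, depending only on $f,\beta,\nu,\mu,T,u_0,u,\omega$ and $L$ (in particular not on $\Delta x,\Delta t,\epsilon,\epsilon_0$, nor on $\mathcal F$ and the weights $\theta^n_p$ otherwise), such that for all $\Delta x,\Delta t,\mathcal F,\theta$ as above and all $\epsilon,\epsilon_0>0$, $$-\Lambda_{\epsilon,\epsilon_0}(u^\Delta,u)\le \mathcal C\left(\frac{\Delta x}{\epsilon}+\frac{\Delta t}{\epsilon_0}\right).$$ -/

import Mathlib

open MeasureTheory Set Filter Topology

noncomputable section

namespace NonlocalFV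

/-- `g ∈ (C² ∩ BV ∩ W^{2,∞})(ℝ)`, where `BV` means finite total variation on `ℝ`. For a `C²`
function the weak derivatives are the classical ones. -/
structure IsC2BVW2 (g : ℝ → ℝ) : Prop where
  contDiff : ContDiff ℝ 2 g
  boundedVariation : BoundedVariationOn g univ
  bounded : ∃ M : ℝ, ∀ x, |g x| ≤ M
  bounded_deriv : ∃ M : ℝ, ∀ x, |deriv g x| ≤ M
  bounded_deriv2 : ∃ M : ℝ, ∀ x, |deriv (deriv g) x| ≤ M

/-- Standing assumptions on the coefficients of `u_t + (f(u) ν(μ * β(u)))_x = 0`. -/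
structure Coefficients (f β ν μ : ℝ → ℝ) : Prop where
  f_lipschitz : ∃ K : NNReal, LipschitzWith K f
  f_zero : f 0 = 0
  β_reg : IsC2BVW2 β
  β_zero : β 0 = 0
  ν_reg : IsC2BVW2 ν
  ν_zero : ν 0 = 0
  μ_reg : IsC2BVW2 μ

/-- Non-negative initial data in `(L¹ ∩ BV)(ℝ)`; as usual for an `L¹` class, bounded variation is
required of some representative. -/
structure InitialDatum (u₀ : ℝ → ℝ) : Prop where
  integrable : Integrable u₀
  nonneg : ∀ᵐ x, 0 ≤ u₀ x
  boundedVariation : ∃ v : ℝ → ℝ, v =ᵐ[volume] u₀ ∧ BoundedVariationOn v univ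

/-- The strip `Q_T = (0, T) × ℝ`, points being written `(t, x)`. -/
def strip (T : ℝ) : Set (ℝ × ℝ) := Ioo 0 T ×ˢ univ

/-- The nonlocal coefficient `𝒰(t, x) = ν((μ * β(u(t)))(x))`. -/
def nonlocalCoeff (β ν μ : ℝ → ℝ) (u : ℝ → ℝ → ℝ) (t x : ℝ) : ℝ :=
  ν (∫ ξ, μ (x - ξ) * β (u t ξ))

/-- `G(a, b) = sgn (a - b) (f a - f b)`. -/
def entropyFlux (f : ℝ → ℝ) (a b : ℝ) : ℝ := Real.sign (a - b) * (f a - f b)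

/-- The volume part of the entropy functional,
`∫_{Q_T} ( |u - k| φ_t + 𝒰 G(u, k) φ_x - sgn (u - k) f(k) 𝒰_x φ ) dt dx`. -/
def entropyVolume (f β ν μ : ℝ → ℝ) (T : ℝ) (u φ : ℝ → ℝ → ℝ) (k : ℝ) : ℝ :=
  ∫ p in strip T,
    (|u p.1 p.2 - k| * deriv (fun τ => φ τ p.2) p.1
      + nonlocalCoeff β ν μ u p.1 p.2 * entropyFlux f (u p.1 p.2) k * deriv (fun z => φ p.1 z) p.2
      - Real.sign (u p.1 p.2 - k) * f k
          * deriv (fun z => nonlocalCoeff β ν μ u p.1 z) p.2 * φ p.1 p.2)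

/-- `Λ_T(u, φ, k)`, where the initial value of `u` is `u(0, ·)`. -/
def entropyFunctional (f β ν μ : ℝ → ℝ) (T : ℝ) (u φ : ℝ → ℝ → ℝ) (k : ℝ) : ℝ :=
  entropyVolume f β ν μ T u φ k
    - (∫ x, |u T x - k| * φ T x) + ∫ x, |u 0 x - k| * φ 0 x

/-- `u ∈ C([0,T]; L¹(ℝ)) ∩ L^∞(Q_T)` is an entropy solution with initial datum `u₀`. The test
functions are the restrictions to `[0, T) × ℝ` of smooth compactly supported functions whose
support does not meet `{t ≥ T}`. -/
structure IsEntropySolution (f β ν μ : ℝ → ℝ) (T : ℝ) (u₀ : ℝ → ℝ) (u : ℝ → ℝ → ℝ) : Prop where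
  memLp_top : MemLp (Function.uncurry u) ⊤ (volume.restrict (strip T))
  integrable : ∀ t ∈ Icc 0 T, Integrable (u t)
  continuous : ∀ t ∈ Icc 0 T,
    Tendsto (fun s => ∫ x, |u s x - u t x|) (𝓝[Icc 0 T] t) (𝓝 0)
  entropy : ∀ k : ℝ, ∀ φ : ℝ → ℝ → ℝ,
    ContDiff ℝ ((⊤ : ℕ∞) : WithTop ℕ∞) (Function.uncurry φ) →
    HasCompactSupport (Function.uncurry φ) →
    tsupport (Function.uncurry φ) ⊆ Iio T ×ˢ univ →
    (∀ t ∈ Ico 0 T, ∀ x, 0 ≤ φ t x) →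
    0 ≤ entropyVolume f β ν μ T u φ k + ∫ x, |u₀ x - k| * φ 0 x

/-- A standard symmetric mollifier supported in `[-1, 1]`. -/
structure IsMollifier (ω : ℝ → ℝ) : Prop where
  contDiff : ContDiff ℝ ((⊤ : ℕ∞) : WithTop ℕ∞) ω
  nonneg : ∀ x, 0 ≤ ω x
  even : ∀ x, ω (-x) = ω x
  support_subset : Function.support ω ⊆ Icc (-1) 1
  integral_eq_one : ∫ x, ω x = 1

/-- `ω_a(x) = ω(x / a) / a`. -/
def scaled (ω : ℝ → ℝ) (a x : ℝ) : ℝ := 1 / a * ω (x / a)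

/-- `Φ(t, x, s, y) = ω_ε(x - y) ω_{ε₀}(t - s)`. -/
def kernel (ω : ℝ → ℝ) (ε ε₀ t x s y : ℝ) : ℝ := scaled ω ε (x - y) * scaled ω ε₀ (t - s)

/-- The relative entropy functional
`Λ_{ε,ε₀}(u, v) = ∫_{Q_T} Λ_T(u, Φ(·, ·, s, y), v(s, y)) dy ds`. -/
def relativeEntropy (f β ν μ ω : ℝ → ℝ) (T ε ε₀ : ℝ) (u v : ℝ → ℝ → ℝ) : ℝ :=
  ∫ q in strip T,
    entropyFunctional f β ν μ T u (fun t x => kernel ω ε ε₀ t x q.1 q.2) (v q.1 q.2)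

/-- `H(a, a', b₁, b₂, b₃) = b₂ - lam (F(a', b₂, b₃) - F(a, b₁, b₂))`. -/
def update (lam : ℝ) (F : ℝ → ℝ → ℝ → ℝ) (a a' b₁ b₂ b₃ : ℝ) : ℝ :=
  b₂ - lam * (F a' b₂ b₃ - F a b₁ b₂)

/-- `F(a, b, c)` is a monotone numerical flux for `a f(u)`, the coefficient `a` being a value of
`ν`, with mesh ratio `lam` and Lipschitz constant `L`: it is consistent, Lipschitz in the two
states, its correction `F(a, b, c) - a f(b)` depends on `a` in a Lipschitz way relative to the
jump `c - b`, and `H` is increasing in its last three arguments. -/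
structure IsMonotoneFlux (f ν : ℝ → ℝ) (lam L : ℝ) (F : ℝ → ℝ → ℝ → ℝ) : Prop where
  consistent : ∀ a ∈ range ν, ∀ b, F a b b = a * f b
  lipschitz : ∀ a ∈ range ν, ∀ b c b' c', |F a b c - F a b' c'| ≤ L * (|b - b'| + |c - c'|)
  lipschitz_coeff : ∀ a ∈ range ν, ∀ a' ∈ range ν, ∀ b c,
    |(F a b c - a * f b) - (F a' b c - a' * f b)| ≤ L * |a - a'| * |c - b|
  monotone : ∀ a ∈ range ν, ∀ a' ∈ range ν, ∀ b₁ b₂ b₃ d₁ d₂ d₃ : ℝ,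
    b₁ ≤ d₁ → b₂ ≤ d₂ → b₃ ≤ d₃ → update lam F a a' b₁ b₂ b₃ ≤ update lam F a a' d₁ d₂ d₃

/-- The average of `u₀` over the cell `C_i = [(i - 1/2) Δx, (i + 1/2) Δx)`. -/
def cellAverage (u₀ : ℝ → ℝ) (Δx : ℝ) (i : ℤ) : ℝ :=
  1 / Δx * ∫ x in Ico (((i : ℝ) - 1 / 2) * Δx) (((i : ℝ) + 1 / 2) * Δx), u₀ x

/-- The discrete convolution `c_{i+1/2} = Δx ∑_p μ((i + 1/2 - p) Δx) β(U_{p+1/2})` with the convex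
combinations `U_{p+1/2} = (1 - θ_p) U_p + θ_p U_{p+1}`. -/
def discreteConv (β μ : ℝ → ℝ) (Δx : ℝ) (θ : ℤ → ℝ) (U : ℤ → ℝ) (i : ℤ) : ℝ :=
  Δx * ∑' p : ℤ, μ (((i : ℝ) + 1 / 2 - p) * Δx) * β ((1 - θ p) * U p + θ p * U (p + 1))

/-- The grid values `u_i^n` of the scheme. -/
def scheme (β ν μ : ℝ → ℝ) (F : ℝ → ℝ → ℝ → ℝ) (Δx Δt : ℝ) (θ : ℕ → ℤ → ℝ) (u₀ : ℝ → ℝ) :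
    ℕ → ℤ → ℝ
  | 0 => cellAverage u₀ Δx
  | n + 1 => fun i =>
      let U := scheme β ν μ F Δx Δt θ u₀ n
      update (Δt / Δx) F
        (ν (discreteConv β μ Δx (θ n) U (i - 1))) (ν (discreteConv β μ Δx (θ n) U i))
        (U (i - 1)) (U i) (U (i + 1))

/-- The numerical solution: `u^Δ(t, x) = u_i^n` for `n Δt ≤ t < (n + 1) Δt` and `x ∈ C_i`. -/
def numericalSolution (β ν μ : ℝ → ℝ) (F : ℝ → ℝ → ℝ → ℝ) (Δx Δt : ℝ) (θ : ℕ → ℤ → ℝ)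
    (u₀ : ℝ → ℝ) (t x : ℝ) : ℝ :=
  scheme β ν μ F Δx Δt θ u₀ ⌊t / Δt⌋₊ ⌊x / Δx + 1 / 2⌋

end NonlocalFV

end

/-!
Discretising the Kruzhkov doubling-of-variables argument. For a fixed point `(s, y)` and
`k = u(s, y)` the test function is a product `h(x) g(t)` with `h = ω_ε(· - y)`, `g = ω_{ε₀}(· - s)`,
and the numerical solution is constant on the cells `[t^n, t^{n+1}) × C_i`, so the entropy
functional is a finite sum over time steps of spatial integrals (`entropyFunctional_eq_sum`).
Monotonicity of the scheme gives the discrete Kruzhkov inequality (`discrete_entropy`). After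
summation by parts in time (`neg_sum_le_of_entropy_step`) what is left is the consistency error
between the discrete and the exact flux and source terms. It has to be bounded by `Δx / ε` and
`Δt / ε₀`, with no smallness assumption on any of these quantities, using only first derivatives of
the mollifiers.

* Bounds on the scheme (`exists_scheme_bound`). Monotone conservative steps contract in `ℓ¹`;
  comparison with `0` bounds the `ℓ¹` norm. Comparison with the shifted solution bounds the total
  variation by a Gronwall argument, the coefficient entering only through its first and second
  differences, which are `O(Δx)` and `O(Δx²)` by the smoothness of `μ` and `ν`.
* Flux (`abs_numFluxTerm_sub_fluxTerm_le`). By summation by parts and the mean value theorem in the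
  shift, the numerical flux is tested with `h'` after a translation by at most one cell. The error
  is then controlled by the total variation in space times `‖h'‖₁ = O(1 / ε)`.
* Source (`abs_sourceTerm_sub_le`). The function `sgn (u_i^n - k)` has no regularity, so the new
  time level in the discrete source forces a comparison with the exact source of the following step.
  The coefficient difference is `O(Δt)` in `L^∞` between two steps, as the exact convolution does
  not see the weights `θ`, plus `O(Δx)` in `L¹` between the discrete and the exact derivative
  (`integral_abs_deriv_sub_gridCoeff_diff_le`). The `L¹` bound becomes `Δx / ε` because
  `ω_ε = O(1 / ε)`. It uses that `μ'` is integrable, which follows from `μ ∈ BV`, and puts the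
  remaining derivative on the numerical solution.

Integration over `y` uses `‖u(s)‖₁ ≤ M` on `[0, T]`. If the integrand of the relative entropy is not
integrable, the relative entropy is `0` by convention and the bound holds because the constant is
non-negative.
-/

open scoped ENNReal

noncomputable section

namespace NonlocalFV

/-! ### The grid -/

/-- The index `i` of the cell `C_i = [(i - 1/2) Δx, (i + 1/2) Δx)` that contains `x`. -/
def cell (Δx x : ℝ) : ℤ := ⌊x / Δx + 1 / 2⌋

lemma measurable_cell (Δx : ℝ) : Measurable (cell Δx) :=
  Int.measurable_floor.comp ((measurable_id.div_const Δx).add_const _)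

lemma measurable_comp_cell (Δx : ℝ) (a : ℤ → ℝ) : Measurable fun x => a (cell Δx x) :=
  (measurable_from_top (f := a)).comp (measurable_cell Δx)

lemma cell_eq_iff {Δx : ℝ} (hΔx : 0 < Δx) {x : ℝ} {i : ℤ} :
    cell Δx x = i ↔ x ∈ Ico (((i : ℝ) - 1 / 2) * Δx) (((i : ℝ) + 1 / 2) * Δx) := by
  rw [cell, Int.floor_eq_iff, mem_Ico, ← le_div_iff₀ hΔx, ← div_lt_iff₀ hΔx]
  constructor <;> rintro ⟨h1, h2⟩ <;> constructor <;> linarith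

lemma abs_sub_cell_le {Δx : ℝ} (hΔx : 0 < Δx) (x : ℝ) : |x - cell Δx x * Δx| ≤ Δx / 2 := by
  obtain ⟨h1, h2⟩ := (cell_eq_iff hΔx).1 (rfl : cell Δx x = cell Δx x)
  rw [abs_le]
  constructor <;> nlinarith

lemma cell_add_self {Δx : ℝ} (hΔx : 0 < Δx) (x : ℝ) : cell Δx (x + Δx) = cell Δx x + 1 := by
  rw [cell, cell, add_div, div_self hΔx.ne', ← Int.floor_add_one]
  ring_nf

lemma cell_sub_mul {Δx : ℝ} (hΔx : 0 < Δx) (x : ℝ) {r : ℝ} (hr : r ∈ Icc (0 : ℝ) 1) :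
    cell Δx (x - r * Δx) = cell Δx x ∨ cell Δx (x - r * Δx) = cell Δx x - 1 := by
  obtain ⟨h1, h2⟩ := (cell_eq_iff hΔx).1 (rfl : cell Δx x = cell Δx x)
  obtain ⟨hr0, hr1⟩ := hr
  rcases le_or_gt (((cell Δx x : ℝ) - 1 / 2) * Δx) (x - r * Δx) with h | h
  · left
    rw [cell_eq_iff hΔx]
    exact ⟨h, by nlinarith⟩
  · right
    rw [cell_eq_iff hΔx]
    push_cast
    exact ⟨by nlinarith, by nlinarith⟩

lemma cell_sub {Δx : ℝ} (hΔx : 0 < Δx) (z ζ : ℝ) :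
    cell Δx (z - ζ) = cell Δx z - cell Δx ζ - 1 ∨ cell Δx (z - ζ) = cell Δx z - cell Δx ζ ∨
      cell Δx (z - ζ) = cell Δx z - cell Δx ζ + 1 := by
  have h1 := abs_le.1 (abs_sub_cell_le hΔx z)
  have h2 := abs_le.1 (abs_sub_cell_le hΔx ζ)
  have h3 := abs_le.1 (abs_sub_cell_le hΔx (z - ζ))
  have l1 : ((cell Δx (z - ζ) - (cell Δx z - cell Δx ζ) : ℤ) : ℝ) < (2 : ℤ) := by
    push_cast
    by_contra hc
    nlinarith
  have l2 : ((-2 : ℤ) : ℝ) < ((cell Δx (z - ζ) - (cell Δx z - cell Δx ζ) : ℤ) : ℝ) := by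
    push_cast
    by_contra hc
    nlinarith
  have l1' := Int.cast_lt.1 l1
  have l2' := Int.cast_lt.1 l2
  omega

/-- Lebesgue measure gives every cell the mass `Δx`. -/
lemma map_cell_volume {Δx : ℝ} (hΔx : 0 < Δx) :
    (volume : Measure ℝ).map (cell Δx) = ENNReal.ofReal Δx • Measure.count := by
  refine Measure.ext_of_singleton fun i => ?_
  rw [Measure.map_apply (measurable_cell Δx) (measurableSet_singleton i), Measure.smul_apply,
    Measure.count_singleton]
  have : cell Δx ⁻¹' {i} = Ico (((i : ℝ) - 1 / 2) * Δx) (((i : ℝ) + 1 / 2) * Δx) := by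
    ext x
    exact cell_eq_iff hΔx
  rw [this, Real.volume_Ico, smul_eq_mul, mul_one]
  congr 1
  ring

lemma integrable_comp_cell {Δx : ℝ} (hΔx : 0 < Δx) {a : ℤ → ℝ} (ha : Summable a) :
    Integrable fun x => a (cell Δx x) := by
  have h : Integrable a ((volume : Measure ℝ).map (cell Δx)) := by
    rw [map_cell_volume hΔx]
    exact (integrable_count_iff.2 ha.norm).smul_measure ENNReal.ofReal_ne_top
  exact h.comp_measurable (measurable_cell Δx)

lemma integral_comp_cell {Δx : ℝ} (hΔx : 0 < Δx) {a : ℤ → ℝ} (ha : Summable a) :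
    ∫ x, a (cell Δx x) = Δx * ∑' i, a i := by
  have hm : AEStronglyMeasurable a ((volume : Measure ℝ).map (cell Δx)) :=
    (measurable_from_top (f := a)).aestronglyMeasurable
  rw [← integral_map (measurable_cell Δx).aemeasurable hm, map_cell_volume hΔx,
    integral_smul_measure, integral_countable (integrable_count_iff.2 ha.norm),
    ENNReal.toReal_ofReal hΔx.le]
  simp [Measure.real]

lemma summable_comp_sub {a : ℤ → ℝ} (ha : Summable a) (q : ℤ) :
    Summable (fun i => a (i - q)) := (Equiv.subRight q).summable_iff.2 ha

lemma tsum_comp_sub (a : ℤ → ℝ) (q : ℤ) : ∑' i, a (i - q) = ∑' i, a i :=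
  (Equiv.subRight q).tsum_eq a

lemma tsum_comp_add (a : ℤ → ℝ) (q : ℤ) : ∑' i, a (i + q) = ∑' i, a i :=
  (Equiv.addRight q).tsum_eq a

lemma summable_comp_add {a : ℤ → ℝ} (ha : Summable a) (q : ℤ) :
    Summable (fun i => a (i + q)) := (Equiv.addRight q).summable_iff.2 ha

/-! ### Functions of bounded variation -/

/-- A `C¹` function of finite total variation has an integrable derivative, because `|g'|` is the
derivative of a bounded monotone function, the running variation. -/
lemma integrable_deriv_of_boundedVariationOn {g : ℝ → ℝ} (hg : ContDiff ℝ 1 g)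
    (hv : BoundedVariationOn g univ) : Integrable (deriv g) := by
  have hc : Continuous (deriv g) := hg.continuous_deriv le_rfl
  have hl := hv.locallyBoundedVariationOn
  set V := variationOnFromTo g univ 0 with hV
  have hmono : Monotone V := by
    rw [← monotoneOn_univ]
    exact variationOnFromTo.monotoneOn hl (mem_univ 0)
  have hle : ∀ᵐ x, ‖deriv g x‖ ≤ deriv V x := by
    filter_upwards [hmono.ae_differentiableAt] with x hx
    have hx' := hx.hasDerivAt
    have hgx : HasDerivAt g (deriv g x) x :=
      ((hg.differentiable one_ne_zero) x).hasDerivAt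
    refine le_of_tendsto_of_tendsto (hasDerivAt_iff_tendsto_slope.1 hgx).norm
      (hasDerivAt_iff_tendsto_slope.1 hx') ?_
    filter_upwards [self_mem_nhdsWithin] with y hy
    have key : ∀ a b : ℝ, a ≤ b → |g b - g a| ≤ V b - V a := fun a b hab =>
      variationOnFromTo.abs_sub_le_sub_of_le hl (mem_univ 0) (mem_univ a) (mem_univ b) hab
    rw [slope_def_field, slope_def_field, Real.norm_eq_abs, abs_div]
    rcases lt_or_gt_of_ne (show y ≠ x from hy) with h | h
    · have h1 := key y x h.le
      rw [abs_of_neg (sub_neg.2 h), ← neg_sub (V x) (V y), ← neg_sub x y, neg_neg, neg_div_neg_eq,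
        abs_sub_comm]
      gcongr
    · have h1 := key x y h.le
      rw [abs_of_pos (sub_pos.2 h)]
      gcongr
  refine integrable_of_intervalIntegral_norm_bounded (l := atTop) (a := fun n : ℕ => -(n : ℝ))
    (b := fun n : ℕ => (n : ℝ)) (2 * (eVariationOn g univ).toReal) ?_ ?_ ?_ ?_
  · intro i
    exact (hc.integrableOn_Icc).mono_set Ioc_subset_Icc_self
  · exact tendsto_neg_atTop_atBot.comp tendsto_natCast_atTop_atTop
  · exact tendsto_natCast_atTop_atTop
  · refine Eventually.of_forall fun n => ?_
    have hn : -(n : ℝ) ≤ n := by linarith [n.cast_nonneg (α := ℝ)]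
    have hm := (hmono.monotoneOn (uIcc (-(n : ℝ)) n))
    calc ∫ x in (-(n : ℝ))..n, ‖deriv g x‖ ≤ ∫ x in (-(n : ℝ))..n, deriv V x := by
          refine intervalIntegral.integral_mono_ae hn
            (hc.norm.intervalIntegrable _ _) hm.intervalIntegrable_deriv hle
      _ ≤ V n - V (-n) := by
          have := hm.intervalIntegral_deriv_mem_uIcc
          rw [uIcc_of_le (sub_nonneg.2 (hmono hn))] at this
          exact this.2
      _ ≤ 2 * (eVariationOn g univ).toReal := by
          have h1 := variationOnFromTo.abs_le_eVariationOn hv (a := 0) (b := (n : ℝ))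
          have h2 := variationOnFromTo.abs_le_eVariationOn hv (a := 0) (b := -(n : ℝ))
          have h1' := (abs_le.1 h1).2
          have h2' := (abs_le.1 h2).1
          linarith

lemma exists_subset_image_range (s : Finset ℤ) :
    ∃ m : ℕ, ∃ n : ℕ, s ⊆ (Finset.range n).image fun j : ℕ => (j : ℤ) - m := by
  obtain ⟨B, hB⟩ : ∃ B : ℕ, ∀ i ∈ s, i.natAbs ≤ B := ⟨s.sup Int.natAbs, fun i hi =>
    Finset.le_sup (f := Int.natAbs) hi⟩
  refine ⟨B, 2 * B + 1, fun i hi => ?_⟩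
  have := hB i hi
  rw [Finset.mem_image]
  exact ⟨(i + B).toNat, by rw [Finset.mem_range]; omega, by omega⟩

lemma sum_abs_sub_le_variation {v : ℝ → ℝ} (hv : BoundedVariationOn v univ) {δ : ℝ} (hδ : 0 ≤ δ)
    (x : ℝ) (s : Finset ℤ) :
    ∑ i ∈ s, |v (x + (i + 1 : ℤ) * δ) - v (x + (i : ℤ) * δ)| ≤ (eVariationOn v univ).toReal := by
  obtain ⟨m, n, hs⟩ := exists_subset_image_range s
  refine (Finset.sum_le_sum_of_subset_of_nonneg hs fun _ _ _ => abs_nonneg _).trans ?_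
  rw [Finset.sum_image (by intro a _ b _ h; simpa using h)]
  have hmono : Monotone fun j : ℕ => x + ((j : ℝ) - m) * δ := by
    intro a b hab
    have : (a : ℝ) ≤ b := by exact_mod_cast hab
    dsimp only
    gcongr
  have h := eVariationOn.sum_le (f := v) (s := univ) (n := n) hmono fun _ => mem_univ _
  have h' := ENNReal.toReal_mono hv h
  rw [ENNReal.toReal_sum fun _ _ => edist_ne_top _ _] at h'
  refine le_trans (le_of_eq (Finset.sum_congr rfl fun j _ => ?_)) h'
  rw [edist_dist, ENNReal.toReal_ofReal dist_nonneg, Real.dist_eq]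
  push_cast
  ring_nf

/-- The cell average as an integral over `C_0`, for any representative `v` of the datum. -/
lemma cellAverage_eq {u₀ v : ℝ → ℝ} (huv : v =ᵐ[volume] u₀) (Δx : ℝ) (i : ℤ) :
    cellAverage u₀ Δx i = 1 / Δx * ∫ x in Ico (-(1 / 2) * Δx) (1 / 2 * Δx), v (x + i * Δx) := by
  rw [cellAverage]
  congr 1
  rw [setIntegral_congr_ae (g := v) measurableSet_Ico
    (huv.mono fun x hx _ => hx.symm), ← integral_indicator measurableSet_Ico,
    ← integral_indicator measurableSet_Ico, ← integral_add_right_eq_self _ (i * Δx : ℝ)]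
  refine integral_congr_ae (Eventually.of_forall fun x => ?_)
  simp only [indicator, mem_Ico]
  congr 1
  apply propext
  constructor <;> rintro ⟨h1, h2⟩ <;> constructor <;> linarith

/-- Cell averaging does not increase the total variation: for each point of `C_0`, its translates
by multiples of `Δx` form a partition. -/
lemma tsum_abs_cellAverage_sub_le {u₀ v : ℝ → ℝ} (hu : Integrable u₀) (huv : v =ᵐ[volume] u₀)
    (hv : BoundedVariationOn v univ) {Δx : ℝ} (hΔx : 0 < Δx) :
    ∑' i, |cellAverage u₀ Δx (i + 1) - cellAverage u₀ Δx i| ≤ (eVariationOn v univ).toReal := by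
  have hvi : Integrable v := hu.congr huv.symm
  refine Real.tsum_le_of_sum_le (fun _ => abs_nonneg _) fun s => ?_
  set I := Ico (-(1 / 2) * Δx) (1 / 2 * Δx) with hI
  have hint : ∀ i : ℤ, Integrable (fun x => v (x + i * Δx)) (volume.restrict I) := fun i =>
    (hvi.comp_add_right _).restrict
  have hint' : ∀ i : ℤ, Integrable (fun x => |v (x + (i + 1 : ℤ) * Δx) - v (x + i * Δx)|)
      (volume.restrict I) := fun i => ((hint (i + 1)).sub (hint i)).abs
  calc ∑ i ∈ s, |cellAverage u₀ Δx (i + 1) - cellAverage u₀ Δx i|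
      ≤ ∑ i ∈ s, 1 / Δx * ∫ x in I, |v (x + (i + 1 : ℤ) * Δx) - v (x + i * Δx)| := by
        refine Finset.sum_le_sum fun i _ => ?_
        rw [cellAverage_eq huv, cellAverage_eq huv, ← mul_sub, ← integral_sub (hint _) (hint _),
          abs_mul, abs_of_pos (one_div_pos.2 hΔx)]
        gcongr
        exact abs_integral_le_integral_abs
    _ = 1 / Δx * ∫ x in I, ∑ i ∈ s, |v (x + (i + 1 : ℤ) * Δx) - v (x + i * Δx)| := by
        rw [← Finset.mul_sum, integral_finsetSum _ fun i _ => hint' i]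
    _ ≤ 1 / Δx * ∫ x in I, (eVariationOn v univ).toReal := by
        refine mul_le_mul_of_nonneg_left (integral_mono (integrable_finsetSum _ fun i _ => hint' i)
          (integrable_const_iff.2 (Or.inr ?_)) fun x => sum_abs_sub_le_variation hv hΔx.le x s)
          (one_div_pos.2 hΔx).le
        exact ⟨by rw [Measure.restrict_apply_univ]; exact measure_Ico_lt_top⟩
    _ = (eVariationOn v univ).toReal := by
        rw [setIntegral_const, Measure.real, hI, Real.volume_Ico,
          ENNReal.toReal_ofReal (by linarith), smul_eq_mul]
        field_simp
        ring

lemma sum_abs_cellAverage_le {u₀ : ℝ → ℝ} (hu : Integrable u₀) {Δx : ℝ} (hΔx : 0 < Δx)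
    (s : Finset ℤ) : ∑ i ∈ s, |cellAverage u₀ Δx i| ≤ 1 / Δx * ∫ x, |u₀ x| := by
  set C : ℤ → Set ℝ := fun i => Ico (((i : ℝ) - 1 / 2) * Δx) (((i : ℝ) + 1 / 2) * Δx) with hC
  have hdis : (s : Set ℤ).PairwiseDisjoint C := by
    intro i _ j _ hij
    refine Set.disjoint_left.2 fun x hx hx' => hij ?_
    rw [← (cell_eq_iff hΔx).2 hx, ← (cell_eq_iff hΔx).2 hx']
  calc ∑ i ∈ s, |cellAverage u₀ Δx i| ≤ ∑ i ∈ s, 1 / Δx * ∫ x in C i, |u₀ x| := by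
        refine Finset.sum_le_sum fun i _ => ?_
        rw [cellAverage, abs_mul, abs_of_pos (one_div_pos.2 hΔx)]
        gcongr
        exact abs_integral_le_integral_abs
    _ = 1 / Δx * ∫ x in ⋃ i ∈ s, C i, |u₀ x| := by
        rw [← Finset.mul_sum, integral_biUnion_finset s (fun i _ => measurableSet_Ico) hdis
          fun i _ => hu.abs.integrableOn]
    _ ≤ 1 / Δx * ∫ x, |u₀ x| := by
        refine mul_le_mul_of_nonneg_left ?_ (one_div_pos.2 hΔx).le
        exact setIntegral_le_integral hu.abs (Eventually.of_forall fun _ => abs_nonneg _)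

lemma summable_abs_cellAverage {u₀ : ℝ → ℝ} (hu : Integrable u₀) {Δx : ℝ} (hΔx : 0 < Δx) :
    Summable fun i => |cellAverage u₀ Δx i| :=
  summable_of_sum_le (fun _ => abs_nonneg _) (sum_abs_cellAverage_le hu hΔx)

lemma tsum_abs_cellAverage_le {u₀ : ℝ → ℝ} (hu : Integrable u₀) {Δx : ℝ} (hΔx : 0 < Δx) :
    Δx * ∑' i, |cellAverage u₀ Δx i| ≤ ∫ x, |u₀ x| := by
  have := Real.tsum_le_of_sum_le (fun _ => abs_nonneg _) (sum_abs_cellAverage_le hu hΔx)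
  calc Δx * ∑' i, |cellAverage u₀ Δx i| ≤ Δx * (1 / Δx * ∫ x, |u₀ x|) := by gcongr
    _ = ∫ x, |u₀ x| := by field_simp

/-! ### Monotone steps: contraction, discrete entropy inequality, total variation -/

/-- One step of the scheme on the grid function `U`, `a i` being the coefficient at the interface
`x_{i+1/2}`. -/
def step (lam : ℝ) (F : ℝ → ℝ → ℝ → ℝ) (a U : ℤ → ℝ) (i : ℤ) : ℝ :=
  update lam F (a (i - 1)) (a i) (U (i - 1)) (U i) (U (i + 1))

/-- The numerical entropy flux at the interface `x_{i+1/2}` for a pair of grid functions; for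
constant `W = k` it is the flux of the Kruzhkov entropy `|· - k|`. -/
def numFlux (F : ℝ → ℝ → ℝ → ℝ) (a U W : ℤ → ℝ) (i : ℤ) : ℝ :=
  F (a i) (max (U i) (W i)) (max (U (i + 1)) (W (i + 1)))
    - F (a i) (min (U i) (W i)) (min (U (i + 1)) (W (i + 1)))

section Step

variable {f ν : ℝ → ℝ} {lam L : ℝ} {F : ℝ → ℝ → ℝ → ℝ} {a : ℤ → ℝ}

lemma abs_step_sub_step_le (hF : IsMonotoneFlux f ν lam L F) (ha : ∀ i, a i ∈ range ν)
    (U W : ℤ → ℝ) (i : ℤ) :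
    |step lam F a U i - step lam F a W i|
      ≤ |U i - W i| - lam * (numFlux F a U W i - numFlux F a U W (i - 1)) := by
  have hm := hF.monotone _ (ha (i - 1)) _ (ha i)
  have h1 := hm _ _ _ _ _ _ (le_max_left (U (i - 1)) (W (i - 1))) (le_max_left (U i) (W i))
    (le_max_left (U (i + 1)) (W (i + 1)))
  have h2 := hm _ _ _ _ _ _ (le_max_right (U (i - 1)) (W (i - 1))) (le_max_right (U i) (W i))
    (le_max_right (U (i + 1)) (W (i + 1)))
  have h3 := hm _ _ _ _ _ _ (min_le_left (U (i - 1)) (W (i - 1))) (min_le_left (U i) (W i))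
    (min_le_left (U (i + 1)) (W (i + 1)))
  have h4 := hm _ _ _ _ _ _ (min_le_right (U (i - 1)) (W (i - 1))) (min_le_right (U i) (W i))
    (min_le_right (U (i + 1)) (W (i + 1)))
  have h5 := max_sub_min_eq_abs' (U i) (W i)
  simp only [step, numFlux, sub_add_cancel]
  rw [← h5, abs_le]
  simp only [update] at *
  constructor <;> linarith

lemma abs_numFlux_le (hF : IsMonotoneFlux f ν lam L F) (ha : ∀ i, a i ∈ range ν)
    (U W : ℤ → ℝ) (i : ℤ) :
    |numFlux F a U W i| ≤ L * (|U i - W i| + |U (i + 1) - W (i + 1)|) := by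
  refine (hF.lipschitz _ (ha i) _ _ _ _).trans_eq ?_
  rw [max_sub_min_eq_abs', max_sub_min_eq_abs', abs_abs, abs_abs]

/-- Monotone conservative steps contract in `ℓ¹`. -/
lemma tsum_abs_step_sub_step_le (hF : IsMonotoneFlux f ν lam L F) (ha : ∀ i, a i ∈ range ν)
    (U W : ℤ → ℝ) (hs : Summable fun i => |U i - W i|) :
    (Summable fun i => |step lam F a U i - step lam F a W i|) ∧
      ∑' i, |step lam F a U i - step lam F a W i| ≤ ∑' i, |U i - W i| := by
  have hE : Summable fun i => numFlux F a U W i := by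
    refine Summable.of_norm_bounded (((hs.add (summable_comp_add hs 1))).mul_left L) fun i => ?_
    exact abs_numFlux_le hF ha U W i
  have hE' : Summable fun i => numFlux F a U W (i - 1) := summable_comp_sub hE 1
  have hr := hs.sub ((hE.sub hE').mul_left lam)
  have hl : Summable fun i => |step lam F a U i - step lam F a W i| :=
    Summable.of_nonneg_of_le (fun _ => abs_nonneg _) (abs_step_sub_step_le hF ha U W) hr
  refine ⟨hl, (hl.tsum_le_tsum (abs_step_sub_step_le hF ha U W) hr).trans_eq ?_⟩
  rw [hs.tsum_sub ((hE.sub hE').mul_left lam), tsum_mul_left, hE.tsum_sub hE', tsum_comp_sub]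
  ring

lemma step_const (hF : IsMonotoneFlux f ν lam L F) (ha : ∀ i, a i ∈ range ν) (k : ℝ) (i : ℤ) :
    step lam F a (fun _ => k) i = k - lam * f k * (a i - a (i - 1)) := by
  simp only [step, update, hF.consistent _ (ha _)]
  ring

lemma sign_mul_le_abs (x y : ℝ) : Real.sign x * y ≤ |y| := by
  rcases Real.sign_apply_eq x with h | h | h <;> rw [h]
  · linarith [neg_le_abs y]
  · simp
  · linarith [le_abs_self y]

lemma sign_mul_self_eq_abs (x : ℝ) : Real.sign x * x = |x| := by
  rcases lt_trichotomy x 0 with h | h | h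
  · rw [Real.sign_of_neg h, abs_of_neg h]; ring
  · simp [h]
  · rw [Real.sign_of_pos h, abs_of_pos h]; ring

/-- The discrete Kruzhkov entropy inequality: compare the step with its value at the constant
state `k`. -/
lemma discrete_entropy (hF : IsMonotoneFlux f ν lam L F) (ha : ∀ i, a i ∈ range ν)
    (U : ℤ → ℝ) (k : ℝ) (i : ℤ) :
    |step lam F a U i - k| - |U i - k|
      ≤ -lam * (numFlux F a U (fun _ => k) i - numFlux F a U (fun _ => k) (i - 1))
        - lam * (Real.sign (step lam F a U i - k) * f k * (a i - a (i - 1))) := by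
  have h := abs_step_sub_step_le hF ha U (fun _ => k) i
  rw [step_const hF ha] at h
  have h1 := sign_mul_le_abs (step lam F a U i - k)
    (step lam F a U i - (k - lam * f k * (a i - a (i - 1))))
  have h2 := sign_mul_self_eq_abs (step lam F a U i - k)
  have h3 : Real.sign (step lam F a U i - k) *
      (step lam F a U i - (k - lam * f k * (a i - a (i - 1)))) =
      Real.sign (step lam F a U i - k) * (step lam F a U i - k)
        + lam * (Real.sign (step lam F a U i - k) * f k * (a i - a (i - 1))) := by ring
  linarith

lemma lipschitz_nonneg (hF : IsMonotoneFlux f ν lam L F) : 0 ≤ L := by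
  have h := hF.lipschitz _ (mem_range_self 0) 0 0 1 0
  have h' := (abs_nonneg _).trans h
  norm_num at h'
  exact h'

lemma abs_flux_coeff_sub_le {κ : ℝ} (hf : ∀ x y, |f x - f y| ≤ κ * |x - y|) (f0 : f 0 = 0)
    (hF : IsMonotoneFlux f ν lam L F) {p q : ℝ} (hp : p ∈ range ν) (hq : q ∈ range ν) (b c : ℝ) :
    |F p b c - F q b c| ≤ |p - q| * (κ * |b| + L * |c - b|) := by
  have h := hF.lipschitz_coeff p hp q hq b c
  have hb : |f b| ≤ κ * |b| := by simpa [f0] using hf b 0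
  have : F p b c - F q b c = ((F p b c - p * f b) - (F q b c - q * f b)) + (p - q) * f b := by ring
  rw [this]
  refine (abs_add_le _ _).trans ?_
  rw [abs_mul]
  have := mul_le_mul_of_nonneg_left hb (abs_nonneg (p - q))
  linarith

lemma abs_flux_sub_le {κ : ℝ} (hf : ∀ x y, |f x - f y| ≤ κ * |x - y|) (f0 : f 0 = 0)
    (hF : IsMonotoneFlux f ν lam L F) {p q : ℝ} (hp : p ∈ range ν) (hq : q ∈ range ν)
    (b c b' c' : ℝ) :
    |F p b c - F q b' c'|
      ≤ L * (|b - b'| + |c - c'|) + |p - q| * (κ * |b'| + L * |c' - b'|) := by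
  have h1 := hF.lipschitz p hp b c b' c'
  have h2 := abs_flux_coeff_sub_le hf f0 hF hp hq b' c'
  calc |F p b c - F q b' c'| = |(F p b c - F p b' c') + (F p b' c' - F q b' c')| := by ring_nf
    _ ≤ _ := (abs_add_le _ _).trans (add_le_add h1 h2)

variable {κ A₁ A₂ : ℝ} {U : ℤ → ℝ}

lemma tsum_abs_step_le (hF : IsMonotoneFlux f ν lam L F) (f0 : f 0 = 0) (ha : ∀ i, a i ∈ range ν)
    (hU : Summable fun i => |U i|) :
    (Summable fun i => |step lam F a U i|) ∧ ∑' i, |step lam F a U i| ≤ ∑' i, |U i| := by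
  have h := tsum_abs_step_sub_step_le hF ha U (fun _ => 0) (by simpa using hU)
  simpa [step_const hF ha, f0] using h

lemma summable_abs_diff (hU : Summable fun i => |U i|) :
    Summable fun i => |U (i + 1) - U i| := by
  refine Summable.of_nonneg_of_le (fun _ => abs_nonneg _) (fun i => abs_sub _ _) ?_
  exact (summable_comp_add hU 1).add hU

/-- Growth of the total variation in one step: shifting the data is controlled by contraction,
shifting the coefficient by its first and second differences. -/
lemma tsum_abs_step_diff_le (hf : ∀ x y, |f x - f y| ≤ κ * |x - y|) (f0 : f 0 = 0)
    (hlam : 0 ≤ lam) (hF : IsMonotoneFlux f ν lam L F) (ha : ∀ i, a i ∈ range ν)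
    (hA₁ : ∀ i, |a (i + 1) - a i| ≤ A₁) (hA₂ : ∀ i, |a (i + 1) - 2 * a i + a (i - 1)| ≤ A₂)
    (hU : Summable fun i => |U i|) :
    ∑' i, |step lam F a U (i + 1) - step lam F a U i|
      ≤ ∑' i, |U (i + 1) - U i|
        + lam * (A₂ * κ * ∑' i, |U i| + A₁ * (κ + 2 * L) * ∑' i, |U (i + 1) - U i|) := by
  have hL := lipschitz_nonneg hF
  have hd := summable_abs_diff hU
  have hd' : Summable fun i => |U (i - 1 + 1) - U (i - 1)| := summable_comp_sub hd 1
  have hdsum : ∑' i, |U (i - 1 + 1) - U (i - 1)| = ∑' i, |U (i + 1) - U i| :=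
    tsum_comp_sub (fun i => |U (i + 1) - U i|) 1
  set Ta : ℤ → ℝ := fun i => a (i + 1) with hTa
  have hTar : ∀ i, Ta i ∈ range ν := fun i => ha _
  obtain ⟨hc1, hc2⟩ := tsum_abs_step_sub_step_le hF hTar (fun i => U (i + 1)) U hd
  have hshift : ∀ i, step lam F Ta (fun j => U (j + 1)) i = step lam F a U (i + 1) := by
    intro i
    simp only [step, hTa, sub_add_cancel, add_sub_cancel_right]
  have hbound : ∀ i, |step lam F Ta U i - step lam F a U i|
      ≤ lam * (A₂ * κ * |U i| + A₁ * (κ + L) * |U (i - 1 + 1) - U (i - 1)|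
        + A₁ * L * |U (i + 1) - U i|) := by
    intro i
    have e1 := hF.lipschitz_coeff _ (ha (i + 1)) _ (ha i) (U i) (U (i + 1))
    have e2 := hF.lipschitz_coeff _ (ha i) _ (ha (i - 1)) (U (i - 1)) (U i)
    have e3 : |f (U i)| ≤ κ * |U i| := by simpa [f0] using hf (U i) 0
    have e4 := hf (U i) (U (i - 1))
    have a1 := hA₁ i
    have a2 : |a i - a (i - 1)| ≤ A₁ := by simpa using hA₁ (i - 1)
    have hA₁0 : 0 ≤ A₁ := (abs_nonneg _).trans a1
    have hA₂0 : 0 ≤ A₂ := (abs_nonneg _).trans (hA₂ i)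
    have b1 : L * |a (i + 1) - a i| * |U (i + 1) - U i| ≤ A₁ * L * |U (i + 1) - U i| := by
      rw [mul_comm A₁]; gcongr
    have b2 : L * |a i - a (i - 1)| * |U i - U (i - 1)| ≤ A₁ * L * |U i - U (i - 1)| := by
      rw [mul_comm A₁]; gcongr
    have b3 : |(a (i + 1) - 2 * a i + a (i - 1)) * f (U i)| ≤ A₂ * (κ * |U i|) := by
      rw [abs_mul]
      exact mul_le_mul (hA₂ i) e3 (abs_nonneg _) hA₂0
    have b4 : |(a i - a (i - 1)) * (f (U i) - f (U (i - 1)))| ≤ A₁ * (κ * |U i - U (i - 1)|) := by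
      rw [abs_mul]
      exact mul_le_mul a2 e4 (abs_nonneg _) hA₁0
    have key : step lam F Ta U i - step lam F a U i = -lam *
        (((F (a (i + 1)) (U i) (U (i + 1)) - a (i + 1) * f (U i))
            - (F (a i) (U i) (U (i + 1)) - a i * f (U i)))
          - ((F (a i) (U (i - 1)) (U i) - a i * f (U (i - 1)))
            - (F (a (i - 1)) (U (i - 1)) (U i) - a (i - 1) * f (U (i - 1))))
          + (a (i + 1) - 2 * a i + a (i - 1)) * f (U i)
          + (a i - a (i - 1)) * (f (U i) - f (U (i - 1)))) := by
      simp only [step, update, hTa, sub_add_cancel]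
      ring
    rw [key, abs_mul, abs_neg, abs_of_nonneg hlam, sub_add_cancel]
    refine mul_le_mul_of_nonneg_left ?_ hlam
    refine (abs_add_le _ _).trans ?_
    have s1 := abs_add_le (((F (a (i + 1)) (U i) (U (i + 1)) - a (i + 1) * f (U i))
            - (F (a i) (U i) (U (i + 1)) - a i * f (U i)))
          - ((F (a i) (U (i - 1)) (U i) - a i * f (U (i - 1)))
            - (F (a (i - 1)) (U (i - 1)) (U i) - a (i - 1) * f (U (i - 1)))))
          ((a (i + 1) - 2 * a i + a (i - 1)) * f (U i))
    have s2 := abs_sub ((F (a (i + 1)) (U i) (U (i + 1)) - a (i + 1) * f (U i))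
            - (F (a i) (U i) (U (i + 1)) - a i * f (U i)))
          ((F (a i) (U (i - 1)) (U i) - a i * f (U (i - 1)))
            - (F (a (i - 1)) (U (i - 1)) (U i) - a (i - 1) * f (U (i - 1))))
    linarith
  have hsb := (((hU.mul_left (A₂ * κ)).add (hd'.mul_left (A₁ * (κ + L)))).add
    (hd.mul_left (A₁ * L))).mul_left lam
  have hp : ∀ i, |step lam F a U (i + 1) - step lam F a U i| ≤
      |step lam F Ta (fun j => U (j + 1)) i - step lam F Ta U i| +
      lam * (A₂ * κ * |U i| + A₁ * (κ + L) * |U (i - 1 + 1) - U (i - 1)|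
        + A₁ * L * |U (i + 1) - U i|) := by
    intro i
    rw [← hshift i]
    refine le_trans ?_ (add_le_add le_rfl (hbound i))
    refine le_trans (le_of_eq ?_) (abs_add_le _ _)
    ring_nf
  have hs := summable_abs_diff (tsum_abs_step_le hF f0 ha hU).1
  refine (hs.tsum_le_tsum hp (hc1.add hsb)).trans ?_
  rw [hc1.tsum_add hsb, tsum_mul_left, ((hU.mul_left (A₂ * κ)).add
    (hd'.mul_left (A₁ * (κ + L)))).tsum_add (hd.mul_left (A₁ * L)),
    (hU.mul_left (A₂ * κ)).tsum_add (hd'.mul_left (A₁ * (κ + L))), tsum_mul_left, tsum_mul_left,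
    tsum_mul_left, hdsum]
  refine (add_le_add hc2 le_rfl).trans (le_of_eq ?_)
  ring

lemma tsum_abs_step_sub_self_le (hf : ∀ x y, |f x - f y| ≤ κ * |x - y|) (f0 : f 0 = 0)
    (hκ : 0 ≤ κ) (hlam : 0 ≤ lam) (hF : IsMonotoneFlux f ν lam L F) (ha : ∀ i, a i ∈ range ν)
    (hA₁ : ∀ i, |a (i + 1) - a i| ≤ A₁) (hU : Summable fun i => |U i|) :
    (Summable fun i => |step lam F a U i - U i|) ∧
    ∑' i, |step lam F a U i - U i|
      ≤ lam * (2 * L * ∑' i, |U (i + 1) - U i| + A₁ * (κ + 2 * L) * ∑' i, |U i|) := by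
  have hL := lipschitz_nonneg hF
  have hd := summable_abs_diff hU
  have hd' : Summable fun i => |U (i - 1 + 1) - U (i - 1)| := summable_comp_sub hd 1
  have hU' : Summable fun i => |U (i - 1)| := summable_comp_sub hU 1
  have hdsum : ∑' i, |U (i - 1 + 1) - U (i - 1)| = ∑' i, |U (i + 1) - U i| :=
    tsum_comp_sub (fun i => |U (i + 1) - U i|) 1
  have hUsum : ∑' i, |U (i - 1)| = ∑' i, |U i| := tsum_comp_sub (fun i => |U i|) 1
  have hp : ∀ i, |step lam F a U i - U i| ≤ lam * (L * |U (i - 1 + 1) - U (i - 1)|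
      + L * |U (i + 1) - U i| + A₁ * (κ + L) * |U (i - 1)| + A₁ * L * |U i|) := by
    intro i
    have e := abs_flux_sub_le hf f0 hF (ha i) (ha (i - 1)) (U i) (U (i + 1)) (U (i - 1)) (U i)
    have a2 : |a i - a (i - 1)| ≤ A₁ := by simpa using hA₁ (i - 1)
    have key : step lam F a U i - U i = -lam * (F (a i) (U i) (U (i + 1))
        - F (a (i - 1)) (U (i - 1)) (U i)) := by
      simp only [step, update]
      ring
    rw [key, abs_mul, abs_neg, abs_of_nonneg hlam, sub_add_cancel]
    refine mul_le_mul_of_nonneg_left (e.trans ?_) hlam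
    have t : |U i - U (i - 1)| ≤ |U i| + |U (i - 1)| := abs_sub _ _
    have : |a i - a (i - 1)| * (κ * |U (i - 1)| + L * |U i - U (i - 1)|)
        ≤ A₁ * (κ * |U (i - 1)| + L * (|U i| + |U (i - 1)|)) := by
      have : 0 ≤ A₁ := (abs_nonneg _).trans a2
      gcongr
    linarith
  have s1 := hd'.mul_left L
  have s2 := hd.mul_left L
  have s3 := hU'.mul_left (A₁ * (κ + L))
  have s4 := hU.mul_left (A₁ * L)
  have hs := (((s1.add s2).add s3).add s4).mul_left lam
  have hl : Summable fun i => |step lam F a U i - U i| :=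
    Summable.of_nonneg_of_le (fun _ => abs_nonneg _) hp hs
  refine ⟨hl, (hl.tsum_le_tsum hp hs).trans (le_of_eq ?_)⟩
  rw [tsum_mul_left, ((s1.add s2).add s3).tsum_add s4, (s1.add s2).tsum_add s3, s1.tsum_add s2,
    tsum_mul_left, tsum_mul_left, tsum_mul_left, tsum_mul_left, hdsum, hUsum]
  ring

end Step

/-! ### The discrete nonlocal coefficient -/

/-- All bounds on the coefficients that the estimates use, with one common constant `κ`. -/
structure UniformBound (f β ν μ : ℝ → ℝ) (κ : ℝ) : Prop where
  nonneg : 0 ≤ κ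
  f_lip : ∀ x y, |f x - f y| ≤ κ * |x - y|
  f_zero : f 0 = 0
  β_lip : ∀ x y, |β x - β y| ≤ κ * |x - y|
  β_zero : β 0 = 0
  ν_diff : Differentiable ℝ ν
  ν_bdd : ∀ x, |ν x| ≤ κ
  ν_deriv : ∀ x, |deriv ν x| ≤ κ
  ν_deriv_lip : ∀ x y, |deriv ν x - deriv ν y| ≤ κ * |x - y|
  μ_diff : Differentiable ℝ μ
  μ_deriv_cont : Continuous (deriv μ)
  μ_bdd : ∀ x, |μ x| ≤ κ
  μ_deriv : ∀ x, |deriv μ x| ≤ κ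
  μ_deriv_lip : ∀ x y, |deriv μ x - deriv μ y| ≤ κ * |x - y|
  μ_int : Integrable (deriv μ)
  μ_tv : ∫ x, |deriv μ x| ≤ κ

lemma abs_sub_le_of_abs_deriv_le {g : ℝ → ℝ} {κ : ℝ} (hg : Differentiable ℝ g)
    (h : ∀ x, |deriv g x| ≤ κ) (x y : ℝ) : |g x - g y| ≤ κ * |x - y| :=
  Convex.norm_image_sub_le_of_norm_deriv_le (fun z _ => hg z) (fun z _ => h z) convex_univ
    (mem_univ y) (mem_univ x)

lemma IsC2BVW2.differentiable_deriv {g : ℝ → ℝ} (h : IsC2BVW2 g) : Differentiable ℝ (deriv g) :=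
  ((contDiff_succ_iff_deriv (n := 1)).1 h.contDiff).2.2.differentiable one_ne_zero

lemma Coefficients.exists_uniformBound {f β ν μ : ℝ → ℝ} (h : Coefficients f β ν μ) :
    ∃ κ, UniformBound f β ν μ κ := by
  obtain ⟨K, hK⟩ := h.f_lipschitz
  obtain ⟨b1, hb1⟩ := h.β_reg.bounded_deriv
  obtain ⟨n0, hn0⟩ := h.ν_reg.bounded
  obtain ⟨n1, hn1⟩ := h.ν_reg.bounded_deriv
  obtain ⟨n2, hn2⟩ := h.ν_reg.bounded_deriv2
  obtain ⟨m0, hm0⟩ := h.μ_reg.bounded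
  obtain ⟨m1, hm1⟩ := h.μ_reg.bounded_deriv
  obtain ⟨m2, hm2⟩ := h.μ_reg.bounded_deriv2
  have two : (2 : WithTop ℕ∞) ≠ 0 := two_ne_zero
  set κ : ℝ := K + |b1| + |n0| + |n1| + |n2| + |m0| + |m1| + |m2| + ∫ x, |deriv μ x| with hκ
  have hI : 0 ≤ ∫ x, |deriv μ x| := integral_nonneg fun _ => abs_nonneg _
  have hK0 : (0 : ℝ) ≤ K := K.2
  have e1 := le_abs_self b1
  have e2 := le_abs_self n0
  have e3 := le_abs_self n1
  have e4 := le_abs_self n2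
  have e5 := le_abs_self m0
  have e6 := le_abs_self m1
  have e7 := le_abs_self m2
  have f1 := abs_nonneg b1
  have f2 := abs_nonneg n0
  have f3 := abs_nonneg n1
  have f4 := abs_nonneg n2
  have f5 := abs_nonneg m0
  have f6 := abs_nonneg m1
  have f7 := abs_nonneg m2
  refine ⟨κ, ⟨by linarith, fun x y => ?_, h.f_zero, ?_, h.β_zero,
    h.ν_reg.contDiff.differentiable two, fun x => (hn0 x).trans (by linarith),
    fun x => (hn1 x).trans (by linarith), ?_, h.μ_reg.contDiff.differentiable two,
    h.μ_reg.differentiable_deriv.continuous, fun x => (hm0 x).trans (by linarith),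
    fun x => (hm1 x).trans (by linarith), ?_,
    integrable_deriv_of_boundedVariationOn (h.μ_reg.contDiff.of_le one_le_two)
      h.μ_reg.boundedVariation, by linarith⟩⟩
  · refine (hK.dist_le_mul x y).trans ?_
    rw [Real.dist_eq]
    gcongr
    linarith
  · exact abs_sub_le_of_abs_deriv_le (h.β_reg.contDiff.differentiable two)
      fun x => (hb1 x).trans (by linarith)
  · exact abs_sub_le_of_abs_deriv_le h.ν_reg.differentiable_deriv
      fun x => (hn2 x).trans (by linarith)
  · exact abs_sub_le_of_abs_deriv_le h.μ_reg.differentiable_deriv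
      fun x => (hm2 x).trans (by linarith)

/-- The interface state `U_{p+1/2} = (1 - θ_p) U_p + θ_p U_{p+1}`. -/
def interp (θ U : ℤ → ℝ) (p : ℤ) : ℝ := (1 - θ p) * U p + θ p * U (p + 1)

lemma abs_interp_sub_le {θ U : ℤ → ℝ} (hθ : ∀ p, θ p ∈ Icc (0 : ℝ) 1) (p : ℤ) :
    |interp θ U p - U p| ≤ |U (p + 1) - U p| := by
  have : interp θ U p - U p = θ p * (U (p + 1) - U p) := by rw [interp]; ring
  rw [this, abs_mul, abs_of_nonneg (hθ p).1]
  exact mul_le_of_le_one_left (abs_nonneg _) (hθ p).2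

lemma abs_interp_le {θ U : ℤ → ℝ} (hθ : ∀ p, θ p ∈ Icc (0 : ℝ) 1) (p : ℤ) :
    |interp θ U p| ≤ |U p| + |U (p + 1)| := by
  obtain ⟨h0, h1⟩ := hθ p
  refine (abs_add_le _ _).trans ?_
  rw [abs_mul, abs_mul, abs_of_nonneg h0, abs_of_nonneg (sub_nonneg.2 h1)]
  have := abs_nonneg (U p)
  have := abs_nonneg (U (p + 1))
  nlinarith

section Conv

variable {f β ν μ : ℝ → ℝ} {κ : ℝ} (hb : UniformBound f β ν μ κ)
variable {Δx : ℝ} (hΔx : 0 < Δx) {θ U : ℤ → ℝ} (hθ : ∀ p, θ p ∈ Icc (0 : ℝ) 1)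
  (hU : Summable fun i => |U i|)

include hb in
lemma UniformBound.abs_β_le (x : ℝ) : |β x| ≤ κ * |x| := by simpa [hb.β_zero] using hb.β_lip x 0

include hb in
lemma UniformBound.abs_f_le (x : ℝ) : |f x| ≤ κ * |x| := by simpa [hb.f_zero] using hb.f_lip x 0

include hb hθ hU in
lemma summable_abs_β_interp : Summable fun p => |β (interp θ U p)| :=
  Summable.of_nonneg_of_le (fun _ => abs_nonneg _)
    (fun p => (hb.abs_β_le _).trans (mul_le_mul_of_nonneg_left (abs_interp_le hθ p) hb.nonneg))
    ((hU.add (summable_comp_add hU 1)).mul_left κ)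

include hb hθ hU in
lemma tsum_abs_β_interp_le : ∑' p, |β (interp θ U p)| ≤ 2 * κ * ∑' p, |U p| := by
  have hU1 : Summable fun p => |U (p + 1)| := summable_comp_add hU 1
  refine ((summable_abs_β_interp hb hθ hU).tsum_le_tsum
    (fun p => (hb.abs_β_le _).trans (mul_le_mul_of_nonneg_left (abs_interp_le hθ p) hb.nonneg))
    ((hU.add hU1).mul_left κ)).trans (le_of_eq ?_)
  rw [tsum_mul_left, hU.tsum_add hU1, tsum_comp_add (fun p => |U p|) 1]
  ring

/-- A weighted sum with bounded weights. -/
lemma abs_tsum_mul_le {w b : ℤ → ℝ} {M : ℝ} (hw : ∀ p, |w p| ≤ M) (hs : Summable fun p => |b p|) :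
    (Summable fun p => w p * b p) ∧ |∑' p, w p * b p| ≤ M * ∑' p, |b p| := by
  have hle : ∀ p, ‖w p * b p‖ ≤ M * |b p| := fun p => by
    rw [Real.norm_eq_abs, abs_mul]
    exact mul_le_mul_of_nonneg_right (hw p) (abs_nonneg _)
  have hs' := hs.mul_left M
  refine ⟨Summable.of_norm_bounded hs' hle, ?_⟩
  have := tsum_of_norm_bounded hs'.hasSum hle
  rwa [tsum_mul_left] at this

include hb hΔx hθ hU in
lemma abs_discreteConv_sub_le (i : ℤ) :
    |discreteConv β μ Δx θ U (i + 1) - discreteConv β μ Δx θ U i|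
      ≤ 2 * κ ^ 2 * (Δx * ∑' p, |U p|) * Δx := by
  have hs := summable_abs_β_interp hb hθ hU
  have h1 := (abs_tsum_mul_le (w := fun p : ℤ => μ ((((i + 1 : ℤ) : ℝ) + 1 / 2 - p) * Δx))
    (fun p => hb.μ_bdd _) hs).1
  have h2 := (abs_tsum_mul_le (w := fun p : ℤ => μ (((i : ℝ) + 1 / 2 - p) * Δx))
    (fun p => hb.μ_bdd _) hs).1
  have h3 := (abs_tsum_mul_le (w := fun p : ℤ => μ ((((i + 1 : ℤ) : ℝ) + 1 / 2 - p) * Δx)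
    - μ (((i : ℝ) + 1 / 2 - p) * Δx)) (M := κ * Δx) (fun p => by
      refine (abs_sub_le_of_abs_deriv_le hb.μ_diff hb.μ_deriv _ _).trans_eq ?_
      congr 1
      rw [← sub_mul]
      push_cast
      ring_nf
      rw [abs_of_pos hΔx]) hs).2
  rw [show (fun p : ℤ => (μ ((((i + 1 : ℤ) : ℝ) + 1 / 2 - p) * Δx)
      - μ (((i : ℝ) + 1 / 2 - p) * Δx)) * β (interp θ U p)) = fun p : ℤ =>
      μ ((((i + 1 : ℤ) : ℝ) + 1 / 2 - p) * Δx) * β (interp θ U p)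
      - μ (((i : ℝ) + 1 / 2 - p) * Δx) * β (interp θ U p) from funext fun p => sub_mul _ _ _,
    h1.tsum_sub h2] at h3
  change |Δx * _ - Δx * _| ≤ _
  rw [← mul_sub, abs_mul, abs_of_pos hΔx]
  have h4 := tsum_abs_β_interp_le hb hθ hU
  calc _ ≤ Δx * (κ * Δx * (2 * κ * ∑' p, |U p|)) := by
        refine mul_le_mul_of_nonneg_left (h3.trans ?_) hΔx.le
        exact mul_le_mul_of_nonneg_left h4 (mul_nonneg hb.nonneg hΔx.le)
    _ = _ := by ring

lemma abs_second_diff_le {g : ℝ → ℝ} {κ : ℝ} (hg : Differentiable ℝ g)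
    (h : ∀ x y, |deriv g x - deriv g y| ≤ κ * |x - y|) (x d : ℝ) :
    |g (x + d) - 2 * g x + g (x - d)| ≤ κ * |d| * |d| := by
  have hd : ∀ z, HasDerivAt (fun z => g (z + d) - g z) (deriv g (z + d) - deriv g z) z := fun z =>
    ((hg (z + d)).hasDerivAt.comp_add_const z d).sub (hg z).hasDerivAt
  have := abs_sub_le_of_abs_deriv_le (g := fun z => g (z + d) - g z) (κ := κ * |d|)
    (fun z => (hd z).differentiableAt)
    (fun z => by rw [(hd z).deriv]; simpa using h (z + d) z) x (x - d)
  simp only [sub_add_cancel, sub_sub_cancel] at this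
  refine le_trans (le_of_eq ?_) this
  ring_nf

include hb hΔx hθ hU in
lemma abs_discreteConv_second_diff_le (i : ℤ) :
    |discreteConv β μ Δx θ U (i + 1) - 2 * discreteConv β μ Δx θ U i
        + discreteConv β μ Δx θ U (i - 1)|
      ≤ 2 * κ ^ 2 * (Δx * ∑' p, |U p|) * Δx ^ 2 := by
  have hs := summable_abs_β_interp hb hθ hU
  have h1 := (abs_tsum_mul_le (w := fun p : ℤ => μ ((((i + 1 : ℤ) : ℝ) + 1 / 2 - p) * Δx))
    (fun p => hb.μ_bdd _) hs).1
  have h2 := (abs_tsum_mul_le (w := fun p : ℤ => μ (((i : ℝ) + 1 / 2 - p) * Δx))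
    (fun p => hb.μ_bdd _) hs).1
  have h0 := (abs_tsum_mul_le (w := fun p : ℤ => μ ((((i - 1 : ℤ) : ℝ) + 1 / 2 - p) * Δx))
    (fun p => hb.μ_bdd _) hs).1
  have h3 := (abs_tsum_mul_le (w := fun p : ℤ => μ ((((i + 1 : ℤ) : ℝ) + 1 / 2 - p) * Δx)
    - 2 * μ (((i : ℝ) + 1 / 2 - p) * Δx) + μ ((((i - 1 : ℤ) : ℝ) + 1 / 2 - p) * Δx))
    (M := κ * Δx * Δx) (fun p => by
      have := abs_second_diff_le hb.μ_diff hb.μ_deriv_lip (((i : ℝ) + 1 / 2 - p) * Δx) Δx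
      rw [abs_of_pos hΔx] at this
      convert this using 6 <;> push_cast <;> ring) hs).2
  rw [show (fun p : ℤ => (μ ((((i + 1 : ℤ) : ℝ) + 1 / 2 - p) * Δx)
      - 2 * μ (((i : ℝ) + 1 / 2 - p) * Δx) + μ ((((i - 1 : ℤ) : ℝ) + 1 / 2 - p) * Δx))
        * β (interp θ U p)) = fun p : ℤ =>
      μ ((((i + 1 : ℤ) : ℝ) + 1 / 2 - p) * Δx) * β (interp θ U p)
      - 2 * (μ (((i : ℝ) + 1 / 2 - p) * Δx) * β (interp θ U p))
      + μ ((((i - 1 : ℤ) : ℝ) + 1 / 2 - p) * Δx) * β (interp θ U p) from funext fun p => by ring,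
    (h1.sub (h2.mul_left 2)).tsum_add h0, h1.tsum_sub (h2.mul_left 2), tsum_mul_left] at h3
  change |Δx * _ - 2 * (Δx * _) + Δx * _| ≤ _
  have h4 := tsum_abs_β_interp_le hb hθ hU
  calc _ = Δx * |(∑' p : ℤ, μ ((((i + 1 : ℤ) : ℝ) + 1 / 2 - p) * Δx) * β (interp θ U p))
          - 2 * (∑' p : ℤ, μ (((i : ℝ) + 1 / 2 - p) * Δx) * β (interp θ U p))
          + ∑' p : ℤ, μ ((((i - 1 : ℤ) : ℝ) + 1 / 2 - p) * Δx) * β (interp θ U p)| := by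
        rw [← abs_of_pos hΔx, ← abs_mul, abs_of_pos hΔx]
        congr 1
        simp only [interp]
        ring
    _ ≤ Δx * (κ * Δx * Δx * (2 * κ * ∑' p, |U p|)) := by
        refine mul_le_mul_of_nonneg_left (h3.trans ?_) hΔx.le
        exact mul_le_mul_of_nonneg_left h4
          (mul_nonneg (mul_nonneg hb.nonneg hΔx.le) hΔx.le)
    _ = _ := by ring

lemma exists_deriv_eq_slope_near {g : ℝ → ℝ} (hg : Differentiable ℝ g) (x y : ℝ) :
    ∃ ξ, |ξ - x| ≤ |y - x| ∧ g y - g x = deriv g ξ * (y - x) := by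
  rcases lt_trichotomy x y with h | h | h
  · obtain ⟨ξ, ⟨h1, h2⟩, h3⟩ := exists_deriv_eq_slope g h hg.continuous.continuousOn
      hg.differentiableOn
    refine ⟨ξ, ?_, by rw [h3, div_mul_cancel₀ _ (sub_pos.2 h).ne']⟩
    rw [abs_of_pos (sub_pos.2 h1), abs_of_pos (sub_pos.2 h)]
    linarith
  · exact ⟨x, by simp, by simp [h]⟩
  · obtain ⟨ξ, ⟨h1, h2⟩, h3⟩ := exists_deriv_eq_slope g h hg.continuous.continuousOn
      hg.differentiableOn
    refine ⟨ξ, ?_, ?_⟩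
    · rw [abs_of_neg (sub_neg.2 h2), abs_of_neg (sub_neg.2 h)]
      linarith
    · have : (x - y) ≠ 0 := (sub_pos.2 h).ne'
      rw [h3]
      field_simp
      ring

/-- A second difference of `g` along three arbitrary points. -/
lemma abs_comp_second_diff_le {g : ℝ → ℝ} {κ D D₂ : ℝ} (hg : Differentiable ℝ g)
    (h1 : ∀ x, |deriv g x| ≤ κ) (h2 : ∀ x y, |deriv g x - deriv g y| ≤ κ * |x - y|) (hκ : 0 ≤ κ)
    {x y z : ℝ} (hxy : |x - y| ≤ D) (hyz : |y - z| ≤ D) (hxyz : |x - 2 * y + z| ≤ D₂) :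
    |g x - 2 * g y + g z| ≤ κ * D₂ + κ * (2 * D) * D := by
  obtain ⟨ξ, hξ, e1⟩ := exists_deriv_eq_slope_near hg y x
  obtain ⟨η, hη, e2⟩ := exists_deriv_eq_slope_near hg y z
  have hD : 0 ≤ D := (abs_nonneg _).trans hxy
  have key : g x - 2 * g y + g z
      = deriv g ξ * (x - 2 * y + z) + (deriv g ξ - deriv g η) * (y - z) := by
    linear_combination e1 + e2
  have hd : |ξ - η| ≤ 2 * D := by
    calc |ξ - η| = |(ξ - y) - (η - y)| := by ring_nf
      _ ≤ |ξ - y| + |η - y| := abs_sub _ _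
      _ ≤ D + D := add_le_add (hξ.trans hxy) (hη.trans (by rwa [abs_sub_comm]))
      _ = 2 * D := by ring
  rw [key]
  refine (abs_add_le _ _).trans ?_
  rw [abs_mul, abs_mul]
  refine add_le_add (mul_le_mul (h1 _) hxyz (abs_nonneg _) hκ)
    (mul_le_mul ((h2 _ _).trans ?_) hyz (abs_nonneg _) (by positivity))
  gcongr

include hb hΔx hθ hU in
lemma abs_ν_discreteConv_sub_le {S : ℝ} (hS : Δx * ∑' p, |U p| ≤ S) (i : ℤ) :
    |ν (discreteConv β μ Δx θ U (i + 1)) - ν (discreteConv β μ Δx θ U i)|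
      ≤ 2 * κ ^ 3 * S * Δx := by
  refine (abs_sub_le_of_abs_deriv_le hb.ν_diff hb.ν_deriv _ _).trans ?_
  have hκ := hb.nonneg
  calc _ ≤ κ * (2 * κ ^ 2 * (Δx * ∑' p, |U p|) * Δx) := by
        gcongr
        exact abs_discreteConv_sub_le hb hΔx hθ hU i
    _ ≤ κ * (2 * κ ^ 2 * S * Δx) := by gcongr
    _ = _ := by ring

include hb hΔx hθ hU in
lemma abs_ν_discreteConv_second_diff_le {S : ℝ} (hS : Δx * ∑' p, |U p| ≤ S) (i : ℤ) :
    |ν (discreteConv β μ Δx θ U (i + 1)) - 2 * ν (discreteConv β μ Δx θ U i)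
        + ν (discreteConv β μ Δx θ U (i - 1))|
      ≤ (2 * κ ^ 3 * S + 8 * κ ^ 5 * S ^ 2) * Δx ^ 2 := by
  have hκ := hb.nonneg
  have h1 : ∀ j, |discreteConv β μ Δx θ U (j + 1) - discreteConv β μ Δx θ U j|
      ≤ 2 * κ ^ 2 * S * Δx := fun j =>
    (abs_discreteConv_sub_le hb hΔx hθ hU j).trans (by gcongr)
  have h2 : |discreteConv β μ Δx θ U (i + 1) - 2 * discreteConv β μ Δx θ U i
        + discreteConv β μ Δx θ U (i - 1)| ≤ 2 * κ ^ 2 * S * Δx ^ 2 :=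
    (abs_discreteConv_second_diff_le hb hΔx hθ hU i).trans (by gcongr)
  have h3 := h1 (i - 1)
  rw [sub_add_cancel] at h3
  refine (abs_comp_second_diff_le hb.ν_diff hb.ν_deriv hb.ν_deriv_lip hκ (h1 i) h3 h2).trans_eq ?_
  ring

end Conv

/-! ### Uniform bounds on the scheme -/

/-- The coefficient `ν(c_{i+1/2})` of the scheme at the interface `x_{i+1/2}`. -/
def gridCoeff (β ν μ : ℝ → ℝ) (Δx : ℝ) (θ U : ℤ → ℝ) (i : ℤ) : ℝ := ν (discreteConv β μ Δx θ U i)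

/-- The grid function `U` has discrete `L¹` norm and total variation at most `R`. -/
structure GridBound (Δx R : ℝ) (U : ℤ → ℝ) : Prop where
  summable : Summable fun i => |U i|
  l1 : Δx * ∑' i, |U i| ≤ R
  tv : ∑' i, |U (i + 1) - U i| ≤ R

lemma GridBound.nonneg {Δx R : ℝ} {U : ℤ → ℝ} (h : GridBound Δx R U) : 0 ≤ R :=
  (tsum_nonneg fun _ => abs_nonneg _).trans h.tv

lemma GridBound.mono {Δx R R' : ℝ} {U : ℤ → ℝ} (h : GridBound Δx R U) (hR : R ≤ R') :
    GridBound Δx R' U := ⟨h.summable, h.l1.trans hR, h.tv.trans hR⟩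

/-- `W` is a run of the scheme that obeys the following bounds, with the constant `R`, on the time
levels `n ≤ N`. -/
structure SchemeBound (β ν μ : ℝ → ℝ) (F : ℝ → ℝ → ℝ → ℝ) (Δx Δt R : ℝ) (θ : ℕ → ℤ → ℝ) (N : ℕ)
    (W : ℕ → ℤ → ℝ) : Prop where
  succ_eq : ∀ n, W (n + 1) = step (Δt / Δx) F (gridCoeff β ν μ Δx (θ n) (W n)) (W n)
  grid : ∀ n ≤ N, GridBound Δx R (W n)
  incr_summable : ∀ n ≤ N, Summable fun i => |W (n + 1) i - W n i|
  incr : ∀ n ≤ N, Δx * ∑' i, |W (n + 1) i - W n i| ≤ R * Δt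
  coeff : ∀ n ≤ N, ∀ i, |gridCoeff β ν μ Δx (θ n) (W n) (i + 1)
    - gridCoeff β ν μ Δx (θ n) (W n) i| ≤ R * Δx

/-- A discrete Gronwall inequality. -/
lemma le_exp_mul_of_le {y : ℕ → ℝ} {a b y₀ : ℝ} (ha : 0 ≤ a) (hb : 0 ≤ b) (hy₀ : 0 ≤ y₀)
    (h0 : y 0 ≤ y₀) (h : ∀ n, y (n + 1) ≤ (1 + a) * y n + b) (n : ℕ) :
    y n ≤ Real.exp (n * a) * (y₀ + n * b) := by
  induction n with
  | zero => simpa using h0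
  | succ n ih =>
    have e1 : 1 + a ≤ Real.exp a := by linarith [Real.add_one_le_exp a]
    have e2 : (1 : ℝ) ≤ Real.exp ((n + 1) * a) := Real.one_le_exp (by positivity)
    have e3 : Real.exp ((n + 1) * a) = Real.exp a * Real.exp (n * a) := by
      rw [← Real.exp_add]; ring_nf
    push_cast
    calc y (n + 1) ≤ (1 + a) * (Real.exp (n * a) * (y₀ + n * b)) + b := by
          refine (h n).trans ?_
          gcongr
      _ ≤ Real.exp a * (Real.exp (n * a) * (y₀ + n * b)) + Real.exp ((n + 1) * a) * b := by
          refine add_le_add (mul_le_mul_of_nonneg_right e1 (by positivity)) ?_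
          exact le_mul_of_one_le_left hb e2
      _ = _ := by rw [e3]; ring

/-- The `ℓ¹` norm, the total variation, the time increments and the coefficient increments of the
scheme are bounded on `[0, T]`, uniformly in the mesh, the flux and the weights. -/
lemma exists_scheme_bound {f β ν μ : ℝ → ℝ} {κ : ℝ} (hb : UniformBound f β ν μ κ) {u₀ : ℝ → ℝ}
    (hu₀ : InitialDatum u₀) (T : ℝ) (L : ℝ) :
    ∃ R : ℝ, 0 ≤ R ∧ ∀ (Δx Δt : ℝ) (N : ℕ) (F : ℝ → ℝ → ℝ → ℝ) (θ : ℕ → ℤ → ℝ),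
      0 < Δx → 0 < Δt → (N : ℝ) * Δt = T → IsMonotoneFlux f ν (Δt / Δx) L F →
      (∀ n p, θ n p ∈ Icc (0 : ℝ) 1) →
        SchemeBound β ν μ F Δx Δt R θ N (scheme β ν μ F Δx Δt θ u₀) := by
  obtain ⟨v, huv, hv⟩ := hu₀.boundedVariation
  set S := ∫ x, |u₀ x| with hS
  have hS0 : 0 ≤ S := integral_nonneg fun _ => abs_nonneg _
  set V := (eVariationOn v univ).toReal with hV
  have hV0 : 0 ≤ V := ENNReal.toReal_nonneg
  have hκ := hb.nonneg
  -- no flux has a negative Lipschitz constant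
  rcases lt_or_ge L 0 with hL | hL
  · refine ⟨0, le_rfl, fun Δx Δt N F θ _ _ _ hF => ?_⟩
    exact absurd (lipschitz_nonneg hF) (not_le.2 hL)
  -- `a` and `b` are the rates in the Gronwall inequality for the total variation
  set a := 2 * κ ^ 3 * S * (κ + 2 * L) with ha
  set b := (2 * κ ^ 3 * S + 8 * κ ^ 5 * S ^ 2) * κ * S with hbd
  have ha0 : 0 ≤ a := by positivity
  have hb0 : 0 ≤ b := by positivity
  set R₁ := Real.exp (T * a) * (V + T * b) with hR₁
  set R := |R₁| + S + (2 * L * |R₁| + a * S) + 2 * κ ^ 3 * S with hR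
  have hR₁0 := abs_nonneg R₁
  have p1 : 0 ≤ 2 * L * |R₁| + a * S := by positivity
  have p2 : 0 ≤ 2 * κ ^ 3 * S := by positivity
  refine ⟨R, by positivity, ?_⟩
  intro Δx Δt N F θ hΔx hΔt hN hF hθ
  set U := scheme β ν μ F Δx Δt θ u₀ with hU
  set A : ℕ → ℤ → ℝ := fun n => gridCoeff β ν μ Δx (θ n) (U n) with hA
  have hsucc : ∀ n i, U (n + 1) i = step (Δt / Δx) F (A n) (U n) i := fun n i => rfl
  have hlam : 0 ≤ Δt / Δx := by positivity
  have hAr : ∀ n i, A n i ∈ range ν := fun n i => mem_range_self _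
  have hsum : ∀ n, (Summable fun i => |U n i|) ∧ Δx * ∑' i, |U n i| ≤ S := by
    intro n
    induction n with
    | zero => exact ⟨summable_abs_cellAverage hu₀.integrable hΔx,
        tsum_abs_cellAverage_le hu₀.integrable hΔx⟩
    | succ n ih =>
      have h := tsum_abs_step_le hF hb.f_zero (hAr n) ih.1
      exact ⟨h.1, (mul_le_mul_of_nonneg_left h.2 hΔx.le).trans ih.2⟩
  have hA₁ : ∀ n i, |A n (i + 1) - A n i| ≤ 2 * κ ^ 3 * S * Δx := fun n i =>
    abs_ν_discreteConv_sub_le hb hΔx (hθ n) (hsum n).1 (hsum n).2 i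
  have hA₂ : ∀ n i, |A n (i + 1) - 2 * A n i + A n (i - 1)|
      ≤ (2 * κ ^ 3 * S + 8 * κ ^ 5 * S ^ 2) * Δx ^ 2 := fun n i =>
    abs_ν_discreteConv_second_diff_le hb hΔx (hθ n) (hsum n).1 (hsum n).2 i
  have hstep : ∀ n, ∑' i, |U (n + 1) (i + 1) - U (n + 1) i|
      ≤ (1 + a * Δt) * ∑' i, |U n (i + 1) - U n i| + b * Δt := by
    intro n
    refine (tsum_abs_step_diff_le hb.f_lip hb.f_zero hlam hF (hAr n) (hA₁ n) (hA₂ n)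
      (hsum n).1).trans ?_
    have e : Δt / Δx * ((2 * κ ^ 3 * S + 8 * κ ^ 5 * S ^ 2) * Δx ^ 2 * κ * ∑' i, |U n i|
        + 2 * κ ^ 3 * S * Δx * (κ + 2 * L) * ∑' i, |U n (i + 1) - U n i|)
        = Δt * (2 * κ ^ 3 * S + 8 * κ ^ 5 * S ^ 2) * κ * (Δx * ∑' i, |U n i|)
          + a * Δt * ∑' i, |U n (i + 1) - U n i| := by
      rw [ha]
      field_simp
    rw [e]
    have : Δt * (2 * κ ^ 3 * S + 8 * κ ^ 5 * S ^ 2) * κ * (Δx * ∑' i, |U n i|)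
        ≤ Δt * (2 * κ ^ 3 * S + 8 * κ ^ 5 * S ^ 2) * κ * S :=
      mul_le_mul_of_nonneg_left (hsum n).2 (by positivity)
    rw [hbd]
    linarith
  have htv : ∀ n ≤ N, ∑' i, |U n (i + 1) - U n i| ≤ |R₁| := by
    intro n hn
    have h0 : ∑' i, |U 0 (i + 1) - U 0 i| ≤ V :=
      tsum_abs_cellAverage_sub_le hu₀.integrable huv hv hΔx
    have hT : (n : ℝ) * Δt ≤ T := by
      rw [← hN]
      have : (n : ℝ) ≤ N := by exact_mod_cast hn
      gcongr
    refine le_trans ?_ (le_abs_self _)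
    calc ∑' i, |U n (i + 1) - U n i|
        ≤ Real.exp (n * (a * Δt)) * (V + n * (b * Δt)) :=
          le_exp_mul_of_le (y := fun n => ∑' i, |U n (i + 1) - U n i|) (by positivity)
            (by positivity) hV0 h0 hstep n
      _ = Real.exp (n * Δt * a) * (V + n * Δt * b) := by ring_nf
      _ ≤ R₁ := by
        rw [hR₁]
        gcongr
  have hincr := fun n => tsum_abs_step_sub_self_le hb.f_lip hb.f_zero hκ hlam hF (hAr n) (hA₁ n)
    (hsum n).1
  refine ⟨fun n => rfl, fun n hn => ⟨(hsum n).1, (hsum n).2.trans (by linarith),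
    (htv n hn).trans (by linarith)⟩, fun n _ => (hincr n).1, fun n hn => ?_,
    fun n _ i => (hA₁ n i).trans (by gcongr; linarith)⟩
  refine (mul_le_mul_of_nonneg_left (hincr n).2 hΔx.le).trans ?_
  have e : Δx * (Δt / Δx * (2 * L * ∑' i, |U n (i + 1) - U n i|
      + 2 * κ ^ 3 * S * Δx * (κ + 2 * L) * ∑' i, |U n i|))
      = (2 * L * ∑' i, |U n (i + 1) - U n i| + a * (Δx * ∑' i, |U n i|)) * Δt := by
    rw [ha]
    field_simp
  rw [e]
  refine mul_le_mul_of_nonneg_right ?_ hΔt.le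
  calc 2 * L * ∑' i, |U n (i + 1) - U n i| + a * (Δx * ∑' i, |U n i|)
      ≤ 2 * L * |R₁| + a * S := by
        have := htv n hn
        have := (hsum n).2
        gcongr
    _ ≤ R := by linarith

/-! ### Consistency of the discrete nonlocal coefficient -/

/-- The convolution `μ * β(u)` for the piecewise constant function `u` with grid values `U`. -/
def gridConv (β μ : ℝ → ℝ) (Δx : ℝ) (U : ℤ → ℝ) (z : ℝ) : ℝ :=
  ∫ ξ, μ (z - ξ) * β (U (cell Δx ξ))

/-- The convolution `μ' * β(u)`, which is the derivative of `gridConv`. -/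
def gridConvDeriv (β μ : ℝ → ℝ) (Δx : ℝ) (U : ℤ → ℝ) (z : ℝ) : ℝ :=
  ∫ ξ, deriv μ (z - ξ) * β (U (cell Δx ξ))

/-- `‖∫ g(ζ) Q(·, ζ) dζ‖₁ ≤ ‖g‖₁ sup_ζ ‖Q(·, ζ)‖₁`. -/
lemma integral_abs_integral_mul_le {g : ℝ → ℝ} (hg : Integrable g) (hgm : Measurable g)
    {Q : ℝ → ℝ → ℝ} (hQ : Measurable (Function.uncurry Q)) {B : ℝ}
    (hB0 : 0 ≤ B) (hQi : ∀ ζ, Integrable fun z => Q z ζ) (hB : ∀ ζ, ∫ z, |Q z ζ| ≤ B) :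
    (Integrable fun z => ∫ ζ, g ζ * Q z ζ) ∧ ∫ z, |∫ ζ, g ζ * Q z ζ| ≤ (∫ ζ, |g ζ|) * B := by
  have hm : Measurable (Function.uncurry fun z ζ => g ζ * Q z ζ) :=
    (hgm.comp measurable_snd).mul hQ
  have hsm : StronglyMeasurable fun z => ∫ ζ, g ζ * Q z ζ :=
    hm.stronglyMeasurable.integral_prod_right
  have hg0 : 0 ≤ ∫ ζ, |g ζ| := integral_nonneg fun _ => abs_nonneg _
  have key : ∫⁻ z, ‖∫ ζ, g ζ * Q z ζ‖ₑ ≤ ENNReal.ofReal ((∫ ζ, |g ζ|) * B) := by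
    calc ∫⁻ z, ‖∫ ζ, g ζ * Q z ζ‖ₑ ≤ ∫⁻ z, ∫⁻ ζ, ‖g ζ * Q z ζ‖ₑ :=
          lintegral_mono fun z => enorm_integral_le_lintegral_enorm _
      _ = ∫⁻ ζ, ∫⁻ z, ‖g ζ * Q z ζ‖ₑ := lintegral_lintegral_swap hm.enorm.aemeasurable
      _ ≤ ∫⁻ ζ, ‖g ζ‖ₑ * ENNReal.ofReal B := by
          refine lintegral_mono fun ζ => ?_
          simp only [enorm_mul]
          rw [lintegral_const_mul' _ _ enorm_ne_top]
          gcongr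
          rw [← ofReal_integral_norm_eq_lintegral_enorm (hQi ζ)]
          exact ENNReal.ofReal_le_ofReal (hB ζ)
      _ = ENNReal.ofReal ((∫ ζ, |g ζ|) * B) := by
          rw [lintegral_mul_const' _ _ ENNReal.ofReal_ne_top,
            ← ofReal_integral_norm_eq_lintegral_enorm hg, ENNReal.ofReal_mul hg0]
          rfl
  have hint : Integrable fun z => ∫ ζ, g ζ * Q z ζ :=
    ⟨hsm.aestronglyMeasurable, key.trans_lt ENNReal.ofReal_lt_top⟩
  refine ⟨hint, ?_⟩
  rw [← ofReal_integral_norm_eq_lintegral_enorm hint,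
    ENNReal.ofReal_le_ofReal_iff (mul_nonneg hg0 hB0)] at key
  exact key

section Consistency

variable {f β ν μ : ℝ → ℝ} {κ : ℝ} (hb : UniformBound f β ν μ κ)
variable {Δx R : ℝ} (hΔx : 0 < Δx) {θ U W : ℤ → ℝ} (hθ : ∀ p, θ p ∈ Icc (0 : ℝ) 1)
  (hU : GridBound Δx R U) (hW : GridBound Δx R W)

include hb hU in
lemma summable_β_grid : Summable fun i => β (U i) :=
  Summable.of_norm_bounded (hU.summable.mul_left κ) fun _ => hb.abs_β_le _

include hb hΔx hU in
lemma integral_abs_β_grid_le : ∫ ξ, |β (U (cell Δx ξ))| ≤ κ * R := by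
  rw [integral_comp_cell hΔx (summable_β_grid hb hU).abs]
  calc Δx * ∑' i, |β (U i)| ≤ Δx * (κ * ∑' i, |U i|) := by
        rw [← tsum_mul_left (a := κ)]
        exact mul_le_mul_of_nonneg_left ((summable_β_grid hb hU).abs.tsum_le_tsum
          (fun i => hb.abs_β_le _) (hU.summable.mul_left κ)) hΔx.le
    _ = κ * (Δx * ∑' i, |U i|) := by ring
    _ ≤ κ * R := mul_le_mul_of_nonneg_left hU.l1 hb.nonneg

/-- Bounded weights against an integrable function. -/
lemma abs_integral_mul_le {g b : ℝ → ℝ} {M : ℝ} (hgm : Measurable g) (hg : ∀ x, |g x| ≤ M)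
    (hb : Integrable b) :
    (Integrable fun x => g x * b x) ∧ |∫ x, g x * b x| ≤ M * ∫ x, |b x| := by
  have hi : Integrable fun x => g x * b x :=
    hb.bdd_mul hgm.aestronglyMeasurable (Eventually.of_forall hg)
  refine ⟨hi, ?_⟩
  rw [← integral_const_mul]
  refine abs_integral_le_integral_abs.trans (integral_mono hi.abs (hb.abs.const_mul M) fun x => ?_)
  simp only [abs_mul]
  exact mul_le_mul_of_nonneg_right (hg x) (abs_nonneg _)

include hb hΔx hU in
lemma hasDerivAt_gridConv (z : ℝ) :
    HasDerivAt (gridConv β μ Δx U) (gridConvDeriv β μ Δx U z) z := by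
  have hi := integrable_comp_cell hΔx (summable_β_grid hb hU)
  have hμm : Measurable μ := hb.μ_diff.continuous.measurable
  refine (hasDerivAt_integral_of_dominated_loc_of_deriv_le (s := univ)
    (F := fun z ξ => μ (z - ξ) * β (U (cell Δx ξ)))
    (F' := fun z ξ => deriv μ (z - ξ) * β (U (cell Δx ξ)))
    (bound := fun ξ => κ * |β (U (cell Δx ξ))|) univ_mem ?_ ?_ ?_ ?_ ?_ ?_).2
  · exact Eventually.of_forall fun y => (abs_integral_mul_le (g := fun ξ => μ (y - ξ))
      (hμm.comp (measurable_const.sub measurable_id)) (fun _ => hb.μ_bdd _)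
      hi).1.aestronglyMeasurable
  · exact (abs_integral_mul_le (g := fun ξ => μ (z - ξ))
      (hμm.comp (measurable_const.sub measurable_id)) (fun _ => hb.μ_bdd _) hi).1
  · exact (abs_integral_mul_le (g := fun ξ => deriv μ (z - ξ))
      (hb.μ_deriv_cont.measurable.comp (measurable_const.sub measurable_id))
      (fun _ => hb.μ_deriv _) hi).1.aestronglyMeasurable
  · refine Eventually.of_forall fun ξ y _ => ?_
    rw [Real.norm_eq_abs, abs_mul]
    exact mul_le_mul_of_nonneg_right (hb.μ_deriv _) (abs_nonneg _)
  · exact hi.abs.const_mul κ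
  · refine Eventually.of_forall fun ξ y _ => ?_
    exact ((hb.μ_diff (y - ξ)).hasDerivAt.comp_sub_const y ξ).mul_const _

include hb hΔx hU in
lemma abs_gridConvDeriv_le (z : ℝ) : |gridConvDeriv β μ Δx U z| ≤ κ ^ 2 * R := by
  refine (abs_integral_mul_le (g := fun ξ => deriv μ (z - ξ))
      (hb.μ_deriv_cont.measurable.comp (measurable_const.sub measurable_id))
      (fun _ => hb.μ_deriv _) (integrable_comp_cell hΔx (summable_β_grid hb hU))).2.trans ?_
  calc _ ≤ κ * (κ * R) := mul_le_mul_of_nonneg_left (integral_abs_β_grid_le hb hΔx hU) hb.nonneg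
    _ = _ := by ring

include hb hΔx hU in
lemma hasDerivAt_ν_gridConv (z : ℝ) :
    HasDerivAt (fun z => ν (gridConv β μ Δx U z))
      (deriv ν (gridConv β μ Δx U z) * gridConvDeriv β μ Δx U z) z :=
  (hb.ν_diff _).hasDerivAt.comp z (hasDerivAt_gridConv hb hΔx hU z)

include hb hΔx hU in
lemma abs_deriv_ν_gridConv_le (z : ℝ) :
    |deriv (fun z => ν (gridConv β μ Δx U z)) z| ≤ κ ^ 3 * R := by
  rw [(hasDerivAt_ν_gridConv hb hΔx hU z).deriv, abs_mul]
  calc _ ≤ κ * (κ ^ 2 * R) := mul_le_mul (hb.ν_deriv _) (abs_gridConvDeriv_le hb hΔx hU z)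
        (abs_nonneg _) hb.nonneg
    _ = _ := by ring

include hb hΔx hU hW in
/-- Stability of `∂ₓ ν(μ * β(u))` under perturbations of `u` in `L¹`. -/
lemma abs_deriv_ν_gridConv_sub_le {D : ℝ} (hs : Summable fun i => |U i - W i|)
    (hD : Δx * ∑' i, |U i - W i| ≤ D) (z : ℝ) :
    |deriv (fun z => ν (gridConv β μ Δx U z)) z - deriv (fun z => ν (gridConv β μ Δx W z)) z|
      ≤ (κ ^ 5 * R + κ ^ 3) * D := by
  have hκ := hb.nonneg
  have hR := hU.nonneg
  have hiU := integrable_comp_cell hΔx (summable_β_grid hb hU)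
  have hiW := integrable_comp_cell hΔx (summable_β_grid hb hW)
  have hle : ∫ ξ, |β (U (cell Δx ξ)) - β (W (cell Δx ξ))| ≤ κ * D := by
    have hsb : Summable fun i => |β (U i) - β (W i)| :=
      Summable.of_nonneg_of_le (fun _ => abs_nonneg _) (fun i => hb.β_lip _ _) (hs.mul_left κ)
    rw [integral_comp_cell hΔx hsb]
    calc Δx * ∑' i, |β (U i) - β (W i)| ≤ Δx * (κ * ∑' i, |U i - W i|) := by
          rw [← tsum_mul_left (a := κ)]
          exact mul_le_mul_of_nonneg_left (hsb.tsum_le_tsum (fun i => hb.β_lip _ _)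
            (hs.mul_left κ)) hΔx.le
      _ = κ * (Δx * ∑' i, |U i - W i|) := by ring
      _ ≤ κ * D := mul_le_mul_of_nonneg_left hD hκ
  have hgen : ∀ g : ℝ → ℝ, Measurable g → (∀ x, |g x| ≤ κ) →
      |(∫ ξ, g (z - ξ) * β (U (cell Δx ξ))) - ∫ ξ, g (z - ξ) * β (W (cell Δx ξ))|
        ≤ κ ^ 2 * D := by
    intro g hg hgb
    have hg' : Measurable fun ξ => g (z - ξ) := hg.comp (measurable_const.sub measurable_id)
    rw [← integral_sub (abs_integral_mul_le hg' (fun _ => hgb _) hiU).1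
      (abs_integral_mul_le hg' (fun _ => hgb _) hiW).1]
    simp only [← mul_sub]
    refine (abs_integral_mul_le hg' (fun _ => hgb _) (hiU.sub hiW)).2.trans ?_
    calc _ ≤ κ * (κ * D) := mul_le_mul_of_nonneg_left hle hκ
      _ = _ := by ring
  have h1 := hgen μ hb.μ_diff.continuous.measurable hb.μ_bdd
  have h2 := hgen (deriv μ) hb.μ_deriv_cont.measurable hb.μ_deriv
  change |gridConv β μ Δx U z - gridConv β μ Δx W z| ≤ _ at h1
  change |gridConvDeriv β μ Δx U z - gridConvDeriv β μ Δx W z| ≤ _ at h2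
  rw [(hasDerivAt_ν_gridConv hb hΔx hU z).deriv, (hasDerivAt_ν_gridConv hb hΔx hW z).deriv]
  set wU := gridConv β μ Δx U z
  set wW := gridConv β μ Δx W z
  set dU := gridConvDeriv β μ Δx U z with hdU
  set dW := gridConvDeriv β μ Δx W z
  have key : deriv ν wU * dU - deriv ν wW * dW
      = (deriv ν wU - deriv ν wW) * dU + deriv ν wW * (dU - dW) := by ring
  rw [key]
  refine (abs_add_le _ _).trans ?_
  rw [abs_mul, abs_mul]
  calc _ ≤ κ * (κ ^ 2 * D) * (κ ^ 2 * R) + κ * (κ ^ 2 * D) := by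
        refine add_le_add (mul_le_mul ((hb.ν_deriv_lip _ _).trans
          (mul_le_mul_of_nonneg_left h1 hκ)) (abs_gridConvDeriv_le hb hΔx hU z) (abs_nonneg _) ?_)
          (mul_le_mul (hb.ν_deriv _) h2 (abs_nonneg _) hκ)
        exact mul_nonneg hκ ((abs_nonneg _).trans h1)
    _ = _ := by ring

include hb hΔx hθ hU in
lemma integral_abs_β_interp_le : ∫ ξ, |β (interp θ U (cell Δx ξ))| ≤ 2 * κ * R := by
  have h := summable_abs_β_interp hb hθ hU.summable
  rw [integral_comp_cell hΔx (a := fun i => |β (interp θ U i)|) h]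
  calc Δx * ∑' i, |β (interp θ U i)| ≤ Δx * (2 * κ * ∑' i, |U i|) :=
        mul_le_mul_of_nonneg_left (tsum_abs_β_interp_le hb hθ hU.summable) hΔx.le
    _ = 2 * κ * (Δx * ∑' i, |U i|) := by ring
    _ ≤ 2 * κ * R := mul_le_mul_of_nonneg_left hU.l1 (mul_nonneg zero_le_two hb.nonneg)

include hb hΔx hθ hU in
/-- Uniform consistency of the discrete convolution, for a mesh of any size. -/
lemma abs_discreteConv_sub_gridConv_le (z : ℝ) :
    |discreteConv β μ Δx θ U (cell Δx z) - gridConv β μ Δx U z|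
      ≤ (3 * κ ^ 2 * R) * Δx := by
  have hκ := hb.nonneg
  have hs := summable_abs_β_interp hb hθ hU.summable
  have hiU := integrable_comp_cell hΔx (summable_β_grid hb hU)
  have hiI := integrable_comp_cell hΔx (a := fun i => β (interp θ U i)) hs.of_abs
  set x₀ : ℝ := ((cell Δx z : ℝ) + 1 / 2) * Δx with hx₀
  have hzx : |x₀ - z| ≤ Δx := by
    have := abs_le.1 (abs_sub_cell_le hΔx z)
    rw [hx₀, abs_le]
    constructor <;> linarith
  have hμm : Measurable μ := hb.μ_diff.continuous.measurable
  have m1 : Measurable fun ξ => μ (x₀ - cell Δx ξ * Δx) :=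
    measurable_comp_cell Δx fun i => μ (x₀ - i * Δx)
  have m2 : Measurable fun ξ => μ (z - ξ) := hμm.comp (measurable_const.sub measurable_id)
  have e : discreteConv β μ Δx θ U (cell Δx z)
      = ∫ ξ, μ (x₀ - cell Δx ξ * Δx) * β (interp θ U (cell Δx ξ)) := by
    rw [integral_comp_cell hΔx (a := fun i => μ (x₀ - i * Δx) * β (interp θ U i))
      (abs_tsum_mul_le (fun p => hb.μ_bdd _) hs).1, discreteConv]
    simp only [hx₀, sub_mul, interp]
  have i1 := (abs_integral_mul_le m1 (fun _ => hb.μ_bdd _) hiI).1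
  have i1' := (abs_integral_mul_le m1 (fun _ => hb.μ_bdd _) hiU).1
  have i2 := (abs_integral_mul_le m2 (fun _ => hb.μ_bdd _) hiU).1
  have e2 : discreteConv β μ Δx θ U (cell Δx z) - gridConv β μ Δx U z
      = (∫ ξ, μ (x₀ - cell Δx ξ * Δx) * (β (interp θ U (cell Δx ξ)) - β (U (cell Δx ξ))))
        + ∫ ξ, (μ (x₀ - cell Δx ξ * Δx) - μ (z - ξ)) * β (U (cell Δx ξ)) := by
    simp only [mul_sub, sub_mul]
    rw [integral_sub i1 i1', integral_sub i1' i2, e, gridConv]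
    ring
  have hsd : Summable fun i => |β (interp θ U i) - β (U i)| :=
    Summable.of_nonneg_of_le (fun _ => abs_nonneg _)
      (fun i => (hb.β_lip _ _).trans (mul_le_mul_of_nonneg_left (abs_interp_sub_le hθ i) hκ))
      ((summable_abs_diff hU.summable).mul_left κ)
  have b1 := (abs_integral_mul_le m1 (fun _ => hb.μ_bdd _) (hiI.sub hiU)).2
  have b1' : ∫ ξ, |β (interp θ U (cell Δx ξ)) - β (U (cell Δx ξ))| ≤ Δx * (κ * R) := by
    rw [integral_comp_cell hΔx (a := fun i => |β (interp θ U i) - β (U i)|) hsd]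
    refine mul_le_mul_of_nonneg_left ?_ hΔx.le
    refine (hsd.tsum_le_tsum (fun i => (hb.β_lip _ _).trans
      (mul_le_mul_of_nonneg_left (abs_interp_sub_le hθ i) hκ))
      ((summable_abs_diff hU.summable).mul_left κ)).trans ?_
    rw [tsum_mul_left]
    exact mul_le_mul_of_nonneg_left hU.tv hκ
  have hw : ∀ ξ, |μ (x₀ - cell Δx ξ * Δx) - μ (z - ξ)| ≤ κ * (2 * Δx) := by
    intro ξ
    refine (abs_sub_le_of_abs_deriv_le hb.μ_diff hb.μ_deriv _ _).trans ?_
    refine mul_le_mul_of_nonneg_left ?_ hκ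
    have h1 := abs_sub_cell_le hΔx ξ
    calc |x₀ - cell Δx ξ * Δx - (z - ξ)| = |(x₀ - z) + (ξ - cell Δx ξ * Δx)| := by ring_nf
      _ ≤ Δx + Δx / 2 := (abs_add_le _ _).trans (add_le_add hzx h1)
      _ ≤ 2 * Δx := by linarith
  have b2 := (abs_integral_mul_le (m1.sub m2) hw hiU).2
  have b2' := integral_abs_β_grid_le hb hΔx hU
  rw [e2]
  refine (abs_add_le _ _).trans ?_
  calc _ ≤ κ * (Δx * (κ * R)) + κ * (2 * Δx) * (κ * R) := by
        refine add_le_add (b1.trans (mul_le_mul_of_nonneg_left b1' hκ))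
          (b2.trans (mul_le_mul_of_nonneg_left b2' (by positivity)))
    _ = _ := by ring

include hb hΔx hθ hU in
lemma abs_gridCoeff_sub_ν_gridConv_le (z : ℝ) :
    |gridCoeff β ν μ Δx θ U (cell Δx z) - ν (gridConv β μ Δx U z)| ≤ (3 * κ ^ 3 * R) * Δx := by
  refine (abs_sub_le_of_abs_deriv_le hb.ν_diff hb.ν_deriv _ _).trans ?_
  calc _ ≤ κ * ((3 * κ ^ 2 * R) * Δx) :=
        mul_le_mul_of_nonneg_left (abs_discreteConv_sub_gridConv_le hb hΔx hθ hU z) hb.nonneg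
    _ = _ := by ring

lemma gridConvDeriv_eq (z : ℝ) :
    gridConvDeriv β μ Δx U z = ∫ ζ, deriv μ ζ * β (U (cell Δx (z - ζ))) := by
  rw [gridConvDeriv, ← integral_sub_left_eq_self (fun ζ => deriv μ ζ * β (U (cell Δx (z - ζ)))) _ z]
  simp only [sub_sub_cancel]

include hb hΔx hθ hU in
/-- The discrete derivative of the discrete convolution is itself an integral against `μ'`. -/
lemma discreteConv_diff_eq (i : ℤ) :
    discreteConv β μ Δx θ U i - discreteConv β μ Δx θ U (i - 1)
      = Δx * ∫ ζ, deriv μ ζ * β (interp θ U (i - cell Δx ζ)) := by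
  have hs := summable_abs_β_interp hb hθ hU.summable
  have hbd : ∀ p, |β (interp θ U p)| ≤ ∑' p, |β (interp θ U p)| := fun p =>
    hs.le_tsum p fun _ _ => abs_nonneg _
  have hi : Integrable fun ζ => deriv μ ζ * β (interp θ U (i - cell Δx ζ)) :=
    hb.μ_int.mul_bdd (measurable_comp_cell Δx fun q => β (interp θ U (i - q))).aestronglyMeasurable
      (Eventually.of_forall fun ζ => hbd _)
  set C : ℤ → Set ℝ := fun q => Ico (((q : ℝ) - 1 / 2) * Δx) (((q : ℝ) + 1 / 2) * Δx) with hC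
  have hdis : Pairwise (Function.onFun Disjoint C) := by
    intro q q' hqq
    refine Set.disjoint_left.2 fun x hx hx' => hqq ?_
    rw [← (cell_eq_iff hΔx).2 hx, ← (cell_eq_iff hΔx).2 hx']
  have hun : ⋃ q, C q = univ :=
    eq_univ_of_forall fun x => mem_iUnion.2 ⟨cell Δx x, (cell_eq_iff hΔx).1 rfl⟩
  have hsum := hasSum_integral_iUnion (fun q => measurableSet_Ico) hdis hi.integrableOn
  rw [hun, setIntegral_univ] at hsum
  have hcell : ∀ q : ℤ, ∫ ζ in C q, deriv μ ζ * β (interp θ U (i - cell Δx ζ))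
      = (μ (((q : ℝ) + 1 / 2) * Δx) - μ (((q : ℝ) - 1 / 2) * Δx)) * β (interp θ U (i - q)) := by
    intro q
    rw [setIntegral_congr_fun (g := fun ζ => deriv μ ζ * β (interp θ U (i - q)))
      measurableSet_Ico (fun ζ hζ => by
        simp only
        rw [(cell_eq_iff hΔx).2 hζ]), integral_mul_const, integral_Ico_eq_integral_Ioc,
      ← intervalIntegral.integral_of_le (by nlinarith),
      intervalIntegral.integral_deriv_eq_sub (fun x _ => hb.μ_diff x)
        (hb.μ_deriv_cont.intervalIntegrable _ _)]
  have htsum := hsum.tsum_eq.symm.trans (tsum_congr hcell)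
  have h1 := (abs_tsum_mul_le (w := fun p : ℤ => μ (((i : ℝ) + 1 / 2 - p) * Δx))
    (fun p => hb.μ_bdd _) hs).1
  have h0 := (abs_tsum_mul_le (w := fun p : ℤ => μ ((((i - 1 : ℤ) : ℝ) + 1 / 2 - p) * Δx))
    (fun p => hb.μ_bdd _) hs).1
  rw [htsum, ← (Equiv.subLeft i).tsum_eq]
  change Δx * _ - Δx * _ = _
  rw [← mul_sub]
  congr 1
  change (∑' p : ℤ, μ (((i : ℝ) + 1 / 2 - p) * Δx) * β (interp θ U p))
    - (∑' p : ℤ, μ ((((i - 1 : ℤ) : ℝ) + 1 / 2 - p) * Δx) * β (interp θ U p)) = _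
  rw [← h1.tsum_sub h0]
  refine tsum_congr fun p => ?_
  simp only [Equiv.subLeft_apply, sub_sub_cancel, ← sub_mul]
  congr 3 <;> congr 1 <;> push_cast <;> ring

/-- The cell of `z - ζ` is at most one away from the difference of the cells of `z` and `ζ`, so the
cell value there is within the neighbouring jumps of the interface value. -/
lemma abs_β_grid_sub_interp_le (hβ : ∀ x y, |β x - β y| ≤ κ * |x - y|) (hκ : 0 ≤ κ)
    (hΔx : 0 < Δx) (hθ : ∀ p, θ p ∈ Icc (0 : ℝ) 1) (z ζ : ℝ) :
    |β (U (cell Δx (z - ζ))) - β (interp θ U (cell Δx z - cell Δx ζ))|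
      ≤ κ * (|U (cell Δx z - cell Δx ζ - 1 + 1) - U (cell Δx z - cell Δx ζ - 1)|
        + 2 * |U (cell Δx z - cell Δx ζ + 1) - U (cell Δx z - cell Δx ζ)|) := by
  refine (hβ _ _).trans (mul_le_mul_of_nonneg_left ?_ hκ)
  set q := cell Δx z - cell Δx ζ
  have h := abs_interp_sub_le (U := U) hθ q
  have key : |U (cell Δx (z - ζ)) - U q| ≤ |U (q - 1 + 1) - U (q - 1)| + |U (q + 1) - U q| := by
    rw [sub_add_cancel]
    rcases cell_sub hΔx z ζ with h | h | h
    · rw [h, abs_sub_comm]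
      linarith [abs_nonneg (U (q + 1) - U q)]
    · rw [h, sub_self, abs_zero]
      positivity
    · rw [h]
      linarith [abs_nonneg (U q - U (q - 1))]
  have t := abs_sub_le (U (cell Δx (z - ζ))) (U q) (interp θ U q)
  rw [abs_sub_comm (U q) (interp θ U q)] at t
  linarith

include hb hΔx hθ hU in
/-- Consistency in `L¹` of the discrete derivative of the discrete convolution. Only `μ' ∈ L¹` and
the total variation of `U` enter, so that `μ'` need not have bounded variation. -/
lemma integral_abs_gridConvDeriv_sub_le :
    (Integrable fun z => gridConvDeriv β μ Δx U z
      - (discreteConv β μ Δx θ U (cell Δx z) - discreteConv β μ Δx θ U (cell Δx z - 1)) / Δx) ∧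
    ∫ z, |gridConvDeriv β μ Δx U z
      - (discreteConv β μ Δx θ U (cell Δx z) - discreteConv β μ Δx θ U (cell Δx z - 1)) / Δx|
      ≤ 3 * κ ^ 2 * R * Δx := by
  have hκ := hb.nonneg
  have hR := hU.nonneg
  have hs := summable_abs_β_interp hb hθ hU.summable
  have hd := summable_abs_diff hU.summable
  have hd' : Summable fun i => |U (i - 1 + 1) - U (i - 1)| := summable_comp_sub hd 1
  set τ : ℤ → ℝ := fun q => κ * (|U (q - 1 + 1) - U (q - 1)| + 2 * |U (q + 1) - U q|) with hτ
  have hτs : Summable τ := (hd'.add (hd.mul_left 2)).mul_left κ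
  have hτsum : ∑' q, τ q ≤ 3 * κ * R := by
    rw [hτ, tsum_mul_left, hd'.tsum_add (hd.mul_left 2), tsum_mul_left,
      tsum_comp_sub (fun i => |U (i + 1) - U i|) 1]
    have := hU.tv
    nlinarith
  set Q : ℝ → ℝ → ℝ := fun z ζ =>
    β (U (cell Δx (z - ζ))) - β (interp θ U (cell Δx z - cell Δx ζ)) with hQ
  have hc1 : Measurable fun p : ℝ × ℝ => cell Δx p.1 := (measurable_cell Δx).comp measurable_fst
  have hc2 : Measurable fun p : ℝ × ℝ => cell Δx p.2 := (measurable_cell Δx).comp measurable_snd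
  have hQm : Measurable (Function.uncurry Q) := by
    refine Measurable.sub ?_ ?_
    · exact (measurable_comp_cell Δx fun i => β (U i)).comp (measurable_fst.sub measurable_snd)
    · exact (measurable_from_top (f := fun q : ℤ => β (interp θ U q))).comp (hc1.sub hc2)
  have hQle : ∀ z ζ, |Q z ζ| ≤ τ (cell Δx z - cell Δx ζ) := fun z ζ =>
    abs_β_grid_sub_interp_le hb.β_lip hκ hΔx hθ z ζ
  have hτi : ∀ ζ, Integrable fun z => τ (cell Δx z - cell Δx ζ) := fun ζ =>
    integrable_comp_cell hΔx (a := fun i => τ (i - cell Δx ζ)) (summable_comp_sub hτs _)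
  have hQi : ∀ ζ, Integrable fun z => Q z ζ := fun ζ =>
    (hτi ζ).mono' (hQm.comp (measurable_id.prodMk measurable_const)).aestronglyMeasurable
      (Eventually.of_forall fun z => hQle z ζ)
  have hQB : ∀ ζ, ∫ z, |Q z ζ| ≤ 3 * κ * R * Δx := by
    intro ζ
    refine (integral_mono (hQi ζ).abs (hτi ζ) fun z => hQle z ζ).trans ?_
    rw [integral_comp_cell hΔx (a := fun i => τ (i - cell Δx ζ)) (summable_comp_sub hτs _),
      tsum_comp_sub]
    linarith [mul_le_mul_of_nonneg_left hτsum hΔx.le]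
  have hbd : ∀ p, |β (interp θ U p)| ≤ ∑' p, |β (interp θ U p)| := fun p =>
    hs.le_tsum p fun _ _ => abs_nonneg _
  have hbd' : ∀ p, |β (U p)| ≤ ∑' p, |β (U p)| := fun p =>
    (summable_β_grid hb hU).abs.le_tsum p fun _ _ => abs_nonneg _
  have e : ∀ z, gridConvDeriv β μ Δx U z
      - (discreteConv β μ Δx θ U (cell Δx z) - discreteConv β μ Δx θ U (cell Δx z - 1)) / Δx
      = ∫ ζ, deriv μ ζ * Q z ζ := by
    intro z
    rw [discreteConv_diff_eq hb hΔx hθ hU, gridConvDeriv_eq, mul_div_cancel_left₀ _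
      hΔx.ne', ← integral_sub]
    · simp only [hQ, mul_sub]
    · exact hb.μ_int.mul_bdd (((measurable_comp_cell Δx fun i => β (U i)).comp
        (measurable_const.sub measurable_id)).aestronglyMeasurable)
        (Eventually.of_forall fun ζ => hbd' _)
    · exact hb.μ_int.mul_bdd (measurable_comp_cell Δx
        fun q => β (interp θ U (cell Δx z - q))).aestronglyMeasurable
        (Eventually.of_forall fun ζ => hbd _)
  simp only [e]
  obtain ⟨h1, h2⟩ := integral_abs_integral_mul_le hb.μ_int hb.μ_deriv_cont.measurable hQm
    (by positivity) hQi hQB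
  refine ⟨h1, h2.trans ?_⟩
  calc _ ≤ κ * (3 * κ * R * Δx) := mul_le_mul_of_nonneg_right hb.μ_tv (by positivity)
    _ = _ := by ring

include hb hΔx hθ hU in
lemma integral_abs_discreteConv_diff_le :
    (Integrable fun z =>
      (discreteConv β μ Δx θ U (cell Δx z) - discreteConv β μ Δx θ U (cell Δx z - 1)) / Δx) ∧
    ∫ z, |(discreteConv β μ Δx θ U (cell Δx z) - discreteConv β μ Δx θ U (cell Δx z - 1)) / Δx|
      ≤ 2 * κ ^ 2 * R := by
  have hκ := hb.nonneg
  have hR := hU.nonneg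
  have hs := summable_abs_β_interp hb hθ hU.summable
  set Q : ℝ → ℝ → ℝ := fun z ζ => β (interp θ U (cell Δx z - cell Δx ζ)) with hQ
  have hc1 : Measurable fun p : ℝ × ℝ => cell Δx p.1 := (measurable_cell Δx).comp measurable_fst
  have hc2 : Measurable fun p : ℝ × ℝ => cell Δx p.2 := (measurable_cell Δx).comp measurable_snd
  have hQm : Measurable (Function.uncurry Q) :=
    (measurable_from_top (f := fun q : ℤ => β (interp θ U q))).comp (hc1.sub hc2)
  have hQi : ∀ ζ, Integrable fun z => Q z ζ := fun ζ =>
    integrable_comp_cell hΔx (a := fun i => β (interp θ U (i - cell Δx ζ)))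
      (summable_comp_sub hs.of_abs _)
  have hQB : ∀ ζ, ∫ z, |Q z ζ| ≤ 2 * κ * R := by
    intro ζ
    rw [integral_comp_cell hΔx (a := fun i => |β (interp θ U (i - cell Δx ζ))|)
      (summable_comp_sub hs _), tsum_comp_sub (fun i => |β (interp θ U i)|),
      ← integral_comp_cell hΔx hs]
    exact integral_abs_β_interp_le hb hΔx hθ hU
  have e : ∀ z, (discreteConv β μ Δx θ U (cell Δx z)
      - discreteConv β μ Δx θ U (cell Δx z - 1)) / Δx = ∫ ζ, deriv μ ζ * Q z ζ := by
    intro z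
    rw [discreteConv_diff_eq hb hΔx hθ hU, mul_div_cancel_left₀ _ hΔx.ne']
  simp only [e]
  obtain ⟨h1, h2⟩ := integral_abs_integral_mul_le hb.μ_int hb.μ_deriv_cont.measurable hQm
    (by positivity) hQi hQB
  refine ⟨h1, h2.trans ?_⟩
  calc _ ≤ κ * (2 * κ * R) := mul_le_mul_of_nonneg_right hb.μ_tv (by positivity)
    _ = _ := by ring

include hb hΔx hθ hU in
/-- Consistency in `L¹` of the discrete derivative of the coefficient `ν(μ * β(u))`. -/
lemma integral_abs_deriv_sub_gridCoeff_diff_le :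
    (Integrable fun z => deriv (fun z => ν (gridConv β μ Δx U z)) z
      - (gridCoeff β ν μ Δx θ U (cell Δx z) - gridCoeff β ν μ Δx θ U (cell Δx z - 1)) / Δx) ∧
    ∫ z, |deriv (fun z => ν (gridConv β μ Δx U z)) z
      - (gridCoeff β ν μ Δx θ U (cell Δx z) - gridCoeff β ν μ Δx θ U (cell Δx z - 1)) / Δx|
      ≤ (3 * κ ^ 3 * R + 10 * κ ^ 5 * R ^ 2) * Δx := by
  have hκ := hb.nonneg
  have hR := hU.nonneg
  obtain ⟨i1, b1⟩ := integral_abs_gridConvDeriv_sub_le hb hΔx hθ hU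
  obtain ⟨i2, b2⟩ := integral_abs_discreteConv_diff_le hb hΔx hθ hU
  set c := discreteConv β μ Δx θ U with hc
  have hpt : ∀ z, |deriv (fun z => ν (gridConv β μ Δx U z)) z
      - (gridCoeff β ν μ Δx θ U (cell Δx z) - gridCoeff β ν μ Δx θ U (cell Δx z - 1)) / Δx|
      ≤ κ * |gridConvDeriv β μ Δx U z - (c (cell Δx z) - c (cell Δx z - 1)) / Δx|
        + 5 * κ ^ 3 * R * Δx * |(c (cell Δx z) - c (cell Δx z - 1)) / Δx| := by
    intro z
    rw [(hasDerivAt_ν_gridConv hb hΔx hU z).deriv]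
    simp only [gridCoeff, ← hc]
    set i := cell Δx z
    obtain ⟨ξ, hξ, e⟩ := exists_deriv_eq_slope_near hb.ν_diff (c i) (c (i - 1))
    have hstep : |c (i - 1) - c i| ≤ 2 * κ ^ 2 * R * Δx := by
      have h := abs_discreteConv_sub_le hb hΔx hθ hU.summable (i - 1)
      rw [sub_add_cancel, abs_sub_comm] at h
      refine h.trans ?_
      have := hU.l1
      gcongr
    have hw := abs_discreteConv_sub_gridConv_le hb hΔx hθ hU z
    rw [← hc] at hw
    have hξw : |ξ - gridConv β μ Δx U z| ≤ 5 * κ ^ 2 * R * Δx := by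
      have := abs_sub_le ξ (c i) (gridConv β μ Δx U z)
      linarith
    set w := gridConv β μ Δx U z
    set w' := gridConvDeriv β μ Δx U z
    have e' : (ν (c i) - ν (c (i - 1))) / Δx = deriv ν ξ * ((c i - c (i - 1)) / Δx) := by
      rw [← mul_div_assoc]
      congr 1
      linarith
    rw [e']
    set D := (c i - c (i - 1)) / Δx
    have key : deriv ν w * w' - deriv ν ξ * D
        = deriv ν w * (w' - D) - (deriv ν ξ - deriv ν w) * D := by ring
    rw [key]
    refine (abs_sub _ _).trans ?_
    rw [abs_mul, abs_mul]
    refine add_le_add (mul_le_mul_of_nonneg_right (hb.ν_deriv _) (abs_nonneg _))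
      (mul_le_mul_of_nonneg_right ((hb.ν_deriv_lip _ _).trans ?_) (abs_nonneg _))
    calc κ * |ξ - w| ≤ κ * (5 * κ ^ 2 * R * Δx) := mul_le_mul_of_nonneg_left hξw hκ
      _ = _ := by ring
  have hi := (i1.abs.const_mul κ).add (i2.abs.const_mul (5 * κ ^ 3 * R * Δx))
  have hm : Measurable fun z => deriv (fun z => ν (gridConv β μ Δx U z)) z
      - (gridCoeff β ν μ Δx θ U (cell Δx z) - gridCoeff β ν μ Δx θ U (cell Δx z - 1)) / Δx :=
    (measurable_deriv _).sub (measurable_comp_cell Δx fun i =>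
      (gridCoeff β ν μ Δx θ U i - gridCoeff β ν μ Δx θ U (i - 1)) / Δx)
  have hint := hi.mono' hm.aestronglyMeasurable (Eventually.of_forall hpt)
  refine ⟨hint, (integral_mono hint.abs hi hpt).trans ?_⟩
  rw [integral_add' (i1.abs.const_mul κ) (i2.abs.const_mul _), integral_const_mul,
    integral_const_mul]
  calc _ ≤ κ * (3 * κ ^ 2 * R * Δx) + 5 * κ ^ 3 * R * Δx * (2 * κ ^ 2 * R) :=
        add_le_add (mul_le_mul_of_nonneg_left b1 hκ)
          (mul_le_mul_of_nonneg_left b2 (by positivity))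
    _ = _ := by ring

end Consistency

/-! ### Flux and source terms tested against a spatial kernel -/

lemma entropyFlux_eq (f : ℝ → ℝ) (a b : ℝ) :
    entropyFlux f a b = f (max a b) - f (min a b) := by
  rw [entropyFlux]
  rcases lt_trichotomy a b with h | h | h
  · rw [Real.sign_of_neg (sub_neg.2 h), max_eq_right h.le, min_eq_left h.le]; ring
  · simp [h]
  · rw [Real.sign_of_pos (sub_pos.2 h), max_eq_left h.le, min_eq_right h.le]; ring

lemma abs_entropyFlux_le {f : ℝ → ℝ} {κ : ℝ} (hf : ∀ x y, |f x - f y| ≤ κ * |x - y|) (a b : ℝ) :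
    |entropyFlux f a b| ≤ κ * |a - b| := by
  rw [entropyFlux_eq]
  refine (hf _ _).trans_eq ?_
  rw [max_sub_min_eq_abs', abs_abs]

lemma abs_sign_le_one (x : ℝ) : |Real.sign x| ≤ 1 := by
  rcases Real.sign_apply_eq x with h | h | h <;> simp [h]

lemma abs_integral_le_of_abs_le {u v : ℝ → ℝ} (hv : Integrable v) (h : ∀ x, |u x| ≤ v x) :
    |∫ x, u x| ≤ ∫ x, v x :=
  norm_integral_le_of_norm_le (f := u) hv (Eventually.of_forall h)

/-- The part of the bound for the numerical entropy fluxes near the cell `C_i` that is summable over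
`i`; `A₁` bounds the increments of the coefficient. -/
def fluxJump (L κ A₁ : ℝ) (U : ℤ → ℝ) (i : ℤ) : ℝ :=
  2 * L * (|U (i - 1 + 1) - U (i - 1)| + 2 * |U (i + 1) - U i|)
    + 2 * A₁ * ((κ + L) * |U (i - 1)| + L * |U i|)

section Flux

variable {f ν : ℝ → ℝ} {lam L κ A₁ : ℝ} {F : ℝ → ℝ → ℝ → ℝ} {a U : ℤ → ℝ}

lemma abs_max_sub_max_le (x y k : ℝ) : |max x k - max y k| ≤ |x - y| := by
  simpa using abs_max_sub_max_le_max x k y k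

lemma abs_min_sub_min_le (x y k : ℝ) : |min x k - min y k| ≤ |x - y| := by
  simpa using abs_min_sub_min_le_max x k y k

lemma abs_max_le (x k : ℝ) : |max x k| ≤ |x| + |k| := by
  rcases max_choice x k with h | h <;> rw [h] <;> linarith [abs_nonneg x, abs_nonneg k]

lemma abs_min_le (x k : ℝ) : |min x k| ≤ |x| + |k| := by
  rcases min_choice x k with h | h <;> rw [h] <;> linarith [abs_nonneg x, abs_nonneg k]

lemma abs_numFlux_sub_le (hf : ∀ x y, |f x - f y| ≤ κ * |x - y|) (f0 : f 0 = 0) (hκ : 0 ≤ κ)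
    (hF : IsMonotoneFlux f ν lam L F) (ha : ∀ i, a i ∈ range ν)
    (hA₁ : ∀ i, |a (i + 1) - a i| ≤ A₁) (k : ℝ) (i : ℤ) :
    |numFlux F a U (fun _ => k) i - numFlux F a U (fun _ => k) (i - 1)|
      ≤ 2 * L * (|U (i - 1 + 1) - U (i - 1)| + |U (i + 1) - U i|)
        + 2 * A₁ * ((κ + L) * |U (i - 1)| + L * |U i|) + 2 * A₁ * κ * |k| := by
  have hL := lipschitz_nonneg hF
  have hA : |a i - a (i - 1)| ≤ A₁ := by simpa using hA₁ (i - 1)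
  have hA0 : 0 ≤ A₁ := (abs_nonneg _).trans hA
  have t := abs_sub (U i) (U (i - 1))
  have gen : ∀ m : ℝ → ℝ, (∀ x y, |m x - m y| ≤ |x - y|) → (∀ x, |m x| ≤ |x| + |k|) →
      |F (a i) (m (U i)) (m (U (i + 1))) - F (a (i - 1)) (m (U (i - 1))) (m (U i))|
        ≤ L * (|U i - U (i - 1)| + |U (i + 1) - U i|)
          + A₁ * (κ * (|U (i - 1)| + |k|) + L * (|U i| + |U (i - 1)|)) := by
    intro m hm hm'
    refine (abs_flux_sub_le hf f0 hF (ha i) (ha (i - 1)) _ _ _ _).trans ?_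
    refine add_le_add (mul_le_mul_of_nonneg_left (add_le_add (hm _ _) (hm _ _)) hL)
      (mul_le_mul hA (add_le_add (mul_le_mul_of_nonneg_left (hm' _) hκ)
        (mul_le_mul_of_nonneg_left ((hm _ _).trans t) hL)) (by positivity) hA0)
  have h1 := gen (fun x => max x k) (fun x y => abs_max_sub_max_le x y k) (fun x => abs_max_le x k)
  have h2 := gen (fun x => min x k) (fun x y => abs_min_sub_min_le x y k) (fun x => abs_min_le x k)
  have e : numFlux F a U (fun _ => k) i - numFlux F a U (fun _ => k) (i - 1)
      = (F (a i) (max (U i) k) (max (U (i + 1)) k)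
          - F (a (i - 1)) (max (U (i - 1)) k) (max (U i) k))
        - (F (a i) (min (U i) k) (min (U (i + 1)) k)
          - F (a (i - 1)) (min (U (i - 1)) k) (min (U i) k)) := by
    simp only [numFlux, sub_add_cancel]
    ring
  rw [e, sub_add_cancel]
  refine (abs_sub _ _).trans ?_
  linarith

lemma abs_numFlux_sub_entropyFlux_le (hF : IsMonotoneFlux f ν lam L F)
    (ha : ∀ i, a i ∈ range ν) (k : ℝ) (i : ℤ) :
    |numFlux F a U (fun _ => k) i - a i * entropyFlux f (U i) k| ≤ 2 * L * |U (i + 1) - U i| := by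
  have hL := lipschitz_nonneg hF
  have e : numFlux F a U (fun _ => k) i - a i * entropyFlux f (U i) k
      = (F (a i) (max (U i) k) (max (U (i + 1)) k) - F (a i) (max (U i) k) (max (U i) k))
        - (F (a i) (min (U i) k) (min (U (i + 1)) k) - F (a i) (min (U i) k) (min (U i) k)) := by
    rw [entropyFlux_eq, hF.consistent _ (ha i), hF.consistent _ (ha i), numFlux]
    ring
  have h1 := hF.lipschitz _ (ha i) (max (U i) k) (max (U (i + 1)) k) (max (U i) k) (max (U i) k)
  have h2 := hF.lipschitz _ (ha i) (min (U i) k) (min (U (i + 1)) k) (min (U i) k) (min (U i) k)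
  have h3 := mul_le_mul_of_nonneg_left (abs_max_sub_max_le (U (i + 1)) (U i) k) hL
  have h4 := mul_le_mul_of_nonneg_left (abs_min_sub_min_le (U (i + 1)) (U i) k) hL
  rw [sub_self, abs_zero, zero_add] at h1 h2
  rw [e]
  refine (abs_sub _ _).trans ?_
  linarith

variable (hf : ∀ x y, |f x - f y| ≤ κ * |x - y|) (f0 : f 0 = 0) (hκ : 0 ≤ κ)
    (hF : IsMonotoneFlux f ν lam L F) (ha : ∀ i, a i ∈ range ν)
    (hA₁ : ∀ i, |a (i + 1) - a i| ≤ A₁)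

include hf f0 hκ hF ha hA₁ in
lemma abs_numFlux_sub_le_fluxJump (k : ℝ) (i : ℤ) :
    |numFlux F a U (fun _ => k) i - numFlux F a U (fun _ => k) (i - 1)|
      ≤ fluxJump L κ A₁ U i + 2 * A₁ * κ * |k| := by
  have h := abs_numFlux_sub_le (U := U) hf f0 hκ hF ha hA₁ k i
  have := mul_nonneg (lipschitz_nonneg hF) (abs_nonneg (U (i + 1) - U i))
  rw [fluxJump]
  linarith

include hf f0 hκ hF ha hA₁ in
lemma abs_numFlux_sub_entropyFlux_le_fluxJump (k : ℝ) {i j : ℤ} (hj : j = i ∨ j = i - 1) :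
    |numFlux F a U (fun _ => k) j - a i * entropyFlux f (U i) k|
      ≤ fluxJump L κ A₁ U i + 2 * A₁ * κ * |k| := by
  have h1 := abs_numFlux_sub_entropyFlux_le (U := U) hF ha k i
  have h2 := abs_numFlux_sub_le (U := U) hf f0 hκ hF ha hA₁ k i
  rw [fluxJump]
  have h3 := (abs_nonneg _).trans h2
  rcases hj with rfl | rfl
  · have := mul_nonneg (lipschitz_nonneg hF) (abs_nonneg (U (j - 1 + 1) - U (j - 1)))
    have hA0 : 0 ≤ A₁ := (abs_nonneg _).trans (hA₁ 0)
    have hL := lipschitz_nonneg hF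
    have : 0 ≤ 2 * A₁ * ((κ + L) * |U (j - 1)| + L * |U j|) + 2 * A₁ * κ * |k| := by positivity
    have := mul_nonneg hL (abs_nonneg (U (j + 1) - U j))
    linarith
  · have t := abs_sub_le (numFlux F a U (fun _ => k) (i - 1)) (numFlux F a U (fun _ => k) i)
      (a i * entropyFlux f (U i) k)
    rw [abs_sub_comm (numFlux F a U (fun _ => k) (i - 1)) (numFlux F a U (fun _ => k) i)] at t
    linarith

end Flux

lemma fluxJump_summable {L κ A₁ : ℝ} {U : ℤ → ℝ} (hU : Summable fun i => |U i|) :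
    Summable (fluxJump L κ A₁ U) ∧ ∑' i, fluxJump L κ A₁ U i
      = 6 * L * ∑' i, |U (i + 1) - U i| + 2 * A₁ * (κ + 2 * L) * ∑' i, |U i| := by
  have hd := summable_abs_diff hU
  have hd' : Summable fun i => |U (i - 1 + 1) - U (i - 1)| := summable_comp_sub hd 1
  have hU' : Summable fun i => |U (i - 1)| := summable_comp_sub hU 1
  have s1 := (hd'.add (hd.mul_left 2)).mul_left (2 * L)
  have s2 := ((hU'.mul_left (κ + L)).add (hU.mul_left L)).mul_left (2 * A₁)
  refine ⟨s1.add s2, ?_⟩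
  change ∑' i, (2 * L * (|U (i - 1 + 1) - U (i - 1)| + 2 * |U (i + 1) - U i|)
    + 2 * A₁ * ((κ + L) * |U (i - 1)| + L * |U i|)) = _
  rw [s1.tsum_add s2, tsum_mul_left, tsum_mul_left, hd'.tsum_add (hd.mul_left 2),
    (hU'.mul_left (κ + L)).tsum_add (hU.mul_left L), tsum_mul_left, tsum_mul_left, tsum_mul_left,
    tsum_comp_sub (fun i => |U (i + 1) - U i|) 1, tsum_comp_sub (fun i => |U i|) 1]
  ring

/-- Summation by parts in mean value form: the discrete derivative of a grid function tested with
`h` is the grid function, shifted by a fraction of a cell, tested with `-h'`. -/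
lemma exists_integral_diff_mul_eq {Δx : ℝ} (hΔx : 0 < Δx) {G : ℤ → ℝ} {M : ℝ}
    (hG : ∀ i, |G i| ≤ M) {h : ℝ → ℝ} (hh : ContDiff ℝ 1 h) (hc : HasCompactSupport h) :
    ∃ r ∈ Icc (0 : ℝ) 1, ∫ x, (G (cell Δx x) - G (cell Δx x - 1)) * h x
      = -Δx * ∫ x, G (cell Δx (x - r * Δx)) * deriv h x := by
  have hGm := measurable_comp_cell Δx G
  have hGl : LocallyIntegrable (fun x => G (cell Δx x)) := by
    have : LocallyIntegrable (fun _ : ℝ => M) := locallyIntegrable_const M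
    exact this.mono hGm.aestronglyMeasurable
      (Eventually.of_forall fun x => (hG _).trans (le_abs_self _))
  -- as a function of the shift `r`, the integral is a convolution with the reflected kernel
  set k : ℝ → ℝ := fun z => h (-z) with hk
  have hkd : ContDiff ℝ 1 k := hh.comp contDiff_neg
  have hkc : HasCompactSupport k := hc.comp_homeomorph (Homeomorph.neg ℝ)
  set ψ : ℝ → ℝ := fun r => ∫ x, G (cell Δx x) * h (x + r * Δx) with hψ
  have hconv : ∀ r, ψ r = convolution (fun x => G (cell Δx x)) k
      (ContinuousLinearMap.mul ℝ ℝ) volume (-(r * Δx)) := by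
    intro r
    rw [convolution_def]
    refine integral_congr_ae (Eventually.of_forall fun x => ?_)
    simp only [hk, ContinuousLinearMap.mul_apply']
    congr 2
    ring
  have hdk : ∀ z, deriv k z = -deriv h (-z) := fun z => deriv_comp_neg h z
  have hderiv : ∀ r, HasDerivAt ψ (Δx * ∫ x, G (cell Δx (x - r * Δx)) * deriv h x) r := by
    intro r
    have h1 := hkc.hasDerivAt_convolution_right (ContinuousLinearMap.mul ℝ ℝ) hGl hkd (-(r * Δx))
    have h2 : HasDerivAt (fun r : ℝ => -(r * Δx)) (-Δx) r :=
      (((hasDerivAt_id' r).mul_const Δx).fun_neg).congr_deriv (by ring)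
    have h3 := h1.comp r h2
    have e1 : (fun r => ψ r) = (convolution (fun x => G (cell Δx x)) k
      (ContinuousLinearMap.mul ℝ ℝ) volume) ∘ fun r : ℝ => -(r * Δx) := funext hconv
    rw [show ψ = fun r => ψ r from rfl, e1]
    refine h3.congr_deriv ?_
    rw [convolution_def, ← integral_add_right_eq_self
      (fun x => G (cell Δx (x - r * Δx)) * deriv h x) (r * Δx), ← integral_mul_const, ← integral_const_mul]
    refine integral_congr_ae (Eventually.of_forall fun x => ?_)
    simp only [hdk, ContinuousLinearMap.mul_apply', add_sub_cancel_right]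
    rw [show -(-(r * Δx) - x) = x + r * Δx by ring]
    ring
  obtain ⟨r, hr, e⟩ := exists_hasDerivAt_eq_slope ψ
    (fun r => Δx * ∫ x, G (cell Δx (x - r * Δx)) * deriv h x) one_pos
    (fun r _ => (hderiv r).continuousAt.continuousWithinAt) (fun r _ => hderiv r)
  refine ⟨r, Ioo_subset_Icc_self hr, ?_⟩
  have hint : ∀ a : ℤ → ℝ, (∀ i, |a i| ≤ M) → Integrable fun x => a (cell Δx x) * h x := fun a ha =>
    (hh.continuous.integrable_of_hasCompactSupport hc).bdd_mul
      (measurable_comp_cell Δx a).aestronglyMeasurable (Eventually.of_forall fun x => ha _)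
  have e0 : ψ 0 = ∫ x, G (cell Δx x) * h x := by simp [hψ]
  have e1 : ψ 1 = ∫ x, G (cell Δx x - 1) * h x := by
    simp only [hψ, one_mul]
    rw [← integral_add_right_eq_self (fun x => G (cell Δx x - 1) * h x) Δx]
    simp only [cell_add_self hΔx, add_sub_cancel_right]
  simp only [sub_mul]
  rw [integral_sub (hint G hG) (hint (fun i => G (i - 1)) fun i => hG _), ← e0, ← e1]
  linarith

section Terms

variable {f β ν μ : ℝ → ℝ} {κ : ℝ} (hb : UniformBound f β ν μ κ)
  {lam L A₁ A₃ Δx R : ℝ} {F : ℝ → ℝ → ℝ → ℝ} {a U W : ℤ → ℝ} {V h : ℝ → ℝ}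

/-- Minus the difference quotient of the numerical flux of the entropy `|· - k|`, tested with `h`. -/
def numFluxTerm (F : ℝ → ℝ → ℝ → ℝ) (Δx : ℝ) (a U : ℤ → ℝ) (k : ℝ) (h : ℝ → ℝ) : ℝ :=
  -(1 / Δx) * ∫ x, (numFlux F a U (fun _ => k) (cell Δx x)
    - numFlux F a U (fun _ => k) (cell Δx x - 1)) * h x

/-- The exact entropy flux `V G(u, k)` tested with `h'`. -/
def fluxTerm (f : ℝ → ℝ) (Δx : ℝ) (V : ℝ → ℝ) (U : ℤ → ℝ) (k : ℝ) (h : ℝ → ℝ) : ℝ :=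
  ∫ x, V x * entropyFlux f (U (cell Δx x)) k * deriv h x

/-- The source `sgn (u - k) f(k) D` tested with `h`. -/
def sourceTerm (f : ℝ → ℝ) (Δx : ℝ) (D : ℝ → ℝ) (U : ℤ → ℝ) (k : ℝ) (h : ℝ → ℝ) : ℝ :=
  ∫ x, Real.sign (U (cell Δx x) - k) * f k * D x * h x

/-- The entropy `|u - k|` tested with `h`. -/
def entropyTerm (Δx : ℝ) (U : ℤ → ℝ) (k : ℝ) (h : ℝ → ℝ) : ℝ :=
  ∫ x, |U (cell Δx x) - k| * h x

lemma exists_abs_numFlux_le (hF : IsMonotoneFlux f ν lam L F) (ha : ∀ i, a i ∈ range ν)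
    (hU : Summable fun i => |U i|) (k : ℝ) :
    ∃ M, ∀ i, |numFlux F a U (fun _ => k) i| ≤ M := by
  have hL := lipschitz_nonneg hF
  have hbd : ∀ p, |U p - k| ≤ (∑' p, |U p|) + |k| := fun p =>
    (abs_sub _ _).trans (add_le_add (hU.le_tsum p fun _ _ => abs_nonneg _) le_rfl)
  exact ⟨_, fun i => (abs_numFlux_le hF ha U _ i).trans
    (mul_le_mul_of_nonneg_left (add_le_add (hbd _) (hbd _)) hL)⟩

include hb in
lemma abs_numFluxTerm_le (hΔx : 0 < Δx) (hF : IsMonotoneFlux f ν lam L F)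
    (ha : ∀ i, a i ∈ range ν) (hA₁ : ∀ i, |a (i + 1) - a i| ≤ A₁) (hU : Summable fun i => |U i|)
    (hh : ContDiff ℝ 1 h) (hc : HasCompactSupport h) (h0 : ∀ x, 0 ≤ h x) (h1 : ∫ x, h x = 1)
    (k : ℝ) :
    |numFluxTerm F Δx a U k h|
      ≤ 1 / Δx * (∫ x, fluxJump L κ A₁ U (cell Δx x) * h x) + 2 * A₁ * κ / Δx * |k| := by
  obtain ⟨M, hM⟩ := exists_abs_numFlux_le hF ha hU k
  have hi : Integrable h := hh.continuous.integrable_of_hasCompactSupport hc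
  obtain ⟨hJ, -⟩ := fluxJump_summable (L := L) (κ := κ) (A₁ := A₁) hU
  have hJi : Integrable fun x => fluxJump L κ A₁ U (cell Δx x) * h x :=
    hi.bdd_mul (measurable_comp_cell Δx _).aestronglyMeasurable
      (Eventually.of_forall fun x => hJ.abs.le_tsum (cell Δx x) fun _ _ => abs_nonneg _)
  have hki : Integrable fun x => 2 * A₁ * κ * |k| * h x := hi.const_mul _
  have hle : |∫ x, (numFlux F a U (fun _ => k) (cell Δx x)
      - numFlux F a U (fun _ => k) (cell Δx x - 1)) * h x|
      ≤ ∫ x, (fluxJump L κ A₁ U (cell Δx x) * h x + 2 * A₁ * κ * |k| * h x) := by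
    refine abs_integral_le_of_abs_le (hJi.add hki) fun x => ?_
    rw [abs_mul, abs_of_nonneg (h0 x), ← add_mul]
    exact mul_le_mul_of_nonneg_right
      (abs_numFlux_sub_le_fluxJump hb.f_lip hb.f_zero hb.nonneg hF ha hA₁ k _) (h0 x)
  rw [integral_add hJi hki, integral_const_mul, h1] at hle
  rw [numFluxTerm, abs_mul, abs_neg, abs_of_pos (one_div_pos.2 hΔx)]
  refine (mul_le_mul_of_nonneg_left hle (one_div_pos.2 hΔx).le).trans (le_of_eq ?_)
  field_simp

include hb in
/-- Consistency of the numerical entropy flux: only `h'` and the total variation of `U` appear, no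
second derivative of `h`. -/
lemma abs_numFluxTerm_sub_fluxTerm_le (hΔx : 0 < Δx) (hF : IsMonotoneFlux f ν lam L F)
    (ha : ∀ i, a i ∈ range ν) (hA₁ : ∀ i, |a (i + 1) - a i| ≤ A₁) (hU : Summable fun i => |U i|)
    (hV : Continuous V) (hVb : ∀ x, |V x| ≤ κ) (hA₃ : ∀ x, |a (cell Δx x) - V x| ≤ A₃)
    (hh : ContDiff ℝ 1 h) (hc : HasCompactSupport h) (k : ℝ) :
    |numFluxTerm F Δx a U k h - fluxTerm f Δx V U k h|
      ≤ (∫ x, (fluxJump L κ A₁ U (cell Δx x) + A₃ * κ * |U (cell Δx x)|) * |deriv h x|)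
        + (2 * A₁ * κ + A₃ * κ) * |k| * ∫ x, |deriv h x| := by
  have hκ := hb.nonneg
  have hA₃0 : 0 ≤ A₃ := (abs_nonneg _).trans (hA₃ 0)
  obtain ⟨M, hM⟩ := exists_abs_numFlux_le hF ha hU k
  have hi : Integrable (deriv h) :=
    (hh.continuous_deriv le_rfl).integrable_of_hasCompactSupport hc.deriv
  obtain ⟨r, hr, e⟩ := exists_integral_diff_mul_eq hΔx hM hh hc
  obtain ⟨hJ, -⟩ := fluxJump_summable (L := L) (κ := κ) (A₁ := A₁) hU
  have hs : Summable fun i => fluxJump L κ A₁ U i + A₃ * κ * |U i| := hJ.add (hU.mul_left _)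
  have hGb : ∀ i, |entropyFlux f (U i) k| ≤ κ * (|U i| + |k|) := fun i =>
    (abs_entropyFlux_le hb.f_lip _ _).trans (mul_le_mul_of_nonneg_left (abs_sub _ _) hκ)
  have hGb' : ∀ i, |entropyFlux f (U i) k| ≤ κ * ((∑' p, |U p|) + |k|) := fun i =>
    (hGb i).trans (mul_le_mul_of_nonneg_left
      (add_le_add (hU.le_tsum i fun _ _ => abs_nonneg _) le_rfl) hκ)
  have i1 : Integrable fun x => numFlux F a U (fun _ => k) (cell Δx (x - r * Δx)) * deriv h x :=
    hi.bdd_mul ((measurable_comp_cell Δx fun i => numFlux F a U (fun _ => k) i).comp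
      (measurable_id.sub_const (r * Δx))).aestronglyMeasurable (Eventually.of_forall fun x => hM _)
  have i2 : Integrable fun x => V x * entropyFlux f (U (cell Δx x)) k * deriv h x := by
    refine hi.bdd_mul (hV.measurable.mul (measurable_comp_cell Δx
      fun i => entropyFlux f (U i) k)).aestronglyMeasurable
      (c := κ * (κ * ((∑' p, |U p|) + |k|))) (Eventually.of_forall fun x => ?_)
    rw [Real.norm_eq_abs, abs_mul]
    exact mul_le_mul (hVb x) (hGb' _) (abs_nonneg _) hκ
  have i3 : Integrable fun x =>
      (fluxJump L κ A₁ U (cell Δx x) + A₃ * κ * |U (cell Δx x)|) * |deriv h x| :=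
    hi.abs.bdd_mul (measurable_comp_cell Δx
      fun i => fluxJump L κ A₁ U i + A₃ * κ * |U i|).aestronglyMeasurable
      (Eventually.of_forall fun x => hs.abs.le_tsum (cell Δx x) fun _ _ => abs_nonneg _)
  have i4 : Integrable fun x => (2 * A₁ * κ + A₃ * κ) * |k| * |deriv h x| := hi.abs.const_mul _
  have e' : numFluxTerm F Δx a U k h
      = ∫ x, numFlux F a U (fun _ => k) (cell Δx (x - r * Δx)) * deriv h x := by
    rw [numFluxTerm, e]
    field_simp
  rw [e', fluxTerm, ← integral_sub i1 i2, ← integral_const_mul, ← integral_add i3 i4]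
  refine abs_integral_le_of_abs_le (i3.add i4) fun x => ?_
  rw [← sub_mul, abs_mul, ← add_mul]
  refine mul_le_mul_of_nonneg_right ?_ (abs_nonneg _)
  have t1 := abs_numFlux_sub_entropyFlux_le_fluxJump (U := U) hb.f_lip hb.f_zero hκ hF ha hA₁ k
    (cell_sub_mul hΔx x hr)
  have t2 : |(a (cell Δx x) - V x) * entropyFlux f (U (cell Δx x)) k|
      ≤ A₃ * (κ * (|U (cell Δx x)| + |k|)) := by
    rw [abs_mul]
    exact mul_le_mul (hA₃ x) (hGb _) (abs_nonneg _) hA₃0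
  have t3 := abs_add_le (numFlux F a U (fun _ => k) (cell Δx (x - r * Δx))
      - a (cell Δx x) * entropyFlux f (U (cell Δx x)) k)
    ((a (cell Δx x) - V x) * entropyFlux f (U (cell Δx x)) k)
  have e4 : numFlux F a U (fun _ => k) (cell Δx (x - r * Δx))
      - V x * entropyFlux f (U (cell Δx x)) k
      = (numFlux F a U (fun _ => k) (cell Δx (x - r * Δx))
      - a (cell Δx x) * entropyFlux f (U (cell Δx x)) k)
      + (a (cell Δx x) - V x) * entropyFlux f (U (cell Δx x)) k := by ring
  rw [e4]
  linarith

lemma integrable_source {D : ℝ → ℝ} {M : ℝ} (hD : Measurable D) (hDb : ∀ x, |D x| ≤ M)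
    (hi : Integrable h) (U : ℤ → ℝ) (k : ℝ) :
    Integrable fun x => Real.sign (U (cell Δx x) - k) * f k * D x * h x := by
  refine hi.bdd_mul (((measurable_comp_cell Δx fun i => Real.sign (U i - k)).mul_const
    _).mul hD).aestronglyMeasurable (c := |f k| * M) (Eventually.of_forall fun x => ?_)
  rw [Real.norm_eq_abs, abs_mul, abs_mul]
  refine mul_le_mul ?_ (hDb x) (abs_nonneg _) (abs_nonneg _)
  exact mul_le_of_le_one_left (abs_nonneg _) (abs_sign_le_one _)

include hb in
lemma abs_sourceTerm_le {D : ℝ → ℝ} {M : ℝ} (hDb : ∀ x, |D x| ≤ M)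
    (hi : Integrable h) (h0 : ∀ x, 0 ≤ h x) (h1 : ∫ x, h x = 1) (U : ℤ → ℝ) (k : ℝ) :
    |sourceTerm f Δx D U k h| ≤ κ * |k| * M := by
  have : ∫ x, |f k| * M * h x = |f k| * M := by rw [integral_const_mul, h1, mul_one]
  have hM : 0 ≤ M := (abs_nonneg _).trans (hDb 0)
  refine le_trans ?_ (mul_le_mul_of_nonneg_right (hb.abs_f_le k) hM)
  rw [← this]
  refine abs_integral_le_of_abs_le (hi.const_mul _) fun x => ?_
  rw [abs_mul, abs_mul, abs_mul, abs_of_nonneg (h0 x)]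
  refine mul_le_mul_of_nonneg_right (mul_le_mul ?_ (hDb x) (abs_nonneg _) (abs_nonneg _)) (h0 x)
  exact mul_le_of_le_one_left (abs_nonneg _) (abs_sign_le_one _)

include hb in
/-- Two source terms whose densities `D`, `D'` differ by a bounded part and an `L¹` part. -/
lemma abs_sourceTerm_sub_le {D D' E : ℝ → ℝ} {M M' P Q m : ℝ} (hD : Measurable D)
    (hD' : Measurable D') (hDb : ∀ x, |D x| ≤ M) (hDb' : ∀ x, |D' x| ≤ M')
    (hE : Integrable E) (hEQ : ∫ x, |E x| ≤ Q) (hP : ∀ x, |D x - D' x| ≤ P + |E x|)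
    (hi : Integrable h) (h0 : ∀ x, 0 ≤ h x) (h1 : ∫ x, h x = 1) (hm : ∀ x, h x ≤ m)
    (U : ℤ → ℝ) (k : ℝ) :
    |sourceTerm f Δx D U k h - sourceTerm f Δx D' U k h| ≤ κ * |k| * (P + m * Q) := by
  have hm0 : 0 ≤ m := (h0 0).trans (hm 0)
  have hQ0 : 0 ≤ Q := (integral_nonneg fun _ => abs_nonneg _).trans hEQ
  rw [sourceTerm, sourceTerm, ← integral_sub (integrable_source hD hDb hi U k)
    (integrable_source hD' hDb' hi U k)]
  have hbd : Integrable fun x => κ * |k| * (P * h x + m * |E x|) :=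
    ((hi.const_mul P).add (hE.abs.const_mul m)).const_mul _
  have hk : 0 ≤ κ * |k| := mul_nonneg hb.nonneg (abs_nonneg _)
  refine (abs_integral_le_of_abs_le hbd fun x => ?_).trans ?_
  · rw [← sub_mul, ← mul_sub, abs_mul, abs_mul, abs_mul, abs_of_nonneg (h0 x),
      mul_assoc]
    refine mul_le_mul ?_ ?_ (mul_nonneg (abs_nonneg _) (h0 x)) hk
    · exact (mul_le_of_le_one_left (abs_nonneg _) (abs_sign_le_one _)).trans (hb.abs_f_le k)
    · refine (mul_le_mul_of_nonneg_right (hP x) (h0 x)).trans ?_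
      have := mul_le_mul_of_nonneg_left (hm x) (abs_nonneg (E x))
      linarith
  · rw [integral_const_mul, integral_add (hi.const_mul P) (hE.abs.const_mul m), integral_const_mul,
      integral_const_mul, h1, mul_one]
    exact mul_le_mul_of_nonneg_left (add_le_add le_rfl (mul_le_mul_of_nonneg_left hEQ hm0)) hk

lemma integrable_entropy (hU : Summable fun i => |U i|) (hi : Integrable h) (k : ℝ) :
    Integrable fun x => |U (cell Δx x) - k| * h x := by
  refine hi.bdd_mul (measurable_comp_cell Δx fun i => |U i - k|).aestronglyMeasurable
    (c := (∑' p, |U p|) + |k|) (Eventually.of_forall fun x => ?_)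
  rw [Real.norm_eq_abs, abs_abs]
  exact (abs_sub _ _).trans (add_le_add (hU.le_tsum _ fun _ _ => abs_nonneg _) le_rfl)

/-- The discrete entropy inequality tested with `h ≥ 0`. -/
lemma entropyTerm_step_sub_le (f0 : f 0 = 0) {Δt : ℝ} (hΔx : 0 < Δx)
    (hF : IsMonotoneFlux f ν (Δt / Δx) L F) (ha : ∀ i, a i ∈ range ν)
    (hA₁ : ∀ i, |a (i + 1) - a i| ≤ A₁) (hU : Summable fun i => |U i|)
    (hi : Integrable h) (h0 : ∀ x, 0 ≤ h x) (k : ℝ) :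
    entropyTerm Δx (step (Δt / Δx) F a U) k h - entropyTerm Δx U k h
      ≤ Δt * (numFluxTerm F Δx a U k h - sourceTerm f Δx
          (fun x => (a (cell Δx x) - a (cell Δx x - 1)) / Δx) (step (Δt / Δx) F a U) k h) := by
  obtain ⟨M, hM⟩ := exists_abs_numFlux_le hF ha hU k
  have hs := (tsum_abs_step_le hF f0 ha hU).1
  have i1 := integrable_entropy (Δx := Δx) hs hi k
  have i2 := integrable_entropy (Δx := Δx) hU hi k
  have i3 : Integrable fun x => (numFlux F a U (fun _ => k) (cell Δx x)
    - numFlux F a U (fun _ => k) (cell Δx x - 1)) * h x :=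
    hi.bdd_mul (measurable_comp_cell Δx fun i => numFlux F a U (fun _ => k) i
      - numFlux F a U (fun _ => k) (i - 1)).aestronglyMeasurable
      (Eventually.of_forall fun x => (abs_sub _ _).trans (add_le_add (hM _) (hM _)))
  have i4 : Integrable fun x => Real.sign (step (Δt / Δx) F a U (cell Δx x) - k) * f k
      * ((a (cell Δx x) - a (cell Δx x - 1)) / Δx) * h x := by
    refine integrable_source (M := A₁ / Δx) (measurable_comp_cell Δx
      fun i => (a i - a (i - 1)) / Δx) (fun x => ?_) hi _ k
    rw [abs_div, abs_of_pos hΔx]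
    have : |a (cell Δx x) - a (cell Δx x - 1)| ≤ A₁ := by simpa using hA₁ (cell Δx x - 1)
    gcongr
  rw [entropyTerm, entropyTerm, ← integral_sub i1 i2, numFluxTerm, sourceTerm, mul_sub, ← mul_assoc,
    ← integral_const_mul, ← integral_const_mul, ← integral_sub (i3.const_mul _) (i4.const_mul _)]
  refine integral_mono (i1.sub i2) ((i3.const_mul _).sub (i4.const_mul _)) fun x => ?_
  have h1 := mul_le_mul_of_nonneg_right (discrete_entropy hF ha U k (cell Δx x)) (h0 x)
  simp only at h1 ⊢
  refine le_trans (le_of_eq ?_) (h1.trans (le_of_eq ?_))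
  · ring
  · field_simp

end Terms

/-! ### Mollifying kernels -/

/-- A `C¹` probability density `φ` with compact support, bounded by `m`, with `‖φ'‖₁ ≤ c`. -/
structure IsKernel (φ : ℝ → ℝ) (m c : ℝ) : Prop where
  contDiff : ContDiff ℝ 1 φ
  compact : HasCompactSupport φ
  nonneg : ∀ x, 0 ≤ φ x
  integral_eq : ∫ x, φ x = 1
  le : ∀ x, φ x ≤ m
  deriv_le : ∫ x, |deriv φ x| ≤ c

namespace IsKernel

variable {φ : ℝ → ℝ} {m c : ℝ} (hφ : IsKernel φ m c)

include hφ

lemma integrable : Integrable φ := hφ.contDiff.continuous.integrable_of_hasCompactSupport hφ.compact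

lemma continuous_deriv : Continuous (deriv φ) := hφ.contDiff.continuous_deriv le_rfl

lemma integrable_deriv : Integrable (deriv φ) :=
  hφ.continuous_deriv.integrable_of_hasCompactSupport hφ.compact.deriv

lemma hasDerivAt (x : ℝ) : HasDerivAt φ (deriv φ x) x :=
  (hφ.contDiff.differentiable one_ne_zero x).hasDerivAt

lemma translate (y : ℝ) : IsKernel (fun x => φ (x - y)) m c where
  contDiff := hφ.contDiff.comp (contDiff_id.sub contDiff_const)
  compact := hφ.compact.comp_homeomorph (Homeomorph.subRight y)
  nonneg x := hφ.nonneg _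
  integral_eq := by rw [integral_sub_right_eq_self φ y, hφ.integral_eq]
  le x := hφ.le _
  deriv_le := by
    simp only [deriv_comp_sub_const]
    rw [integral_sub_right_eq_self (fun x => |deriv φ x|) y]
    exact hφ.deriv_le

lemma m_nonneg : 0 ≤ m := (hφ.nonneg 0).trans (hφ.le 0)

lemma c_nonneg : 0 ≤ c := (integral_nonneg fun _ => abs_nonneg _).trans hφ.deriv_le

end IsKernel

lemma IsMollifier.exists_isKernel {ω : ℝ → ℝ} (hω : IsMollifier ω) :
    ∃ m c : ℝ, ∀ a, 0 < a → IsKernel (scaled ω a) (m / a) (c / a) := by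
  have hc : HasCompactSupport ω :=
    HasCompactSupport.of_support_subset_isCompact isCompact_Icc hω.support_subset
  obtain ⟨m, hm⟩ := hc.exists_bound_of_continuous hω.contDiff.continuous
  have hd : ContDiff ℝ 1 ω := hω.contDiff.of_le (by exact_mod_cast le_top)
  refine ⟨m, ∫ x, |deriv ω x|, fun a ha => ?_⟩
  have hderiv : ∀ x, deriv (scaled ω a) x = 1 / a * (deriv ω (x / a) / a) := by
    intro x
    have h1 : HasDerivAt (fun x => ω (x / a)) (deriv ω (x / a) * (1 / a)) x :=
      ((hd.differentiable one_ne_zero _).hasDerivAt).comp x ((hasDerivAt_id' x).div_const a)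
    have h2 := (h1.const_mul (1 / a)).deriv
    change deriv (fun x => 1 / a * ω (x / a)) x = _
    rw [h2]
    ring
  refine ⟨contDiff_const.mul (hd.comp (contDiff_id.div_const a)), ?_, fun x => ?_, ?_, fun x => ?_,
    ?_⟩
  · have : HasCompactSupport fun x => ω (x / a) := by
      have := hc.comp_homeomorph (Homeomorph.mulRight₀ a⁻¹ (inv_ne_zero ha.ne'))
      simpa [Function.comp_def, div_eq_mul_inv] using this
    exact this.mul_left
  · exact mul_nonneg (one_div_pos.2 ha).le (hω.nonneg _)
  · change ∫ x, 1 / a * ω (x / a) = 1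
    rw [integral_const_mul, Measure.integral_comp_div ω a, hω.integral_eq_one, abs_of_pos ha,
      smul_eq_mul, mul_one, one_div_mul_cancel ha.ne']
  · change 1 / a * ω (x / a) ≤ m / a
    rw [one_div_mul_eq_div]
    have := (le_abs_self _).trans (hm (x / a))
    gcongr
  · refine le_of_eq ?_
    simp only [hderiv, abs_mul, abs_div, abs_of_pos ha, abs_one]
    rw [integral_const_mul, integral_div, Measure.integral_comp_div (fun x => |deriv ω x|) a,
      abs_of_pos ha, smul_eq_mul]
    field_simp

/-- Fubini for a convolution in the variable of the kernel. -/
lemma integral_integral_mul_comp_sub {r φ : ℝ → ℝ} (hr : Integrable r) (hφ : Integrable φ) :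
    (Integrable fun y => ∫ x, r x * φ (x - y)) ∧
      ∫ y, ∫ x, r x * φ (x - y) = (∫ x, r x) * ∫ x, φ x := by
  have e : (fun y => ∫ x, r x * φ (x - y))
      = convolution r (fun z => φ (-z)) (ContinuousLinearMap.mul ℝ ℝ) volume := by
    funext y
    rw [convolution_def]
    simp only [ContinuousLinearMap.mul_apply', neg_sub]
  have hφ' : Integrable fun z => φ (-z) := hφ.comp_neg
  rw [e]
  refine ⟨hr.integrable_convolution _ hφ', ?_⟩
  rw [integral_convolution _ hr hφ', ContinuousLinearMap.mul_apply', integral_neg_eq_self]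

/-! ### Time weights -/

section Weights

variable {g : ℝ → ℝ} {m c : ℝ} (hg : IsKernel g m c) {Δt : ℝ}

include hg in
lemma IsKernel.abs_sub_le {a b s t : ℝ} (hs : s ∈ Icc a b) (ht : t ∈ Icc a b) :
    |g t - g s| ≤ ∫ τ in a..b, |deriv g τ| := by
  have hab : a ≤ b := hs.1.trans hs.2
  have hc := hg.continuous_deriv
  rw [← intervalIntegral.integral_deriv_eq_sub (fun x _ => hg.contDiff.differentiable one_ne_zero x)
    (hc.intervalIntegrable _ _), ← Real.norm_eq_abs]
  refine (intervalIntegral.norm_integral_le_integral_norm_uIoc).trans ?_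
  rw [intervalIntegral.integral_of_le hab]
  refine setIntegral_mono_set (hc.abs.integrableOn_Icc.mono_set Ioc_subset_Icc_self)
    (Eventually.of_forall fun _ => abs_nonneg _) (Eventually.of_forall ?_)
  intro x hx
  rcases le_total s t with h | h
  · rw [uIoc_of_le h] at hx
    exact ⟨hs.1.trans_lt hx.1, hx.2.trans ht.2⟩
  · rw [uIoc_of_ge h] at hx
    exact ⟨ht.1.trans_lt hx.1, hx.2.trans hs.2⟩

include hg in
lemma IsKernel.abs_integral_sub_le {a b s : ℝ} (hs : s ∈ Icc a b) :
    |(∫ t in a..b, g t) - (b - a) * g s| ≤ (b - a) * ∫ τ in a..b, |deriv g τ| := by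
  have hab : a ≤ b := hs.1.trans hs.2
  have e : (∫ t in a..b, g t) - (b - a) * g s = ∫ t in a..b, (g t - g s) := by
    rw [intervalIntegral.integral_sub (hg.contDiff.continuous.intervalIntegrable _ _)
      intervalIntegrable_const, intervalIntegral.integral_const, smul_eq_mul]
  rw [e, ← Real.norm_eq_abs]
  refine (intervalIntegral.norm_integral_le_of_norm_le_const
    (C := ∫ τ in a..b, |deriv g τ|) fun t ht => ?_).trans_eq ?_
  · rw [uIoc_of_le hab] at ht
    exact hg.abs_sub_le hs (Ioc_subset_Icc_self ht)
  · rw [abs_of_nonneg (sub_nonneg.2 hab), mul_comm]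

lemma sum_integral_steps {p : ℝ → ℝ} (hp : Continuous p) (Δt : ℝ) (N : ℕ) :
    ∑ n ∈ Finset.range N, ∫ t in (n * Δt)..((n + 1 : ℕ) * Δt), p t
      = ∫ t in (0 : ℝ)..(N * Δt), p t := by
  have := intervalIntegral.sum_integral_adjacent_intervals (f := p) (μ := volume)
    (a := fun n : ℕ => (n : ℝ) * Δt) (n := N) fun k _ => hp.intervalIntegrable _ _
  simpa using this

include hg in
lemma IsKernel.sum_integral_le_one (hΔt : 0 ≤ Δt) (N : ℕ) :
    ∑ n ∈ Finset.range N, ∫ t in (n * Δt)..((n + 1 : ℕ) * Δt), g t ≤ 1 := by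
  rw [sum_integral_steps hg.contDiff.continuous, intervalIntegral.integral_of_le (by positivity),
    ← hg.integral_eq]
  exact setIntegral_le_integral hg.integrable (Eventually.of_forall hg.nonneg)

include hg in
lemma IsKernel.sum_integral_le_mul (hΔt : 0 ≤ Δt) (N : ℕ) :
    ∑ n ∈ Finset.range N, ∫ t in (n * Δt)..((n + 1 : ℕ) * Δt), g t ≤ N * Δt * m := by
  have h0 : (0 : ℝ) ≤ N * Δt := by positivity
  rw [sum_integral_steps hg.contDiff.continuous]
  calc ∫ t in (0 : ℝ)..(N * Δt), g t ≤ ∫ _ in (0 : ℝ)..(N * Δt), m :=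
        intervalIntegral.integral_mono_on h0 (hg.contDiff.continuous.intervalIntegrable _ _)
          intervalIntegrable_const fun x _ => hg.le x
    _ = N * Δt * m := by rw [intervalIntegral.integral_const, sub_zero, smul_eq_mul]

include hg in
lemma IsKernel.sum_integral_abs_deriv_le (hΔt : 0 ≤ Δt) (N : ℕ) :
    ∑ n ∈ Finset.range N, ∫ t in (n * Δt)..((n + 1 : ℕ) * Δt), |deriv g t| ≤ c := by
  rw [sum_integral_steps hg.continuous_deriv.abs, intervalIntegral.integral_of_le (by positivity)]
  exact (setIntegral_le_integral hg.integrable_deriv.abs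
    (Eventually.of_forall fun _ => abs_nonneg _)).trans hg.deriv_le

end Weights

/-! ### The entropy functional of a piecewise constant function -/

lemma floor_div_eq_iff {Δt : ℝ} (hΔt : 0 < Δt) {t : ℝ} (ht : 0 ≤ t) (n : ℕ) :
    ⌊t / Δt⌋₊ = n ↔ t ∈ Ico (n * Δt) ((n + 1 : ℕ) * Δt) := by
  rw [Nat.floor_eq_iff (by positivity), le_div_iff₀ hΔt, div_lt_iff₀ hΔt]
  push_cast
  rfl

lemma integral_Ico_indicator {Δt : ℝ} (hΔt : 0 < Δt) {N n : ℕ} (hn : n < N) (p : ℝ → ℝ) :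
    ∫ t in Ico 0 (N * Δt), (Ico (n * Δt) ((n + 1 : ℕ) * Δt)).indicator p t
      = ∫ t in (n * Δt)..((n + 1 : ℕ) * Δt), p t := by
  have h1 : ((n + 1 : ℕ) : ℝ) ≤ N := by exact_mod_cast hn
  have h2 : (n : ℝ) ≤ (n + 1 : ℕ) := by exact_mod_cast n.le_succ
  rw [setIntegral_indicator measurableSet_Ico, inter_eq_right.2, integral_Ico_eq_integral_Ioc,
    intervalIntegral.integral_of_le (by gcongr)]
  exact Ico_subset_Ico (by positivity) (by gcongr)

/-- For a function that is constant on the cells `[t^n, t^{n+1}) × C_i` and a product test function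
the entropy functional is a finite sum over the time steps. -/
lemma entropyFunctional_eq_sum {f β ν μ : ℝ → ℝ} {κ : ℝ} (hb : UniformBound f β ν μ κ)
    {Δx Δt T R : ℝ} (hΔx : 0 < Δx) (hΔt : 0 < Δt) {N : ℕ} (hN : (N : ℝ) * Δt = T)
    {W : ℕ → ℤ → ℝ} (hW : ∀ n ≤ N, GridBound Δx R (W n)) {g h : ℝ → ℝ} {m c m' c' : ℝ}
    (hg : IsKernel g m c) (hh : IsKernel h m' c') (k : ℝ) :
    entropyFunctional f β ν μ T (fun t x => W ⌊t / Δt⌋₊ (cell Δx x)) (fun t x => h x * g t) k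
      = (∑ n ∈ Finset.range N,
          (entropyTerm Δx (W n) k h * (g ((n + 1 : ℕ) * Δt) - g (n * Δt))
          + (fluxTerm f Δx (fun z => ν (gridConv β μ Δx (W n) z)) (W n) k h
            - sourceTerm f Δx (deriv fun z => ν (gridConv β μ Δx (W n) z)) (W n) k h)
            * ∫ t in (n * Δt)..((n + 1 : ℕ) * Δt), g t))
        - entropyTerm Δx (W N) k h * g (N * Δt) + entropyTerm Δx (W 0) k h * g ((0 : ℕ) * Δt) := by
  have hκ := hb.nonneg
  set V : ℕ → ℝ → ℝ := fun n z => ν (gridConv β μ Δx (W n) z) with hV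
  have hhi := hh.integrable
  have hhi' := hh.integrable_deriv
  have eT : ⌊T / Δt⌋₊ = N := by
    rw [← hN, mul_div_cancel_right₀ _ hΔt.ne', Nat.floor_natCast]
  have e0 : ⌊(0 : ℝ) / Δt⌋₊ = 0 := by simp
  have hfin : ∀ k', ∫ x, |W k' (cell Δx x) - k| * (h x * g (k' * Δt))
      = entropyTerm Δx (W k') k h * g (k' * Δt) := by
    intro k'
    rw [entropyTerm, ← integral_mul_const]
    simp only [mul_assoc]
  rw [entropyFunctional, eT, e0, ← hN, hfin N]
  have hfin0 := hfin 0
  simp only [Nat.cast_zero, zero_mul] at hfin0 ⊢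
  rw [hfin0]
  congr 2
  set I : ℕ → Set ℝ := fun n => Ico (n * Δt) ((n + 1 : ℕ) * Δt) with hI
  set X : ℕ → ℝ → ℝ := fun n x => |W n (cell Δx x) - k| * h x with hX
  set Y : ℕ → ℝ → ℝ := fun n x => V n x * entropyFlux f (W n (cell Δx x)) k * deriv h x
    - Real.sign (W n (cell Δx x) - k) * f k * deriv (V n) x * h x with hY
  have hXi : ∀ n ∈ Finset.range N, Integrable (X n) := fun n hn =>
    integrable_entropy (hW n (Finset.mem_range.1 hn).le).summable hhi k
  have hY1 : ∀ n ∈ Finset.range N, Integrable fun x =>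
      V n x * entropyFlux f (W n (cell Δx x)) k * deriv h x := by
    intro n hn
    have hWn := hW n (Finset.mem_range.1 hn).le
    have hVc : Continuous (V n) := continuous_iff_continuousAt.2 fun z =>
      (hasDerivAt_ν_gridConv hb hΔx hWn z).continuousAt
    refine hhi'.bdd_mul (hVc.measurable.mul (measurable_comp_cell Δx
      fun i => entropyFlux f (W n i) k)).aestronglyMeasurable
      (c := κ * (κ * ((∑' p, |W n p|) + |k|))) (Eventually.of_forall fun x => ?_)
    rw [Real.norm_eq_abs, abs_mul]
    refine mul_le_mul (hb.ν_bdd _) ((abs_entropyFlux_le hb.f_lip _ _).trans ?_) (abs_nonneg _) hκ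
    exact mul_le_mul_of_nonneg_left ((abs_sub _ _).trans
      (add_le_add (hWn.summable.le_tsum _ fun _ _ => abs_nonneg _) le_rfl)) hκ
  have hY2 : ∀ n ∈ Finset.range N, Integrable fun x =>
      Real.sign (W n (cell Δx x) - k) * f k * deriv (V n) x * h x := by
    intro n hn
    exact integrable_source (measurable_deriv _)
      (abs_deriv_ν_gridConv_le hb hΔx (hW n (Finset.mem_range.1 hn).le)) hhi _ k
  have hYi : ∀ n ∈ Finset.range N, Integrable (Y n) := fun n hn => (hY1 n hn).sub (hY2 n hn)
  have hstrip : (volume.restrict (strip (N * Δt)) : Measure (ℝ × ℝ))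
      = (volume.restrict (Ico 0 (N * Δt))).prod volume := by
    rw [strip, Measure.volume_eq_prod, ← Measure.prod_restrict, Measure.restrict_univ,
      Measure.restrict_congr_set (Ioo_ae_eq_Ico (μ := volume))]
  have hpi : ∀ p : ℝ → ℝ, Continuous p → ∀ n, Integrable ((I n).indicator p)
      (volume.restrict (Ico 0 (N * Δt))) := fun p hp n =>
    ((hp.integrableOn_Icc).mono_set Ico_subset_Icc_self).indicator measurableSet_Ico
  have hgc := hg.contDiff.continuous
  have hgc' := hg.continuous_deriv
  have i1 : ∀ n ∈ Finset.range N, Integrable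
      (fun p : ℝ × ℝ => (I n).indicator (deriv g) p.1 * X n p.2)
      ((volume.restrict (Ico 0 (N * Δt))).prod volume) := fun n hn =>
    (hpi _ hgc' n).mul_prod (hXi n hn)
  have i2 : ∀ n ∈ Finset.range N, Integrable
      (fun p : ℝ × ℝ => (I n).indicator g p.1 * Y n p.2)
      ((volume.restrict (Ico 0 (N * Δt))).prod volume) := fun n hn =>
    (hpi _ hgc n).mul_prod (hYi n hn)
  have i12 : ∀ n ∈ Finset.range N, Integrable
      (fun p : ℝ × ℝ => (I n).indicator (deriv g) p.1 * X n p.2 + (I n).indicator g p.1 * Y n p.2)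
      ((volume.restrict (Ico 0 (N * Δt))).prod volume) := fun n hn => (i1 n hn).add (i2 n hn)
  have hpt : ∀ p ∈ strip (N * Δt),
      (|W ⌊p.1 / Δt⌋₊ (cell Δx p.2) - k| * deriv (fun τ => h p.2 * g τ) p.1
      + nonlocalCoeff β ν μ (fun t x => W ⌊t / Δt⌋₊ (cell Δx x)) p.1 p.2
        * entropyFlux f (W ⌊p.1 / Δt⌋₊ (cell Δx p.2)) k * deriv (fun z => h z * g p.1) p.2
      - Real.sign (W ⌊p.1 / Δt⌋₊ (cell Δx p.2) - k) * f k
          * deriv (fun z => nonlocalCoeff β ν μ (fun t x => W ⌊t / Δt⌋₊ (cell Δx x)) p.1 z) p.2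
          * (h p.2 * g p.1))
      = ∑ n ∈ Finset.range N, ((I n).indicator (deriv g) p.1 * X n p.2
          + (I n).indicator g p.1 * Y n p.2) := by
    intro p hp
    have hp0 : 0 < p.1 := hp.1.1
    have hpT : p.1 < N * Δt := hp.1.2
    set n := ⌊p.1 / Δt⌋₊ with hn
    have hnN : n ∈ Finset.range N := by
      rw [Finset.mem_range, hn, Nat.floor_lt (by positivity), div_lt_iff₀ hΔt]
      exact hpT
    have hmem : ∀ j : ℕ, p.1 ∈ I j ↔ n = j := fun j => (floor_div_eq_iff hΔt hp0.le j).symm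
    rw [Finset.sum_eq_single_of_mem n hnN]
    · rw [indicator_of_mem ((hmem n).2 rfl), indicator_of_mem ((hmem n).2 rfl)]
      have d1 : deriv (fun τ => h p.2 * g τ) p.1 = h p.2 * deriv g p.1 :=
        ((hg.hasDerivAt p.1).const_mul (h p.2)).deriv
      have d2 : deriv (fun z => h z * g p.1) p.2 = deriv h p.2 * g p.1 :=
        ((hh.hasDerivAt p.2).mul_const (g p.1)).deriv
      rw [d1, d2]
      have d3 : ∀ z, nonlocalCoeff β ν μ (fun t x => W ⌊t / Δt⌋₊ (cell Δx x)) p.1 z = V n z :=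
        fun z => rfl
      simp only [d3, hX, hY]
      ring
    · intro j _ hj
      have hj' : p.1 ∉ I j := fun hc => hj ((hmem j).1 hc).symm
      rw [indicator_of_notMem hj', indicator_of_notMem hj', zero_mul, zero_mul, add_zero]
  have hms : MeasurableSet (strip (N * Δt)) := measurableSet_Ioo.prod MeasurableSet.univ
  rw [entropyVolume, setIntegral_congr_fun hms hpt, hstrip,
    integral_finsetSum _ i12]
  refine Finset.sum_congr rfl fun n hn => ?_
  rw [integral_add (i1 n hn) (i2 n hn), integral_prod_mul, integral_prod_mul,
    integral_Ico_indicator hΔt (Finset.mem_range.1 hn),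
    integral_Ico_indicator hΔt (Finset.mem_range.1 hn),
    intervalIntegral.integral_deriv_eq_sub (fun x _ => hg.contDiff.differentiable one_ne_zero x)
      (hgc'.intervalIntegrable _ _), mul_comm]
  congr 1
  rw [mul_comm]
  congr 1
  exact integral_sub (hY1 n hn) (hY2 n hn)

/-! ### The relative entropy estimate -/

/-- Summation by parts in time. Since the sign in the discrete source `B' n` is taken at the new
time level, it is compared with the exact source `B (n + 1)` of the next step. -/
lemma neg_sum_le_of_entropy_step {M : ℕ} {S A A' B B' γ g : ℕ → ℝ} {dt : ℝ} (hdt : 0 ≤ dt)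
    (hS : ∀ n < M + 1, S (n + 1) - S n ≤ dt * (A' n - B' n)) (hg : ∀ n, 0 ≤ g n)
    (hγ : ∀ n, 0 ≤ γ n) :
    -((∑ n ∈ Finset.range (M + 1), (S n * (g (n + 1) - g n) + (A n - B n) * γ n))
        - S (M + 1) * g (M + 1) + S 0 * g 0)
      ≤ (∑ n ∈ Finset.range (M + 1),
          (|γ n - dt * g (n + 1)| * |A' n| + γ n * |A' n - A n|))
        + (∑ n ∈ Finset.range M,
          (|γ (n + 1) - dt * g (n + 1)| * |B' n| + γ (n + 1) * |B (n + 1) - B' n|))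
        + γ 0 * |B 0| + dt * g (M + 1) * |B' M| := by
  have hSum : ∀ m, ∑ n ∈ Finset.range m, S n * (g (n + 1) - g n)
      = S m * g m - S 0 * g 0 - ∑ n ∈ Finset.range m, (S (n + 1) - S n) * g (n + 1) := by
    intro m
    induction m with
    | zero => simp
    | succ m ih => rw [Finset.sum_range_succ, Finset.sum_range_succ, ih]; ring
  have h1 : ∑ n ∈ Finset.range (M + 1), (S (n + 1) - S n) * g (n + 1)
      ≤ ∑ n ∈ Finset.range (M + 1), dt * (A' n - B' n) * g (n + 1) :=
    Finset.sum_le_sum fun n hn =>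
      mul_le_mul_of_nonneg_right (hS n (Finset.mem_range.1 hn)) (hg _)
  have h2 : ∑ n ∈ Finset.range (M + 1), (dt * g (n + 1) * A' n - γ n * A n)
      ≤ ∑ n ∈ Finset.range (M + 1), (|γ n - dt * g (n + 1)| * |A' n| + γ n * |A' n - A n|) := by
    refine Finset.sum_le_sum fun n _ => ?_
    have e1 : -(γ n - dt * g (n + 1)) * A' n ≤ |γ n - dt * g (n + 1)| * |A' n| := by
      rw [← abs_neg, ← abs_mul]
      exact le_abs_self _
    have e2 := mul_le_mul_of_nonneg_left (le_abs_self (A' n - A n)) (hγ n)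
    linarith
  have h3 : ∑ n ∈ Finset.range M, (γ (n + 1) * B (n + 1) - dt * g (n + 1) * B' n)
      ≤ ∑ n ∈ Finset.range M,
          (|γ (n + 1) - dt * g (n + 1)| * |B' n| + γ (n + 1) * |B (n + 1) - B' n|) := by
    refine Finset.sum_le_sum fun n _ => ?_
    have e1 : (γ (n + 1) - dt * g (n + 1)) * B' n ≤ |γ (n + 1) - dt * g (n + 1)| * |B' n| := by
      rw [← abs_mul]
      exact le_abs_self _
    have e2 := mul_le_mul_of_nonneg_left (le_abs_self (B (n + 1) - B' n)) (hγ (n + 1))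
    linarith
  have h4 : γ 0 * B 0 ≤ γ 0 * |B 0| := mul_le_mul_of_nonneg_left (le_abs_self _) (hγ 0)
  have h5 : -(dt * g (M + 1) * B' M) ≤ dt * g (M + 1) * |B' M| := by
    rw [← mul_neg]
    exact mul_le_mul_of_nonneg_left (neg_le_abs _) (mul_nonneg hdt (hg _))
  have e1 : ∑ n ∈ Finset.range (M + 1), (S n * (g (n + 1) - g n) + (A n - B n) * γ n)
      = S (M + 1) * g (M + 1) - S 0 * g 0
        - ∑ n ∈ Finset.range (M + 1), (S (n + 1) - S n) * g (n + 1)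
        + ∑ n ∈ Finset.range (M + 1), γ n * A n - ∑ n ∈ Finset.range (M + 1), γ n * B n := by
    rw [Finset.sum_add_distrib, hSum, add_sub_assoc, ← Finset.sum_sub_distrib]
    congr 1
    exact Finset.sum_congr rfl fun n _ => by ring
  have e2 : ∑ n ∈ Finset.range (M + 1), dt * (A' n - B' n) * g (n + 1)
      = ∑ n ∈ Finset.range (M + 1), dt * g (n + 1) * A' n
        - ∑ n ∈ Finset.range (M + 1), dt * g (n + 1) * B' n := by
    rw [← Finset.sum_sub_distrib]
    exact Finset.sum_congr rfl fun n _ => by ring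
  have e3 := Finset.sum_range_succ' (fun n => γ n * B n) M
  have e4 := Finset.sum_range_succ (fun n => dt * g (n + 1) * B' n) M
  rw [Finset.sum_sub_distrib] at h2 h3
  linarith

section Estimate

variable {f β ν μ : ℝ → ℝ} {κ : ℝ} (hb : UniformBound f β ν μ κ)
  {L Δx Δt T R : ℝ} (hΔx : 0 < Δx) (hΔt : 0 < Δt) {N : ℕ} (hN : (N : ℝ) * Δt = T) (hT : 0 < T)
  {F : ℝ → ℝ → ℝ → ℝ} (hF : IsMonotoneFlux f ν (Δt / Δx) L F)
  {θ : ℕ → ℤ → ℝ} (hθ : ∀ n p, θ n p ∈ Icc (0 : ℝ) 1)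
  {W : ℕ → ℤ → ℝ} (hW : SchemeBound β ν μ F Δx Δt R θ N W)
  {φ g : ℝ → ℝ} {m c m' c' : ℝ} (hφ : IsKernel φ m c) (hg : IsKernel g m' c')

/-- The bound, up to multiples of `|k|`, of the numerical flux term for the grid function `U`, the
spatial kernel being centred at `y`. -/
def fluxBound (L κ R Δx : ℝ) (U : ℤ → ℝ) (φ : ℝ → ℝ) (y : ℝ) : ℝ :=
  1 / Δx * ∫ x, fluxJump L κ (R * Δx) U (cell Δx x) * φ (x - y)

/-- The bound, up to multiples of `|k|`, of the consistency error of the flux term for the grid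
function `U`, the spatial kernel being centred at `y`. -/
def fluxErrorBound (L κ R Δx : ℝ) (U : ℤ → ℝ) (φ : ℝ → ℝ) (y : ℝ) : ℝ :=
  ∫ x, (fluxJump L κ (R * Δx) U (cell Δx x) + 3 * κ ^ 3 * R * Δx * κ * |U (cell Δx x)|)
    * |deriv φ (x - y)|

/-- The coefficient of `|k|` in the bound of the entropy functional; `m`, `c` belong to the kernel in
space and `m'`, `c'` to the kernel in time. -/
def sourceBound (κ R T Δx Δt m c m' c' : ℝ) : ℝ :=
  Δt * c' * (2 * R * κ) + (2 * R * κ + 3 * κ ^ 4 * R) * Δx * c + Δt * c' * (κ * R)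
    + T * m' * (κ * ((κ ^ 5 * R + κ ^ 3) * (R * Δt)))
    + κ * (m * ((3 * κ ^ 3 * R + 10 * κ ^ 5 * R ^ 2) * Δx))
    + Δt * m' * (κ ^ 4 * R) + Δt * m' * (κ * R)

include hb hΔx hΔt hN hT hF hθ hW hφ hg in
/-- The estimate for a fixed centre `(s, y)` of the kernels. The weights of the two sums over the
time steps have total mass at most `Δt c'` and `1`, whatever the number of steps. -/
lemma neg_entropyFunctional_le (y k : ℝ) :
    -entropyFunctional f β ν μ T (fun t x => W ⌊t / Δt⌋₊ (cell Δx x))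
        (fun t x => φ (x - y) * g t) k
      ≤ (∑ n ∈ Finset.range N,
          (Δt * (∫ t in (n * Δt)..((n + 1 : ℕ) * Δt), |deriv g t|) * fluxBound L κ R Δx (W n) φ y
          + (∫ t in (n * Δt)..((n + 1 : ℕ) * Δt), g t) * fluxErrorBound L κ R Δx (W n) φ y))
        + sourceBound κ R T Δx Δt m c m' c' * |k| := by
  have hκ := hb.nonneg
  have hh := hφ.translate y
  obtain ⟨M, rfl⟩ : ∃ M, N = M + 1 := by
    refine Nat.exists_eq_succ_of_ne_zero ?_
    rintro rfl
    simp at hN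
    linarith
  have hR : 0 ≤ R := (hW.grid 0 (Nat.zero_le _)).nonneg
  set h : ℝ → ℝ := fun x => φ (x - y) with hh'
  set a : ℕ → ℤ → ℝ := fun n => gridCoeff β ν μ Δx (θ n) (W n) with ha
  set V : ℕ → ℝ → ℝ := fun n z => ν (gridConv β μ Δx (W n) z) with hV
  set γ : ℕ → ℝ := fun n => ∫ t in (n * Δt)..((n + 1 : ℕ) * Δt), g t with hγ
  set η : ℕ → ℝ := fun n => ∫ t in (n * Δt)..((n + 1 : ℕ) * Δt), |deriv g t| with hη
  set A : ℕ → ℝ := fun n => fluxTerm f Δx (V n) (W n) k h with hA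
  set A' : ℕ → ℝ := fun n => numFluxTerm F Δx (a n) (W n) k h with hA'
  set B : ℕ → ℝ := fun n => sourceTerm f Δx (deriv (V n)) (W n) k h with hB
  set B' : ℕ → ℝ := fun n => sourceTerm f Δx
    (fun x => (a n (cell Δx x) - a n (cell Δx x - 1)) / Δx) (W (n + 1)) k h with hB'
  have har : ∀ n i, a n i ∈ range ν := fun n i => mem_range_self _
  have hstep : ∀ n : ℕ, (n : ℝ) * Δt ≤ (n + 1 : ℕ) * Δt := fun n => by
    have : (n : ℝ) ≤ (n + 1 : ℕ) := by exact_mod_cast n.le_succ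
    gcongr
  have hlen : ∀ n : ℕ, ((n + 1 : ℕ) * Δt - n * Δt : ℝ) = Δt := fun n => by push_cast; ring
  have hγ0 : ∀ n, 0 ≤ γ n := fun n =>
    intervalIntegral.integral_nonneg (hstep n) fun x _ => hg.nonneg x
  have hη0 : ∀ n, 0 ≤ η n := fun n =>
    intervalIntegral.integral_nonneg (hstep n) fun x _ => abs_nonneg _
  have hw1 : ∀ n, |γ n - Δt * g ((n + 1 : ℕ) * Δt)| ≤ Δt * η n := fun n => by
    have := hg.abs_integral_sub_le (right_mem_Icc.2 (hstep n))
    rwa [hlen] at this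
  have hw0 : ∀ n, |γ n - Δt * g (n * Δt)| ≤ Δt * η n := fun n => by
    have := hg.abs_integral_sub_le (left_mem_Icc.2 (hstep n))
    rwa [hlen] at this
  have hm' := hg.m_nonneg
  have hc' := hg.c_nonneg
  have hm := hφ.m_nonneg
  have hc := hφ.c_nonneg
  have hγle : γ 0 ≤ Δt * m' := by
    have := hg.sum_integral_le_mul hΔt.le 1
    simpa [hγ] using this
  have bA' : ∀ n < M + 1, |A' n| ≤ fluxBound L κ R Δx (W n) φ y + 2 * R * κ * |k| := by
    intro n hn
    refine (abs_numFluxTerm_le hb hΔx hF (har n) (hW.coeff n hn.le)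
      (hW.grid n hn.le).summable hh.contDiff hh.compact hh.nonneg hh.integral_eq k).trans
      (le_of_eq ?_)
    rw [fluxBound]
    congr 1
    field_simp
  have bAA' : ∀ n < M + 1, |A' n - A n| ≤ fluxErrorBound L κ R Δx (W n) φ y
      + (2 * R * κ + 3 * κ ^ 4 * R) * Δx * c * |k| := by
    intro n hn
    have hWn := hW.grid n hn.le
    have hVc : Continuous (V n) := continuous_iff_continuousAt.2 fun z =>
      (hasDerivAt_ν_gridConv hb hΔx hWn z).continuousAt
    refine (abs_numFluxTerm_sub_fluxTerm_le hb hΔx hF (har n) (hW.coeff n hn.le)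
      hWn.summable hVc (fun x => hb.ν_bdd _)
      (abs_gridCoeff_sub_ν_gridConv_le hb hΔx (hθ n) hWn) hh.contDiff hh.compact k).trans ?_
    refine add_le_add (le_of_eq ?_) ?_
    · rw [fluxErrorBound]
      simp only [hh', deriv_comp_sub_const]
    · calc _ ≤ (2 * (R * Δx) * κ + 3 * κ ^ 3 * R * Δx * κ) * |k| * c :=
            mul_le_mul_of_nonneg_left hh.deriv_le (by positivity)
        _ = _ := by ring
  have bB : ∀ n < M + 1, |B n| ≤ κ ^ 4 * R * |k| := by
    intro n hn
    refine (abs_sourceTerm_le hb (abs_deriv_ν_gridConv_le hb hΔx (hW.grid n hn.le))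
      hh.integrable hh.nonneg hh.integral_eq _ k).trans (le_of_eq ?_)
    ring
  have hdiff : ∀ n < M + 1, ∀ x, |(a n (cell Δx x) - a n (cell Δx x - 1)) / Δx| ≤ R := by
    intro n hn x
    rw [abs_div, abs_of_pos hΔx, div_le_iff₀ hΔx]
    simpa using hW.coeff n hn.le (cell Δx x - 1)
  have hdiffm : ∀ n, Measurable fun x => (a n (cell Δx x) - a n (cell Δx x - 1)) / Δx := fun n =>
    measurable_comp_cell Δx fun i => (a n i - a n (i - 1)) / Δx
  have bB' : ∀ n < M + 1, |B' n| ≤ κ * R * |k| := by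
    intro n hn
    refine (abs_sourceTerm_le hb (hdiff n hn) hh.integrable hh.nonneg hh.integral_eq _ k).trans
      (le_of_eq ?_)
    ring
  have bBB' : ∀ n < M, |B (n + 1) - B' n| ≤ (κ * ((κ ^ 5 * R + κ ^ 3) * (R * Δt))
      + κ * (m * ((3 * κ ^ 3 * R + 10 * κ ^ 5 * R ^ 2) * Δx))) * |k| := by
    intro n hn
    have hn1 : n + 1 ≤ M + 1 := by omega
    have hn0 : n ≤ M + 1 := by omega
    obtain ⟨hE, hEQ⟩ := integral_abs_deriv_sub_gridCoeff_diff_le hb hΔx (hθ n) (hW.grid n hn0)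
    have hP : ∀ x, |deriv (V (n + 1)) x - (a n (cell Δx x) - a n (cell Δx x - 1)) / Δx|
        ≤ (κ ^ 5 * R + κ ^ 3) * (R * Δt)
          + |deriv (V n) x - (a n (cell Δx x) - a n (cell Δx x - 1)) / Δx| := fun x =>
      (abs_sub_le _ (deriv (V n) x) _).trans (add_le_add
        (abs_deriv_ν_gridConv_sub_le hb hΔx (hW.grid (n + 1) hn1) (hW.grid n hn0)
          (hW.incr_summable n hn0) (hW.incr n hn0) x) le_rfl)
    refine (abs_sourceTerm_sub_le hb (measurable_deriv _) (hdiffm n)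
      (abs_deriv_ν_gridConv_le hb hΔx (hW.grid (n + 1) hn1)) (hdiff n (by omega)) hE hEQ hP
      hh.integrable hh.nonneg hh.integral_eq hh.le _ k).trans (le_of_eq ?_)
    ring
  have hS : ∀ n < M + 1, entropyTerm Δx (W (n + 1)) k h - entropyTerm Δx (W n) k h
      ≤ Δt * (A' n - B' n) := by
    intro n hn
    have := entropyTerm_step_sub_le (h := h) hb.f_zero hΔx hF (har n) (hW.coeff n hn.le)
      (hW.grid n hn.le).summable hh.integrable hh.nonneg k
    simp only [hA', hB', hW.succ_eq n]
    exact this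
  rw [entropyFunctional_eq_sum hb hΔx hΔt hN hW.grid hg hh k]
  refine (neg_sum_le_of_entropy_step (S := fun n => entropyTerm Δx (W n) k h) (A := A) (A' := A')
    (B := B) (B' := B') (γ := γ) (g := fun n => g (n * Δt)) hΔt.le hS (fun n => hg.nonneg _)
    hγ0).trans ?_
  have hsγ1 : ∑ n ∈ Finset.range (M + 1), γ n ≤ 1 := hg.sum_integral_le_one hΔt.le _
  have hsγT : ∑ n ∈ Finset.range (M + 1), γ n ≤ T * m' := by
    have := hg.sum_integral_le_mul hΔt.le (M + 1)
    rwa [hN] at this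
  have hsη : ∑ n ∈ Finset.range (M + 1), η n ≤ c' := hg.sum_integral_abs_deriv_le hΔt.le _
  have hsγ' : ∑ n ∈ Finset.range M, γ (n + 1) ≤ ∑ n ∈ Finset.range (M + 1), γ n := by
    rw [Finset.sum_range_succ']
    linarith [hγ0 0]
  have hsη' : ∑ n ∈ Finset.range M, η (n + 1) ≤ c' := by
    refine le_trans ?_ hsη
    rw [Finset.sum_range_succ' η]
    linarith [hη0 0]
  have hk := abs_nonneg k
  have t1 : ∑ n ∈ Finset.range (M + 1),
      (|γ n - Δt * g ((n + 1 : ℕ) * Δt)| * |A' n| + γ n * |A' n - A n|)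
      ≤ (∑ n ∈ Finset.range (M + 1), (Δt * η n * fluxBound L κ R Δx (W n) φ y
          + γ n * fluxErrorBound L κ R Δx (W n) φ y))
        + (Δt * c' * (2 * R * κ * |k|) + (2 * R * κ + 3 * κ ^ 4 * R) * Δx * c * |k|) := by
    have s1 : ∑ n ∈ Finset.range (M + 1), (Δt * (2 * R * κ * |k|) * η n
        + (2 * R * κ + 3 * κ ^ 4 * R) * Δx * c * |k| * γ n)
        ≤ Δt * c' * (2 * R * κ * |k|) + (2 * R * κ + 3 * κ ^ 4 * R) * Δx * c * |k| := by
      rw [Finset.sum_add_distrib, ← Finset.mul_sum, ← Finset.mul_sum]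
      refine add_le_add ((mul_le_mul_of_nonneg_left hsη (by positivity)).trans_eq (by ring))
        ((mul_le_mul_of_nonneg_left hsγ1 (by positivity)).trans_eq (by ring))
    refine le_trans ?_ (add_le_add le_rfl s1)
    rw [← Finset.sum_add_distrib]
    refine Finset.sum_le_sum fun n hn => ?_
    have hn' := Finset.mem_range.1 hn
    have r1 := mul_le_mul (hw1 n) (bA' n hn') (abs_nonneg _) (mul_nonneg hΔt.le (hη0 n))
    have r2 := mul_le_mul_of_nonneg_left (bAA' n hn') (hγ0 n)
    refine (add_le_add r1 r2).trans_eq ?_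
    ring
  have t2 : ∑ n ∈ Finset.range M, (|γ (n + 1) - Δt * g ((n + 1 : ℕ) * Δt)| * |B' n|
        + γ (n + 1) * |B (n + 1) - B' n|)
      ≤ Δt * c' * (κ * R) * |k| + T * m' * (κ * ((κ ^ 5 * R + κ ^ 3) * (R * Δt))) * |k|
        + κ * (m * ((3 * κ ^ 3 * R + 10 * κ ^ 5 * R ^ 2) * Δx)) * |k| := by
    have s1 : ∑ n ∈ Finset.range M, (Δt * (κ * R * |k|) * η (n + 1)
        + ((κ * ((κ ^ 5 * R + κ ^ 3) * (R * Δt)) * |k|) * γ (n + 1)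
          + (κ * (m * ((3 * κ ^ 3 * R + 10 * κ ^ 5 * R ^ 2) * Δx)) * |k|) * γ (n + 1)))
        ≤ Δt * c' * (κ * R) * |k| + (T * m' * (κ * ((κ ^ 5 * R + κ ^ 3) * (R * Δt))) * |k|
        + κ * (m * ((3 * κ ^ 3 * R + 10 * κ ^ 5 * R ^ 2) * Δx)) * |k|) := by
      rw [Finset.sum_add_distrib, Finset.sum_add_distrib, ← Finset.mul_sum, ← Finset.mul_sum,
        ← Finset.mul_sum]
      refine add_le_add ((mul_le_mul_of_nonneg_left hsη' (by positivity)).trans_eq (by ring))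
        (add_le_add ((mul_le_mul_of_nonneg_left (hsγ'.trans hsγT) (by positivity)).trans_eq
          (by ring)) ((mul_le_mul_of_nonneg_left (hsγ'.trans hsγ1) (by positivity)).trans_eq
          (by ring)))
    rw [add_assoc]
    refine le_trans ?_ s1
    refine Finset.sum_le_sum fun n hn => ?_
    have hn' := Finset.mem_range.1 hn
    have r1 := mul_le_mul (hw0 (n + 1)) (bB' n (by omega)) (abs_nonneg _)
      (mul_nonneg hΔt.le (hη0 (n + 1)))
    have r2 := mul_le_mul_of_nonneg_left (bBB' n hn') (hγ0 (n + 1))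
    refine (add_le_add r1 r2).trans_eq ?_
    ring
  have t3 : γ 0 * |B 0| ≤ Δt * m' * (κ ^ 4 * R) * |k| :=
    (mul_le_mul hγle (bB 0 (by omega)) (abs_nonneg _) (by positivity)).trans_eq (by ring)
  have t4 : Δt * g ((M + 1 : ℕ) * Δt) * |B' M| ≤ Δt * m' * (κ * R) * |k| :=
    (mul_le_mul (mul_le_mul_of_nonneg_left (hg.le _) hΔt.le) (bB' M (by omega)) (abs_nonneg _)
      (by positivity)).trans_eq (by ring)
  refine (add_le_add (add_le_add (add_le_add t1 t2) t3) t4).trans_eq ?_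
  rw [sourceBound]
  ring

/-- A bound of the sum of `fluxJump` over all cells, for coefficient increments at most `R Δx`. -/
def jumpSum (L κ R : ℝ) : ℝ := 6 * L * R + 2 * R ^ 2 * (κ + 2 * L)

lemma tsum_fluxJump_le (hκ : 0 ≤ κ) (hL : 0 ≤ L) {U : ℤ → ℝ} (hU : GridBound Δx R U) :
    ∑' i, fluxJump L κ (R * Δx) U i ≤ jumpSum L κ R := by
  rw [(fluxJump_summable hU.summable).2, jumpSum]
  have hR := hU.nonneg
  have h1 := mul_le_mul_of_nonneg_left hU.tv (show 0 ≤ 6 * L by positivity)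
  have h2 := mul_le_mul_of_nonneg_left hU.l1 (show 0 ≤ 2 * R * (κ + 2 * L) by positivity)
  refine (add_le_add h1 (le_trans (le_of_eq ?_) h2)).trans_eq ?_
  · ring
  · ring

lemma integral_fluxBound_le (hκ : 0 ≤ κ) (hL : 0 ≤ L) (hΔx : 0 < Δx) {U : ℤ → ℝ}
    (hU : GridBound Δx R U) (hφ : IsKernel φ m c) :
    (Integrable fun y => fluxBound L κ R Δx U φ y) ∧
      ∫ y, fluxBound L κ R Δx U φ y ≤ jumpSum L κ R := by
  have hJ := (fluxJump_summable (L := L) (κ := κ) (A₁ := R * Δx) hU.summable).1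
  obtain ⟨h1, h2⟩ := integral_integral_mul_comp_sub (integrable_comp_cell hΔx hJ) hφ.integrable
  refine ⟨h1.const_mul _, ?_⟩
  simp only [fluxBound]
  rw [integral_const_mul, h2, hφ.integral_eq, mul_one, integral_comp_cell hΔx hJ, ← mul_assoc,
    one_div_mul_cancel hΔx.ne', one_mul]
  exact tsum_fluxJump_le hκ hL hU

lemma integral_fluxErrorBound_le (hκ : 0 ≤ κ) (hL : 0 ≤ L) (hΔx : 0 < Δx) {U : ℤ → ℝ}
    (hU : GridBound Δx R U) (hφ : IsKernel φ m c) :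
    (Integrable fun y => fluxErrorBound L κ R Δx U φ y) ∧
      ∫ y, fluxErrorBound L κ R Δx U φ y ≤ (jumpSum L κ R + 3 * κ ^ 4 * R ^ 2) * Δx * c := by
  have hR := hU.nonneg
  have hJ := (fluxJump_summable (L := L) (κ := κ) (A₁ := R * Δx) hU.summable).1
  have hU' := hU.summable.mul_left (3 * κ ^ 3 * R * Δx * κ)
  have hs : Summable fun i => fluxJump L κ (R * Δx) U i + 3 * κ ^ 3 * R * Δx * κ * |U i| :=
    hJ.add hU'
  obtain ⟨h1, h2⟩ := integral_integral_mul_comp_sub (integrable_comp_cell hΔx hs)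
    hφ.integrable_deriv.abs
  refine ⟨h1, h2.trans_le ?_⟩
  rw [integral_comp_cell hΔx hs, hJ.tsum_add hU', tsum_mul_left]
  have h3 : Δx * (∑' i, fluxJump L κ (R * Δx) U i + 3 * κ ^ 3 * R * Δx * κ * ∑' i, |U i|)
      ≤ (jumpSum L κ R + 3 * κ ^ 4 * R ^ 2) * Δx := by
    have e1 := mul_le_mul_of_nonneg_left (tsum_fluxJump_le hκ hL hU) hΔx.le
    have e2 := mul_le_mul_of_nonneg_left hU.l1 (show 0 ≤ 3 * κ ^ 4 * R * Δx by positivity)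
    refine le_trans (le_of_eq ?_) ((add_le_add e1 e2).trans_eq ?_)
    · ring
    · ring
  have h4 : 0 ≤ (jumpSum L κ R + 3 * κ ^ 4 * R ^ 2) * Δx := by
    rw [jumpSum]
    positivity
  exact mul_le_mul h3 hφ.deriv_le (integral_nonneg fun _ => abs_nonneg _) h4

include hb hΔx hΔt hN hT hF hθ hW hφ hg in
/-- The estimate integrated over the centre `y` of the spatial kernel. -/
lemma neg_integral_entropyFunctional_le {v : ℝ → ℝ} {M : ℝ} (hv : Integrable v)
    (hM : ∫ y, |v y| ≤ M)
    (hΛ : Integrable fun y => entropyFunctional f β ν μ T (fun t x => W ⌊t / Δt⌋₊ (cell Δx x))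
        (fun t x => φ (x - y) * g t) (v y)) :
    -∫ y, entropyFunctional f β ν μ T (fun t x => W ⌊t / Δt⌋₊ (cell Δx x))
        (fun t x => φ (x - y) * g t) (v y)
      ≤ Δt * c' * jumpSum L κ R + (jumpSum L κ R + 3 * κ ^ 4 * R ^ 2) * Δx * c
        + sourceBound κ R T Δx Δt m c m' c' * M := by
  have hκ := hb.nonneg
  have hL := lipschitz_nonneg hF
  have hR : 0 ≤ R := (hW.grid 0 (Nat.zero_le _)).nonneg
  have hm' := hg.m_nonneg
  have hc' := hg.c_nonneg
  have hm := hφ.m_nonneg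
  have hc := hφ.c_nonneg
  set γ : ℕ → ℝ := fun n => ∫ t in (n * Δt)..((n + 1 : ℕ) * Δt), g t with hγ
  set η : ℕ → ℝ := fun n => ∫ t in (n * Δt)..((n + 1 : ℕ) * Δt), |deriv g t| with hη
  have hstep : ∀ n : ℕ, (n : ℝ) * Δt ≤ (n + 1 : ℕ) * Δt := fun n => by
    have : (n : ℝ) ≤ (n + 1 : ℕ) := by exact_mod_cast n.le_succ
    gcongr
  have hγ0 : ∀ n, 0 ≤ γ n := fun n =>
    intervalIntegral.integral_nonneg (hstep n) fun x _ => hg.nonneg x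
  have hη0 : ∀ n, 0 ≤ η n := fun n =>
    intervalIntegral.integral_nonneg (hstep n) fun x _ => abs_nonneg _
  have hsγ : ∑ n ∈ Finset.range N, γ n ≤ 1 := hg.sum_integral_le_one hΔt.le _
  have hsη : ∑ n ∈ Finset.range N, η n ≤ c' := hg.sum_integral_abs_deriv_le hΔt.le _
  have i1 : ∀ n ∈ Finset.range N, Integrable fun y => Δt * η n * fluxBound L κ R Δx (W n) φ y :=
    fun n hn => (integral_fluxBound_le hκ hL hΔx (hW.grid n (Finset.mem_range.1 hn).le)
      hφ).1.const_mul _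
  have i2 : ∀ n ∈ Finset.range N, Integrable fun y => γ n * fluxErrorBound L κ R Δx (W n) φ y :=
    fun n hn => (integral_fluxErrorBound_le hκ hL hΔx (hW.grid n (Finset.mem_range.1 hn).le)
      hφ).1.const_mul _
  have i12 : ∀ n ∈ Finset.range N, Integrable fun y => Δt * η n * fluxBound L κ R Δx (W n) φ y
      + γ n * fluxErrorBound L κ R Δx (W n) φ y := fun n hn => (i1 n hn).add (i2 n hn)
  have i3 : Integrable fun y => sourceBound κ R T Δx Δt m c m' c' * |v y| := hv.abs.const_mul _
  have hs0 : 0 ≤ sourceBound κ R T Δx Δt m c m' c' := by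
    rw [sourceBound]
    positivity
  have hJ0 : 0 ≤ jumpSum L κ R := by
    rw [jumpSum]
    positivity
  rw [← integral_neg]
  refine (integral_mono hΛ.neg ((integrable_finsetSum _ i12).add i3)
    fun y => neg_entropyFunctional_le hb hΔx hΔt hN hT hF hθ hW hφ hg y (v y)).trans ?_
  rw [integral_add' (integrable_finsetSum _ i12) i3, integral_finsetSum _ i12, integral_const_mul]
  refine add_le_add ?_ (mul_le_mul_of_nonneg_left hM hs0)
  calc _ ≤ ∑ n ∈ Finset.range N, (Δt * jumpSum L κ R * η n
        + (jumpSum L κ R + 3 * κ ^ 4 * R ^ 2) * Δx * c * γ n) := by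
        refine Finset.sum_le_sum fun n hn => ?_
        have hWn := hW.grid n (Finset.mem_range.1 hn).le
        rw [integral_add (i1 n hn) (i2 n hn), integral_const_mul, integral_const_mul]
        have e1 := mul_le_mul_of_nonneg_left (integral_fluxBound_le hκ hL hΔx hWn hφ).2
          (mul_nonneg hΔt.le (hη0 n))
        have e2 := mul_le_mul_of_nonneg_left (integral_fluxErrorBound_le hκ hL hΔx hWn hφ).2 (hγ0 n)
        refine (add_le_add e1 e2).trans_eq ?_
        ring
    _ ≤ _ := by
        rw [Finset.sum_add_distrib, ← Finset.mul_sum, ← Finset.mul_sum]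
        refine add_le_add ((mul_le_mul_of_nonneg_left hsη (by positivity)).trans_eq (by ring))
          ((mul_le_mul_of_nonneg_left hsγ (by positivity)).trans_eq (by ring))

end Estimate

/-- A function in `C([0, T]; L¹)` is bounded in `L¹`. -/
lemma IsEntropySolution.exists_integral_abs_le {f β ν μ : ℝ → ℝ} {T : ℝ} {u₀ : ℝ → ℝ}
    {u : ℝ → ℝ → ℝ} (hu : IsEntropySolution f β ν μ T u₀ u) :
    ∃ M, 0 ≤ M ∧ ∀ s ∈ Icc 0 T, ∫ y, |u s y| ≤ M := by
  have hcont : ContinuousOn (fun s => ∫ y, |u s y|) (Icc 0 T) := by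
    intro t ht
    refine tendsto_iff_dist_tendsto_zero.2 ?_
    refine squeeze_zero' (Eventually.of_forall fun _ => dist_nonneg) ?_ (hu.continuous t ht)
    filter_upwards [self_mem_nhdsWithin] with s hs
    have is := hu.integrable s hs
    have it := hu.integrable t ht
    rw [Real.dist_eq, ← integral_sub is.abs it.abs]
    exact abs_integral_le_of_abs_le (is.sub it).abs fun y => abs_abs_sub_abs_le_abs_sub _ _
  obtain ⟨M, hM⟩ := isCompact_Icc.bddAbove_image hcont
  exact ⟨max M 0, le_max_right _ _, fun s hs =>
    (hM (mem_image_of_mem _ hs)).trans (le_max_left _ _)⟩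

end NonlocalFV

end

theorem lemma3p3 (f β ν μ : ℝ → ℝ) (hcoef : NonlocalFV.Coefficients f β ν μ)
    (T : ℝ) (hT : 0 < T)
    (u₀ : ℝ → ℝ) (hu₀ : NonlocalFV.InitialDatum u₀)
    (u : ℝ → ℝ → ℝ) (hu : NonlocalFV.IsEntropySolution f β ν μ T u₀ u)
    (ω : ℝ → ℝ) (hω : NonlocalFV.IsMollifier ω) (L : ℝ) :
    ∃ C : ℝ, ∀ (Δx Δt : ℝ) (N : ℕ) (F : ℝ → ℝ → ℝ → ℝ) (θ : ℕ → ℤ → ℝ),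
      0 < Δx → 0 < Δt → (N : ℝ) * Δt = T →
      NonlocalFV.IsMonotoneFlux f ν (Δt / Δx) L F →
      (∀ n p, θ n p ∈ Set.Icc (0 : ℝ) 1) →
      ∀ ε ε₀ : ℝ, 0 < ε → 0 < ε₀ →
        -NonlocalFV.relativeEntropy f β ν μ ω T ε ε₀
            (NonlocalFV.numericalSolution β ν μ F Δx Δt θ u₀) u
          ≤ C * (Δx / ε + Δt / ε₀) := by
  obtain ⟨κ, hb⟩ := hcoef.exists_uniformBound
  obtain ⟨R, hR, hscheme⟩ := NonlocalFV.exists_scheme_bound hb hu₀ T L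
  obtain ⟨M, hM0, hM⟩ := hu.exists_integral_abs_le
  obtain ⟨m, c, hω'⟩ := hω.exists_isKernel
  have hκ := hb.nonneg
  have hm0 : 0 ≤ m := by simpa using (hω' 1 one_pos).m_nonneg
  have hc0 : 0 ≤ c := by simpa using (hω' 1 one_pos).c_nonneg
  -- the coefficients of `Δx / ε` and of `Δt / ε₀`
  set J := NonlocalFV.jumpSum L κ R with hJ
  set a := (J + 3 * κ ^ 4 * R ^ 2) * c + ((2 * R * κ + 3 * κ ^ 4 * R) * c
    + κ * m * (3 * κ ^ 3 * R + 10 * κ ^ 5 * R ^ 2)) * M with ha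
  set b := c * J + (c * (2 * R * κ) + c * (κ * R) + T * m * (κ * ((κ ^ 5 * R + κ ^ 3) * R))
    + m * (κ ^ 4 * R) + m * (κ * R)) * M with hbdef
  refine ⟨T * (a + b), ?_⟩
  intro Δx Δt N F θ hΔx hΔt hN hF hθ ε ε₀ hε hε₀
  have hL := NonlocalFV.lipschitz_nonneg hF
  have hJ0 : 0 ≤ J := by
    rw [hJ, NonlocalFV.jumpSum]
    positivity
  have ha0 : 0 ≤ a := by positivity
  have hb0 : 0 ≤ b := by positivity
  have hX : 0 ≤ Δx / ε := by positivity
  have hY : 0 ≤ Δt / ε₀ := by positivity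
  have hW := hscheme Δx Δt N F θ hΔx hΔt hN hF hθ
  set E : ℝ → ℝ → ℝ := fun s y => NonlocalFV.entropyFunctional f β ν μ T
    (NonlocalFV.numericalSolution β ν μ F Δx Δt θ u₀)
    (fun t x => NonlocalFV.kernel ω ε ε₀ t x s y) (u s y) with hE
  change -∫ q in NonlocalFV.strip T, E q.1 q.2 ≤ _
  have hstrip : (volume.restrict (NonlocalFV.strip T) : Measure (ℝ × ℝ))
      = (volume.restrict (Ioo 0 T)).prod volume := by
    rw [NonlocalFV.strip, Measure.volume_eq_prod, ← Measure.prod_restrict, Measure.restrict_univ]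
  rw [hstrip]
  by_cases hi : Integrable (fun q : ℝ × ℝ => E q.1 q.2) ((volume.restrict (Ioo 0 T)).prod volume)
  swap
  -- the Bochner integral of a non-integrable function is `0`
  · rw [integral_undef hi, neg_zero]
    positivity
  rw [integral_prod _ hi, ← integral_neg]
  have hpt : ∀ᵐ s ∂(volume.restrict (Ioo 0 T)), -∫ y, E s y ≤ a * (Δx / ε) + b * (Δt / ε₀) := by
    filter_upwards [hi.prod_right_ae, ae_restrict_mem measurableSet_Ioo] with s his hs
    have hs' : s ∈ Icc 0 T := Ioo_subset_Icc_self hs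
    refine (NonlocalFV.neg_integral_entropyFunctional_le hb hΔx hΔt hN hT hF hθ hW (hω' ε hε)
      ((hω' ε₀ hε₀).translate s) (hu.integrable s hs') (hM s hs') his).trans (le_of_eq ?_)
    rw [NonlocalFV.sourceBound, ha, hbdef]
    ring
  calc ∫ s in Ioo 0 T, -∫ y, E s y ≤ ∫ _ in Ioo 0 T, (a * (Δx / ε) + b * (Δt / ε₀)) :=
        integral_mono_ae hi.integral_prod_left.neg (integrable_const _) hpt
    _ = T * (a * (Δx / ε) + b * (Δt / ε₀)) := by
        rw [setIntegral_const, Measure.real, Real.volume_Ioo, ENNReal.toReal_ofReal (by linarith),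
          smul_eq_mul, sub_zero]
    _ ≤ T * (a + b) * (Δx / ε + Δt / ε₀) := by
        have h1 := mul_nonneg ha0 hY
        have h2 := mul_nonneg hb0 hX
        rw [mul_assoc]
        refine mul_le_mul_of_nonneg_left ?_ hT.le
        linarith
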